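/- Let $k$ be a field of characteristic zero, $A$ an associative unital $k$-algebra, $M$ an $A$-bimodule (over $k$, i.e. with $k$ acting in the same way on both sides) and $f\colon A\otimes A\to M$ a Hochschild normal $2$-cocycle, i.e. a $k$-bilinear map with $af(b,c)-f(ab,c)+f(a,bc)-f(a,b)c=0$ and $f(1,a)=f(a,1)=0$. Let $E=A\ltimes_f M$ be the square zero extension, i.e. $A\oplus M$ with the product $(a,m)(a',m')=(aa',\,am'+ma'+f(a,a'))$. Write $\overline A=A/k$ and $\overline E=E/k$ (quotients by $k\cdot 1$). Extend $f$ to $E$ by zero on $M$. For $x,y\in A\cup M$ let $xy$ denote the product of $A$ if $x,y\in A$, the action of $A$ on $M$ if exactly one of them is in $M$, and $0$ if both are in $M$. For $0\le w\le n$ let $B^n_w\subseteq\overline E^{\otimes n}$ be the span of the tensors $x_1\otimes\cdots\otimes x_n$ with exactly $w$ of the $x_i$ in $M$ and the others in $\overline A$ ($B_0^0=k$, and $B^n_w=0$ if $n<w$). For $w\ge 0$ and $v\ge 2w$ let $X_v^w=M\otimes B_w^{n}\subseteq E\otimes\overline E^{\otimes n}$, where $n=v-w$, and let $X_v^w=0$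 otherwise. For an elementary tensor $x=x_0\otimes\cdots\otimes x_n\in X_v^w$ with all $x_i\in A\cup M$, let $i(x)$ be the last index $i$ with $x_i\in M$ and put $$b(x)=\sum_{j=0}^{n-1}(-1)^j x_0\otimes\cdots\otimes x_jx_{j+1}\otimes\cdots\otimes x_n+(-1)^n x_nx_0\otimes x_1\otimes\cdots\otimes x_{n-1}\in X_{v-1}^w\quad(b=0\text{ if }n=0),$$ $$t(x)=(-1)^{i(x)n}x_{i(x)}\otimes\cdots\otimes x_n\otimes x_0\otimes\cdots\otimes x_{i(x)-1}\in X_v^w,\qquad N=\sum_{l=0}^{w}t^l\colon X_v^w\to X_v^w,$$ $$F_j(x)=(-1)^jx_0\otimes\cdots\otimes f(x_j,x_{j+1})\otimes\cdots\otimes x_n,$$ $$d(x)=\sum_{j=1}^{n-1}F_j(x)\in X_v^{w+1},\qquad d'(x)=-d(x)-\sum_{j=i(x)+1}^{n-1}t(F_j(x))\in X_v^{w+1}.$$ For $w\ge0$ and $v\ge2w$ let $\hat X_v^w=X_v^w\oplus X_{v-1}^w$ ($\hat X_v^w=0$ otherwise), and define $\hat b\colon\hat X_v^w\to\hat X_{v-1}^w$,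 $\hat d\colon\hat X_v^w\to\hat X_v^{w+1}$ and $\hat B\colon\hat X_v^w\to\hat X_{v+1}^w$ by $$\hat b(x,y)=(b(x)+(\mathrm{id}-t)(y),-b(y)),\qquad \hat d(x,y)=(d(x),d'(y)),\qquad \hat B(x,y)=(0,N(x)).$$ Then: (1) $(\hat X,\hat b,\hat d,\hat B)$ is a double mixed complex: $\hat b$, $\hat d$ and $\hat B$ have square zero and anticommute with each other. (2) The Hochschild, cyclic, periodic and negative homologies of $(\hat X,\hat b,\hat d,\hat B)$ are the corresponding homologies of $E$ relative to $M$. More precisely, let $(\breve X,\breve b,\breve B)$ be the associated mixed complex, with $\breve X_n=\prod_w\hat X_{n+w}^w$, $\breve b=\hat b+\hat d$ and $\breve B=\hat B$. Then there is a morphism of mixed complexes from $(\breve X,\breve b,\breve B)$ to $$\ker\bigl((E\otimes\overline E^{\otimes *},b,B)\to(A\otimes\overline A^{\otimes *},b,B)\bigr),$$ the kernel of the morphism of normalized mixed complexes induced by the projection $E\to A=E/M$, which induces isomorphisms on $\mathrm{HH}_n$, $\mathrm{HC}_n$, $\mathrm{HP}_n$ and $\mathrm{HN}_n$ for all $n\in\mathbb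 Z$. For a mixed complex $(Y,b,B)$ with $Y_q=0$ for $q<0$, $\mathrm{HH}$ is the homology of $(Y,b)$, and $\mathrm{HC}$, $\mathrm{HP}$ and $\mathrm{HN}$ are the homologies, with respect to $b+B$, of the total complexes with degree $n$ parts $\prod_{p\ge0}Y_{n-2p}$, $\prod_{p\in\mathbb Z}Y_{n-2p}$ and $\prod_{p\le0}Y_{n-2p}$, respectively (for $\mathrm{HC}$, the component of $B$ leaving the columns $p\ge 0$ is dropped). -/

import Mathlib

open scoped TensorProduct

noncomputable section

/-! ## Mixed complexes, their four homologies, and double mixed complexes -/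

/-- The data `(X, b, B)` of a mixed complex over `k`, graded by `n ≥ 0`, before imposing
the identities. -/
structure MixedDiagram (k : Type*) [CommRing k] where
  /-- the module in degree `n` -/
  X : ℕ → Type*
  [addCommGroup : ∀ n, AddCommGroup (X n)]
  [module : ∀ n, Module k (X n)]
  /-- the boundary map, of degree `-1` (it is zero on `X 0`) -/
  b : ∀ n, X (n + 1) →ₗ[k] X n
  /-- the Connes operator, of degree `+1` -/
  B : ∀ n, X n →ₗ[k] X (n + 1)

attribute [instance] MixedDiagram.addCommGroup MixedDiagram.module

namespace MixedDiagram

variable {k : Type*} [CommRing k]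

/-- The operator `b + B` on the product of all the `X m`. -/
def bPlusB (C : MixedDiagram k) : (∀ m, C.X m) →ₗ[k] (∀ m, C.X m) :=
  LinearMap.pi fun m => match m with
    | 0 => C.b 0 ∘ₗ LinearMap.proj 1
    | m + 1 => C.b (m + 1) ∘ₗ LinearMap.proj (m + 2) + C.B m ∘ₗ LinearMap.proj m

/-- The double complex `BP(X)` has entry `X m` in column `p` and row `m + p`, for `m ≥ 0` and
`p ∈ ℤ`, so that entry contributes to total degree `n = m + 2 p`. Given a set `J` of columns,
`entries J n` is the set of all `m` such that the entry `X m` of total degree `n` lies in one of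
the columns in `J`. -/
def entries (J : Set ℤ) (n : ℤ) : Set ℕ := {m | ∃ p ∈ J, (m : ℤ) + 2 * p = n}

/-- The degree `n` part of the (product) total complex of the columns in `J` of `BP(X)`: the
product of the entries of total degree `n`, seen as the families in `∏ₘ X m` which
vanish at the other indices. -/
def tot (C : MixedDiagram k) (J : Set ℤ) (n : ℤ) : Submodule k (∀ m, C.X m) where
  carrier := {x | ∀ m, m ∉ entries J n → x m = 0}
  add_mem' := fun hx hy m hm => by simp [hx m hm, hy m hm]
  zero_mem' := fun _ _ => rfl
  smul_mem' := fun c x hx m hm => by simp [hx m hm]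

open scoped Classical in
/-- The projection of `∏ₘ X m` onto the degree `n` part of the total complex of the columns
in `J`. -/
def truncate (C : MixedDiagram k) (J : Set ℤ) (n : ℤ) : (∀ m, C.X m) →ₗ[k] (∀ m, C.X m) :=
  LinearMap.pi fun m => if m ∈ entries J n then LinearMap.proj m else 0

/-- The cycles of degree `n` of the total complex of the columns in `J`: the elements `x` of
degree `n` whose boundary `(b + B) x` is zero in degree `n - 1`. The components of `b + B` which
leave the columns in `J` are dropped. -/
def cycles (C : MixedDiagram k) (J : Set ℤ) (n : ℤ) : Submodule k (∀ m, C.X m) :=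
  C.tot J n ⊓ LinearMap.ker (C.truncate J (n - 1) ∘ₗ C.bPlusB)

/-- The boundaries of degree `n` of the total complex of the columns in `J`: the images of the
elements of degree `n + 1` under `b + B`, whose components which leave the columns in `J` are
dropped. -/
def boundaries (C : MixedDiagram k) (J : Set ℤ) (n : ℤ) : Submodule k (∀ m, C.X m) :=
  (C.tot J (n + 1)).map (C.truncate J n ∘ₗ C.bPlusB)

/-- The degree `n` homology of the total complex of the columns in `J` of `BP(X)`:
cycles modulo boundaries. -/
abbrev homology (C : MixedDiagram k) (J : Set ℤ) (n : ℤ) : Type _ :=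
  C.cycles J n ⧸ (C.boundaries J n).comap (C.cycles J n).subtype

/-- A morphism of mixed complexes. -/
structure Hom (C D : MixedDiagram k) where
  /-- the component in degree `n` -/
  f : ∀ n, C.X n →ₗ[k] D.X n
  comm_b : ∀ n, f n ∘ₗ C.b n = D.b n ∘ₗ f (n + 1)
  comm_B : ∀ n, f (n + 1) ∘ₗ C.B n = D.B n ∘ₗ f n

namespace Hom

variable {C D : MixedDiagram k} (φ : Hom C D)

/-- The map induced on the products of all the components. -/
def prodMap : (∀ m, C.X m) →ₗ[k] (∀ m, D.X m) :=
  LinearMap.pi fun m => φ.f m ∘ₗ LinearMap.proj m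

theorem prodMap_mem (J : Set ℤ) (n : ℤ) : ∀ x ∈ C.tot J n, φ.prodMap x ∈ D.tot J n := by
  intro x hx m hm
  simp [prodMap, hx m hm]

theorem prodMap_bPlusB (x : ∀ m, C.X m) :
    φ.prodMap (C.bPlusB x) = D.bPlusB (φ.prodMap x) := by
  funext m
  cases m with
  | zero => exact LinearMap.congr_fun (φ.comm_b 0) (x 1)
  | succ m =>
    have h1 := LinearMap.congr_fun (φ.comm_b (m + 1)) (x (m + 2))
    have h2 := LinearMap.congr_fun (φ.comm_B m) (x m)
    simp only [LinearMap.comp_apply] at h1 h2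
    simp [prodMap, bPlusB, h1, h2]

theorem prodMap_truncate (J : Set ℤ) (n : ℤ) (x : ∀ m, C.X m) :
    φ.prodMap (C.truncate J n x) = D.truncate J n (φ.prodMap x) := by
  funext m
  by_cases hm : m ∈ entries J n <;> simp [prodMap, truncate, hm]

/-- The map induced on cycles. -/
def cyclesMap (J : Set ℤ) (n : ℤ) : C.cycles J n →ₗ[k] D.cycles J n :=
  φ.prodMap.restrict (by
    rintro x ⟨hx, hx'⟩
    have h0 : C.truncate J (n - 1) (C.bPlusB x) = 0 := hx'
    refine ⟨φ.prodMap_mem J n x hx, ?_⟩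
    change D.truncate J (n - 1) (D.bPlusB (φ.prodMap x)) = 0
    rw [← φ.prodMap_bPlusB, ← φ.prodMap_truncate, h0, map_zero])

/-- The map induced by a morphism of mixed complexes on the homologies of the total complexes of
the columns in `J`. -/
def homologyMap (J : Set ℤ) (n : ℤ) : C.homology J n →ₗ[k] D.homology J n :=
  Submodule.mapQ _ _ (φ.cyclesMap J n) (by
    rintro x ⟨y, hy, hxy⟩
    have h0 : C.truncate J n (C.bPlusB y) = x.1 := hxy
    refine ⟨φ.prodMap y, φ.prodMap_mem J (n + 1) y hy, ?_⟩
    change D.truncate J n (D.bPlusB (φ.prodMap y)) = φ.prodMap x.1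
    rw [← φ.prodMap_bPlusB, ← φ.prodMap_truncate, h0])

end Hom

/-- The columns giving the Hochschild homology: column `0` of `BP(X)` is the complex `(X, b)`. -/
def colsHH : Set ℤ := {0}

/-- The columns of `BC(X)`, giving the cyclic homology. -/
def colsHC : Set ℤ := {p | 0 ≤ p}

/-- The columns of `BP(X)`, giving the periodic homology. -/
def colsHP : Set ℤ := Set.univ

/-- The columns of `BN(X)`, giving the negative homology. -/
def colsHN : Set ℤ := {p | p ≤ 0}

/-- Hochschild homology of a mixed complex. -/
abbrev HH (C : MixedDiagram k) (n : ℤ) : Type _ := C.homology colsHH n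
/-- Cyclic homology of a mixed complex. -/
abbrev HC (C : MixedDiagram k) (n : ℤ) : Type _ := C.homology colsHC n
/-- Periodic homology of a mixed complex. -/
abbrev HP (C : MixedDiagram k) (n : ℤ) : Type _ := C.homology colsHP n
/-- Negative homology of a mixed complex. -/
abbrev HN (C : MixedDiagram k) (n : ℤ) : Type _ := C.homology colsHN n

namespace Hom

variable {C D : MixedDiagram k} (φ : Hom C D) (n : ℤ)

/-- The map induced on Hochschild homology. -/
abbrev mapHH : C.HH n →ₗ[k] D.HH n := φ.homologyMap colsHH n
/-- The map induced on cyclic homology. -/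
abbrev mapHC : C.HC n →ₗ[k] D.HC n := φ.homologyMap colsHC n
/-- The map induced on periodic homology. -/
abbrev mapHP : C.HP n →ₗ[k] D.HP n := φ.homologyMap colsHP n
/-- The map induced on negative homology. -/
abbrev mapHN : C.HN n →ₗ[k] D.HN n := φ.homologyMap colsHN n

end Hom

end MixedDiagram

/-- The data `(X, δ, ∂, B)` of a double mixed complex whose nonzero objects `X_v^w` satisfy
`v ≥ w ≥ 0`. As a bigraded module `X_v^w` has bidegree `(-w, v)`. The object `X_v^w` is written
`X w n`, where `n = v - w` is the total degree. So `δ : X_v^w → X_{v-1}^w` fixes the first degree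
and lowers the second one, `∂ : X_v^w → X_v^{w+1}` lowers the first degree and fixes the second
one, and `B : X_v^w → X_{v+1}^w` fixes the first degree and increases the second one. -/
structure DoubleMixedDiagram (k : Type*) [CommRing k] where
  /-- `X w n` is the object `X_v^w`, with `v = n + w` -/
  X : ℕ → ℕ → Type*
  [addCommGroup : ∀ w n, AddCommGroup (X w n)]
  [module : ∀ w n, Module k (X w n)]
  /-- the map `X_v^w → X_{v-1}^w` -/
  δ : ∀ w n, X w (n + 1) →ₗ[k] X w n
  /-- the map `X_v^w → X_v^{w+1}` -/
  del : ∀ w n, X w (n + 1) →ₗ[k] X (w + 1) n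
  /-- the map `X_v^w → X_{v+1}^w` -/
  B : ∀ w n, X w n →ₗ[k] X w (n + 1)

attribute [instance] DoubleMixedDiagram.addCommGroup DoubleMixedDiagram.module

namespace DoubleMixedDiagram

variable {k : Type*} [CommRing k]

/-- `(X, δ, ∂, B)` is a double mixed complex if the three maps have square zero and
anticommute with each other. -/
structure IsDoubleMixedComplex (C : DoubleMixedDiagram k) : Prop where
  δ_δ : ∀ w n, C.δ w n ∘ₗ C.δ w (n + 1) = 0
  del_del : ∀ w n, C.del (w + 1) n ∘ₗ C.del w (n + 1) = 0
  B_B : ∀ w n, C.B w (n + 1) ∘ₗ C.B w n = 0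
  δ_del : ∀ w n, C.δ (w + 1) n ∘ₗ C.del w (n + 1) + C.del w n ∘ₗ C.δ w (n + 1) = 0
  δ_B_zero : ∀ w, C.δ w 0 ∘ₗ C.B w 0 = 0
  δ_B : ∀ w n, C.δ w (n + 1) ∘ₗ C.B w (n + 1) + C.B w n ∘ₗ C.δ w n = 0
  del_B_zero : ∀ w, C.del w 0 ∘ₗ C.B w 0 = 0
  del_B : ∀ w n, C.del w (n + 1) ∘ₗ C.B w (n + 1) + C.B (w + 1) n ∘ₗ C.del w n = 0

/-- The associated mixed complex `(X, δ + ∂, B)`, where `(X, δ + ∂)` is the (product) total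
complex of `(X, δ, ∂)`. -/
def assoc (C : DoubleMixedDiagram k) : MixedDiagram k where
  X n := ∀ w, C.X w n
  b n := LinearMap.pi fun w => match w with
    | 0 => C.δ 0 n ∘ₗ LinearMap.proj 0
    | w + 1 => C.δ (w + 1) n ∘ₗ LinearMap.proj (w + 1) + C.del w n ∘ₗ LinearMap.proj w
  B n := LinearMap.pi fun w => C.B w n ∘ₗ LinearMap.proj w

end DoubleMixedDiagram

/-! ## Operations on tensor powers -/

section Tensor

variable {k : Type*} [CommRing k] {V : Type*} [AddCommGroup V] [Module k V]

/-- For a bilinear map `β` on `V`, the tuple `(x_0, …, β(x_j, x_{j+1}), …, x_{n+1})`. -/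
def contractFun (β : V →ₗ[k] V →ₗ[k] V) {n : ℕ} (j : Fin (n + 1)) (x : Fin (n + 2) → V)
    (l : Fin (n + 1)) : V :=
  if l < j then x l.castSucc else if l = j then β (x l.castSucc) (x l.succ) else x l.succ

theorem predAbove_val {n : ℕ} (j : Fin (n + 1)) (i : Fin (n + 2)) :
    (j.predAbove i : ℕ) = if (j : ℕ) < i then (i : ℕ) - 1 else i := by
  unfold Fin.predAbove
  by_cases h : j.castSucc < i
  · have h' : (j : ℕ) < i := h
    simp [h, h']
  · have h' : ¬ (j : ℕ) < i := h
    simp [h, h']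

theorem contractFun_update (β : V →ₗ[k] V →ₗ[k] V) {n : ℕ} (j : Fin (n + 1))
    (x : Fin (n + 2) → V) (i : Fin (n + 2)) :
    ∃ g : V →ₗ[k] V, ∀ a, contractFun β j (Function.update x i a) =
      Function.update (contractFun β j x) (j.predAbove i) (g a) := by
  rcases lt_trichotomy (i : ℕ) (j : ℕ) with h | h | h
  · refine ⟨LinearMap.id, fun a => funext fun l => ?_⟩
    simp only [contractFun, Function.update_apply, Fin.ext_iff, Fin.lt_def, predAbove_val,
      Fin.val_castSucc, Fin.val_succ]
    split_ifs <;> first | rfl | omega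
  · have h1 : i = j.castSucc := Fin.ext h
    subst h1
    refine ⟨β.flip (x j.succ), fun a => funext fun l => ?_⟩
    by_cases hl : l = j
    · subst hl
      have : l.succ ≠ l.castSucc := by simp [Fin.ext_iff]
      simp only [contractFun, Fin.predAbove_castSucc_self, lt_irrefl, if_false, if_true,
        Function.update_self, Function.update_of_ne this, LinearMap.flip_apply]
    · have hl' : (l : ℕ) ≠ j := fun e => hl (Fin.ext e)
      simp only [contractFun, Function.update_apply, Fin.ext_iff, Fin.lt_def, predAbove_val,
        Fin.val_castSucc, Fin.val_succ]
      split_ifs <;> first | rfl | omega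
  · by_cases h1 : (i : ℕ) = j + 1
    · have h1 : i = j.succ := Fin.ext h1
      subst h1
      refine ⟨β (x j.castSucc), fun a => funext fun l => ?_⟩
      by_cases hl : l = j
      · subst hl
        have : l.castSucc ≠ l.succ := by simp [Fin.ext_iff]
        simp only [contractFun, Fin.predAbove_succ_self, lt_irrefl, if_false, if_true,
          Function.update_self, Function.update_of_ne this]
      · have hl' : (l : ℕ) ≠ j := fun e => hl (Fin.ext e)
        simp only [contractFun, Function.update_apply, Fin.ext_iff, Fin.lt_def, predAbove_val,
          Fin.val_castSucc, Fin.val_succ]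
        split_ifs <;> first | rfl | omega
    · refine ⟨LinearMap.id, fun a => funext fun l => ?_⟩
      simp only [contractFun, Function.update_apply, Fin.ext_iff, Fin.lt_def, predAbove_val,
        Fin.val_castSucc, Fin.val_succ]
      split_ifs <;> first | rfl | omega

/-- The linear map `x_0 ⊗ ⋯ ⊗ x_{n+1} ↦ x_0 ⊗ ⋯ ⊗ β(x_j, x_{j+1}) ⊗ ⋯ ⊗ x_{n+1}`. -/
def contract (β : V →ₗ[k] V →ₗ[k] V) {n : ℕ} (j : Fin (n + 1)) :
    (⨂[k] _ : Fin (n + 2), V) →ₗ[k] ⨂[k] _ : Fin (n + 1), V :=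
  PiTensorProduct.lift (MultilinearMap.mk' (fun x => PiTensorProduct.tprod k (contractFun β j x))
    (fun x i a a' => by
      obtain ⟨g, hg⟩ := contractFun_update β j x i
      simp only [hg, map_add, MultilinearMap.map_update_add])
    (fun x i c a => by
      obtain ⟨g, hg⟩ := contractFun_update β j x i
      simp only [hg, map_smul, MultilinearMap.map_update_smul]))

@[simp] theorem contract_tprod (β : V →ₗ[k] V →ₗ[k] V) {n : ℕ} (j : Fin (n + 1))
    (x : Fin (n + 2) → V) :
    contract β j (PiTensorProduct.tprod k x) = PiTensorProduct.tprod k (contractFun β j x) := by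
  simp [contract]

/-- The cyclic rotation
`x_0 ⊗ ⋯ ⊗ x_n ↦ x_i ⊗ ⋯ ⊗ x_n ⊗ x_0 ⊗ ⋯ ⊗ x_{i-1}`
(addition in `Fin (n + 1)` is modulo `n + 1`). -/
def rotate (k : Type*) [CommRing k] (V : Type*) [AddCommGroup V] [Module k V] {n : ℕ}
    (i : Fin (n + 1)) : (⨂[k] _ : Fin (n + 1), V) →ₗ[k] ⨂[k] _ : Fin (n + 1), V :=
  (PiTensorProduct.reindex k (fun _ => V) (Equiv.addRight i).symm).toLinearMap

@[simp] theorem rotate_tprod {n : ℕ} (i : Fin (n + 1)) (x : Fin (n + 1) → V) :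
    rotate k V i (PiTensorProduct.tprod k x) = PiTensorProduct.tprod k fun l => x (l + i) := by
  simp [rotate]

/-- The Hochschild boundary map formula with respect to a bilinear product `β`:
`x_0 ⊗ ⋯ ⊗ x_{n+1} ↦ ∑_{j ≤ n} (-1)^j x_0 ⊗ ⋯ ⊗ β(x_j, x_{j+1}) ⊗ ⋯ ⊗ x_{n+1}
  + (-1)^{n+1} β(x_{n+1}, x_0) ⊗ x_1 ⊗ ⋯ ⊗ x_n`. -/
def hochschildB (β : V →ₗ[k] V →ₗ[k] V) (n : ℕ) :
    (⨂[k] _ : Fin (n + 2), V) →ₗ[k] ⨂[k] _ : Fin (n + 1), V :=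
  ∑ j : Fin (n + 1), (-1 : k) ^ (j : ℕ) • contract β j
    + (-1 : k) ^ (n + 1) • (contract β 0 ∘ₗ rotate k V (Fin.last (n + 1)))

/-- The linear map `x_0 ⊗ ⋯ ⊗ x_n ↦ e ⊗ x_0 ⊗ ⋯ ⊗ x_n`. -/
def prepend (e : V) (n : ℕ) :
    (⨂[k] _ : Fin (n + 1), V) →ₗ[k] ⨂[k] _ : Fin (n + 2), V :=
  PiTensorProduct.lift ((PiTensorProduct.tprod k (s := fun _ : Fin (n + 2) => V)).curryLeft e)

@[simp] theorem prepend_tprod (e : V) (n : ℕ) (x : Fin (n + 1) → V) :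
    prepend e n (PiTensorProduct.tprod k x) =
      PiTensorProduct.tprod k (Fin.cons e x : Fin (n + 2) → V) := by
  simp [prepend]

/-- The Connes operator formula (on normalized chains):
`x_0 ⊗ ⋯ ⊗ x_n ↦ ∑_{i ≤ n} (-1)^{i n} e ⊗ x_i ⊗ ⋯ ⊗ x_n ⊗ x_0 ⊗ ⋯ ⊗ x_{i-1}`. -/
def connesB (e : V) (n : ℕ) : (⨂[k] _ : Fin (n + 1), V) →ₗ[k] ⨂[k] _ : Fin (n + 2), V :=
  ∑ i : Fin (n + 1), (-1 : k) ^ ((i : ℕ) * n) • (prepend e n ∘ₗ rotate k V i)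

variable (k) in
/-- The submodule of degenerate chains, spanned by the `x_0 ⊗ ⋯ ⊗ x_n` such that `x_i = e` for
some `i ≥ 1`. -/
def degenerate (e : V) (n : ℕ) : Submodule k (⨂[k] _ : Fin (n + 1), V) :=
  Submodule.span k {z | ∃ x : Fin (n + 1) → V, (∃ i, i ≠ 0 ∧ x i = e) ∧
    PiTensorProduct.tprod k x = z}

theorem tprod_mem_degenerate (e : V) {n : ℕ} (x : Fin (n + 1) → V) (i : Fin (n + 1)) (hi : i ≠ 0)
    (h : x i = e) : PiTensorProduct.tprod k x ∈ degenerate k e n :=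
  Submodule.subset_span ⟨x, ⟨i, hi, h⟩, rfl⟩

theorem degenerate_le {e : V} {n : ℕ} {W : Submodule k (⨂[k] _ : Fin (n + 1), V)}
    (h : ∀ (x : Fin (n + 1) → V) (i : Fin (n + 1)), i ≠ 0 → x i = e →
      PiTensorProduct.tprod k x ∈ W) : degenerate k e n ≤ W := by
  refine Submodule.span_le.2 ?_
  rintro z ⟨x, ⟨i, hi, hx⟩, rfl⟩
  exact h x i hi hx

theorem connesB_degenerate (e : V) (n : ℕ) :
    degenerate k e n ≤ (degenerate k e (n + 1)).comap (connesB e n) := by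
  refine degenerate_le fun x i hi hx => ?_
  simp only [Submodule.mem_comap, connesB, LinearMap.sum_apply, LinearMap.smul_apply,
    LinearMap.comp_apply, rotate_tprod, prepend_tprod]
  refine Submodule.sum_mem _ fun j _ => Submodule.smul_mem _ _ ?_
  refine tprod_mem_degenerate e _ (i - j).succ (Fin.succ_ne_zero _) ?_
  simp [hx]

/-- If `x_i = e` and the `j`-th contraction does not involve `x_i`, then the result is
degenerate. -/
theorem contract_mem_degenerate (β : V →ₗ[k] V →ₗ[k] V) (e : V) {n : ℕ} (j : Fin (n + 1))
    (x : Fin (n + 2) → V) (i : Fin (n + 2)) (hi : i ≠ 0) (hx : x i = e)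
    (h1 : i ≠ j.castSucc) (h2 : i ≠ j.succ) :
    PiTensorProduct.tprod k (contractFun β j x) ∈ degenerate k e n := by
  have h1' : (i : ℕ) ≠ j := fun h => h1 (Fin.ext h)
  have h2' : (i : ℕ) ≠ j + 1 := fun h => h2 (Fin.ext h)
  have h0 : (i : ℕ) ≠ 0 := fun h => hi (Fin.ext h)
  rcases lt_or_gt_of_ne h1' with h | h
  · refine tprod_mem_degenerate e _ ⟨i, by omega⟩ (fun e => h0 (congrArg Fin.val e)) ?_
    rw [← hx, contractFun, if_pos (by exact h)]
    rfl
  · obtain ⟨m, rfl⟩ := Fin.exists_succ_eq.2 hi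
    have hm : (j : ℕ) < m := by
      simp only [Fin.val_succ] at h h2'
      omega
    refine tprod_mem_degenerate e _ m (fun e => ?_) ?_
    · simp [e] at hm
    · rw [← hx, contractFun, if_neg (fun h' => ?_), if_neg (fun h' => ?_)]
      · rw [h'] at hm
        exact lt_irrefl _ hm
      · have : (m : ℕ) < j := h'
        omega

/-- Contractions along a bilinear map vanishing at the unit preserve degenerate chains. -/
theorem contract_degenerate (β : V →ₗ[k] V →ₗ[k] V) (e : V) (h1 : ∀ v, β e v = 0)
    (h2 : ∀ v, β v e = 0) {n : ℕ} (j : Fin (n + 1)) :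
    degenerate k e (n + 1) ≤ (degenerate k e n).comap (contract β j) := by
  refine degenerate_le fun x i hi hx => ?_
  rw [Submodule.mem_comap, contract_tprod]
  by_cases h : i = j.castSucc ∨ i = j.succ
  · have h0 : contractFun β j x j = 0 := by
      rcases h with rfl | rfl <;> simp [contractFun, hx, h1, h2]
    rw [MultilinearMap.map_coord_zero _ j h0]
    exact Submodule.zero_mem _
  · exact contract_mem_degenerate β e j x i hi hx (fun h' => h (Or.inl h'))
      (fun h' => h (Or.inr h'))

theorem succ_add_last {n : ℕ} (l : Fin (n + 1)) : l.succ + Fin.last (n + 1) = l.castSucc := by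
  have h : (l.castSucc + 1) + Fin.last (n + 1) = l.castSucc := by
    have h1 : (1 : Fin (n + 2)) + Fin.last (n + 1) = 0 :=
      (add_comm _ _).trans (Fin.last_add_one (n + 1))
    rw [add_assoc l.castSucc, h1, add_zero]
  rwa [Fin.coeSucc_eq_succ] at h

/-- The Hochschild boundary of a unital product preserves degenerate chains. -/
theorem hochschildB_degenerate (β : V →ₗ[k] V →ₗ[k] V) (e : V) (h1 : ∀ v, β e v = v)
    (h2 : ∀ v, β v e = v) (n : ℕ) :
    degenerate k e (n + 1) ≤ (degenerate k e n).comap (hochschildB β n) := by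
  refine degenerate_le fun x i hi hx => ?_
  simp only [Submodule.mem_comap, hochschildB, LinearMap.add_apply, LinearMap.sum_apply,
    LinearMap.smul_apply, LinearMap.comp_apply, rotate_tprod, contract_tprod]
  obtain ⟨m, rfl⟩ := Fin.exists_succ_eq.2 hi
  induction m using Fin.lastCases with
  | last =>
    rw [Fin.sum_univ_castSucc, add_assoc]
    refine Submodule.add_mem _ (Submodule.sum_mem _ fun j _ => Submodule.smul_mem _ _ ?_) ?_
    · refine contract_mem_degenerate β e _ x _ hi hx (fun h => ?_) (fun h => ?_) <;>
        · have := congrArg Fin.val h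
          have hj := j.isLt
          simp at this
          try omega
    · have e1 : contractFun β (Fin.last n) x = fun l => x l.castSucc := by
        funext l
        rcases (Fin.le_last l).lt_or_eq with h | h
        · simp [contractFun, h]
        · subst h
          simp only [contractFun, lt_irrefl, if_false, if_true]
          rw [hx, h2]
      have e2 : contractFun β 0 (fun l => x (l + Fin.last (n + 1))) = fun l => x l.castSucc := by
        funext l
        by_cases h : l = 0
        · subst h
          simp only [contractFun, lt_irrefl, if_false, if_true, succ_add_last]
          rw [← Fin.succ_last, Fin.castSucc_zero, zero_add, hx, h1]
        · simp [contractFun, h, succ_add_last]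
      rw [e1, e2, Fin.val_last, pow_succ, mul_neg_one, neg_smul, add_neg_cancel]
      exact Submodule.zero_mem _
  | cast m =>
    refine Submodule.add_mem _ ?_ (Submodule.smul_mem _ _ ?_)
    · rw [← Finset.add_sum_erase Finset.univ _ (Finset.mem_univ m.castSucc),
        ← Finset.add_sum_erase (Finset.univ.erase m.castSucc) _
          (Finset.mem_erase.2 ⟨(Fin.castSucc_lt_succ (i := m)).ne', Finset.mem_univ m.succ⟩),
        ← add_assoc]
      refine Submodule.add_mem _ ?_
        (Submodule.sum_mem _ fun j hj => Submodule.smul_mem _ _ ?_)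
      · have e1 : contractFun β m.castSucc x = contractFun β m.succ x := by
          have hx' : x m.succ.castSucc = e := hx
          funext l
          rcases lt_trichotomy (l : ℕ) (m : ℕ) with h | h | h
          · have a1 : l < m.castSucc := h
            have a2 : l < m.succ := by simp only [Fin.lt_def, Fin.val_succ]; omega
            simp [contractFun, a1, a2]
          · have a1 : l = m.castSucc := Fin.ext h
            subst a1
            have a2 : m.castSucc < m.succ := Fin.castSucc_lt_succ
            simp only [contractFun, lt_irrefl, if_false, if_true, a2]
            rw [hx, h2]
          · by_cases h' : (l : ℕ) = m + 1
            · have a1 : l = m.succ := Fin.ext h'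
              subst a1
              have a2 : ¬ m.succ < m.castSucc := by simp [Fin.lt_def]
              have a3 : m.succ ≠ m.castSucc := by simp [Fin.ext_iff]
              simp only [contractFun, lt_irrefl, if_false, if_true, a2, a3]
              rw [hx', h1]
            · have a1 : ¬ l < m.castSucc := fun q => by
                have : (l : ℕ) < m := q
                omega
              have a2 : l ≠ m.castSucc := fun q => by
                have : (l : ℕ) = m := congrArg Fin.val q
                omega
              have a3 : ¬ l < m.succ := fun q => by
                have : (l : ℕ) < m + 1 := q
                omega
              have a4 : l ≠ m.succ := fun q => h' (congrArg Fin.val q)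
              simp [contractFun, a1, a2, a3, a4]
        rw [e1, Fin.val_castSucc, Fin.val_succ, pow_succ, mul_neg_one, neg_smul, add_neg_cancel]
        exact Submodule.zero_mem _
      · simp only [Finset.mem_erase, Finset.mem_univ, and_true] at hj
        refine contract_mem_degenerate β e _ x _ hi hx (fun h => hj.1 ?_) (fun h => hj.2 ?_)
        · have := congrArg Fin.val h
          simp only [Fin.val_succ, Fin.val_castSucc] at this
          exact Fin.ext (by simp only [Fin.val_succ]; omega)
        · exact (Fin.succ_injective _ h).symm
    · refine contract_mem_degenerate β e 0 _ m.succ.succ (Fin.succ_ne_zero _) ?_ ?_ ?_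
      · rw [succ_add_last]
        exact hx
      · simp [Fin.ext_iff]
      · simp [Fin.ext_iff]

end Tensor

/-! ## The normalized mixed complex of an algebra, and its relative version -/

section Hochschild

variable (k : Type*) [CommRing k] (R : Type*) [Ring R] [Algebra k R]

/-- The normalized Hochschild chains `R ⊗ (R/k)^{⊗ n}`, as the quotient of `R^{⊗ (n + 1)}` by
the degenerate chains. -/
abbrev NormChains (n : ℕ) : Type _ := (⨂[k] _ : Fin (n + 1), R) ⧸ degenerate k (1 : R) n

/-- The normalized mixed complex `(R ⊗ (R/k)^{⊗ *}, b, B)` of the algebra `R`. -/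
def hochschildMixed : MixedDiagram k where
  X n := NormChains k R n
  b n := Submodule.mapQ _ _ (hochschildB (LinearMap.mul k R) n)
    (hochschildB_degenerate _ _ (fun v => by simp) (fun v => by simp) n)
  B n := Submodule.mapQ _ _ (connesB (1 : R) n) (connesB_degenerate _ n)

variable {k R} {S : Type*} [Ring S] [Algebra k S] (g : R →ₐ[k] S)

/-- The map induced by an algebra morphism on tensor powers. -/
def tensorMap (n : ℕ) : (⨂[k] _ : Fin n, R) →ₗ[k] ⨂[k] _ : Fin n, S :=
  PiTensorProduct.map fun _ => g.toLinearMap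

theorem tensorMap_tprod {n : ℕ} (x : Fin n → R) :
    tensorMap g n (PiTensorProduct.tprod k x) = PiTensorProduct.tprod k fun i => g (x i) := by
  simp [tensorMap]

theorem tensorMap_hochschildB (n : ℕ) :
    tensorMap g (n + 1) ∘ₗ hochschildB (LinearMap.mul k R) n =
      hochschildB (LinearMap.mul k S) n ∘ₗ tensorMap g (n + 2) := by
  have key : ∀ (j : Fin (n + 1)) (x : Fin (n + 2) → R),
      (fun i => g (contractFun (LinearMap.mul k R) j x i)) =
        contractFun (LinearMap.mul k S) j fun i => g (x i) := by
    intro j x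
    funext i
    simp only [contractFun]
    split_ifs <;> simp
  refine PiTensorProduct.ext (MultilinearMap.ext fun x => ?_)
  simp [hochschildB, tensorMap_tprod, key]

theorem tensorMap_connesB (n : ℕ) :
    tensorMap g (n + 2) ∘ₗ connesB (1 : R) n = connesB (1 : S) n ∘ₗ tensorMap g (n + 1) := by
  have key : ∀ x : Fin (n + 1) → R,
      (fun i => g ((Fin.cons 1 x : Fin (n + 2) → R) i)) =
        (Fin.cons 1 (fun i => g (x i)) : Fin (n + 2) → S) := by
    intro x
    funext i
    refine Fin.cases ?_ (fun i => ?_) i <;> simp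
  refine PiTensorProduct.ext (MultilinearMap.ext fun x => ?_)
  simp [connesB, tensorMap_tprod, key]

theorem tensorMap_degenerate (n : ℕ) :
    degenerate k (1 : R) n ≤ (degenerate k (1 : S) n).comap (tensorMap g (n + 1)) := by
  refine degenerate_le fun x i hi hx => ?_
  rw [Submodule.mem_comap, tensorMap_tprod]
  exact tprod_mem_degenerate _ _ i hi (by simp [hx])

/-- The morphism between the normalized mixed complexes induced by an algebra morphism. -/
def hochschildMixedMap : (hochschildMixed k R).Hom (hochschildMixed k S) where
  f n := Submodule.mapQ _ _ (tensorMap g (n + 1)) (tensorMap_degenerate g n)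
  comm_b n := by
    refine Submodule.linearMap_qext _ (LinearMap.ext fun x => ?_)
    exact congrArg (Submodule.Quotient.mk (p := degenerate k (1 : S) n))
      (LinearMap.congr_fun (tensorMap_hochschildB g n) x)
  comm_B n := by
    refine Submodule.linearMap_qext _ (LinearMap.ext fun x => ?_)
    exact congrArg (Submodule.Quotient.mk (p := degenerate k (1 : S) (n + 1)))
      (LinearMap.congr_fun (tensorMap_connesB g n) x)

end Hochschild

/-- The kernel of a morphism of mixed complexes. -/
def MixedDiagram.Hom.ker {k : Type*} [CommRing k] {C D : MixedDiagram k} (φ : C.Hom D) :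
    MixedDiagram k where
  X n := LinearMap.ker (φ.f n)
  b n := (C.b n).restrict (by
    intro x hx
    have h := LinearMap.congr_fun (φ.comm_b n) x
    simp only [LinearMap.comp_apply, LinearMap.mem_ker.1 hx, map_zero] at h
    exact h)
  B n := (C.B n).restrict (by
    intro x hx
    have h := LinearMap.congr_fun (φ.comm_B n) x
    simp only [LinearMap.comp_apply, LinearMap.mem_ker.1 hx, map_zero] at h
    exact h)

/-- The mixed complex `ker ((R ⊗ (R/k)^{⊗ *}, b, B) → (S ⊗ (S/k)^{⊗ *}, b, B))`. If
`g : R → S` is surjective with kernel `I`, then its homologies are by definition those of `R`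
relative to `I`. -/
def relativeMixed {k : Type*} [CommRing k] {R : Type*} [Ring R] [Algebra k R] {S : Type*} [Ring S]
    [Algebra k S] (g : R →ₐ[k] S) : MixedDiagram k :=
  (hochschildMixedMap g).ker

/-! ## Square zero extensions -/

open MulOpposite (op)

/-- A Hochschild normal 2-cocycle on the `k`-algebra `A` with values in the `A`-bimodule `M`. -/
structure NormalCocycle (k A M : Type*) [CommRing k] [Ring A] [Algebra k A] [AddCommGroup M]
    [Module k M] [Module A M] [Module Aᵐᵒᵖ M] where
  /-- the underlying `k`-bilinear map -/
  toFun : A →ₗ[k] A →ₗ[k] M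
  cocycle : ∀ a b c, a • toFun b c - toFun (a * b) c + toFun a (b * c) - op c • toFun a b = 0
  one_left : ∀ a, toFun 1 a = 0
  one_right : ∀ a, toFun a 1 = 0

/-- The square zero extension `E = A ⋉_f M`: the direct sum `A ⊕ M` with the product
`(a, m) (a', m') = (a a', a m' + m a' + f(a, a'))`. -/
def SqZeroExt {k A M : Type*} [CommRing k] [Ring A] [Algebra k A] [AddCommGroup M]
    [Module k M] [Module A M] [Module Aᵐᵒᵖ M] (_f : NormalCocycle k A M) : Type _ := A × M

namespace SqZeroExt

variable {k A M : Type*} [CommRing k] [Ring A] [Algebra k A] [AddCommGroup M]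
  [Module k M] [Module A M] [Module Aᵐᵒᵖ M] (f : NormalCocycle k A M)

instance : AddCommGroup (SqZeroExt f) := inferInstanceAs (AddCommGroup (A × M))

instance : Module k (SqZeroExt f) := inferInstanceAs (Module k (A × M))

/-- The projection onto `A`, as a linear map. -/
def fstL : SqZeroExt f →ₗ[k] A := LinearMap.fst k A M

/-- The projection onto `M`. -/
def sndL : SqZeroExt f →ₗ[k] M := LinearMap.snd k A M

/-- The inclusion of `A`. -/
def inA : A →ₗ[k] SqZeroExt f := LinearMap.inl k A M

/-- The inclusion of `M`. -/
def inM : M →ₗ[k] SqZeroExt f := LinearMap.inr k A M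

variable {f}

@[ext] theorem ext {x y : SqZeroExt f} (h1 : fstL f x = fstL f y) (h2 : sndL f x = sndL f y) :
    x = y := Prod.ext h1 h2

@[simp] theorem fstL_inA (a : A) : fstL f (inA f a) = a := rfl
@[simp] theorem sndL_inA (a : A) : sndL f (inA f a) = 0 := rfl
@[simp] theorem fstL_inM (m : M) : fstL f (inM f m) = 0 := rfl
@[simp] theorem sndL_inM (m : M) : sndL f (inM f m) = m := rfl

instance : Mul (SqZeroExt f) := ⟨fun x y =>
  (show A × M from (fstL f x * fstL f y,
    fstL f x • sndL f y + op (fstL f y) • sndL f x + f.toFun (fstL f x) (fstL f y)))⟩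

instance : One (SqZeroExt f) := ⟨inA f 1⟩

@[simp] theorem fstL_one : fstL f (1 : SqZeroExt f) = 1 := rfl
@[simp] theorem sndL_one : sndL f (1 : SqZeroExt f) = 0 := rfl
@[simp] theorem fstL_mul (x y : SqZeroExt f) : fstL f (x * y) = fstL f x * fstL f y := rfl
@[simp] theorem sndL_mul (x y : SqZeroExt f) : sndL f (x * y) =
    fstL f x • sndL f y + op (fstL f y) • sndL f x + f.toFun (fstL f x) (fstL f y) := rfl

variable [SMulCommClass A Aᵐᵒᵖ M]

instance : Ring (SqZeroExt f) :=
  { (inferInstance : AddCommGroup (SqZeroExt f)), (inferInstance : Mul (SqZeroExt f)),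
    (inferInstance : One (SqZeroExt f)) with
    left_distrib := fun x y z => by
      ext <;> simp [mul_add, smul_add, add_smul]
      abel
    right_distrib := fun x y z => by
      ext <;> simp [add_mul, smul_add, add_smul]
      abel
    zero_mul := fun x => by ext <;> simp
    mul_zero := fun x => by ext <;> simp
    mul_assoc := fun x y z => by
      ext
      · simp [mul_assoc]
      · have h := f.cocycle (fstL f x) (fstL f y) (fstL f z)
        have hs : op (fstL f z) • fstL f x • sndL f y = fstL f x • op (fstL f z) • sndL f y :=
          (smul_comm _ _ _).symm
        simp only [sndL_mul, fstL_mul, smul_add, MulOpposite.op_mul, mul_smul, hs]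
        rw [sub_eq_zero] at h
        rw [← h]
        abel
    one_mul := fun x => by ext <;> simp [f.one_left]
    mul_one := fun x => by ext <;> simp [f.one_right] }

variable [IsScalarTower k A M] [IsScalarTower k Aᵐᵒᵖ M]

instance : Algebra k (SqZeroExt f) :=
  Algebra.ofModule
    (fun c x y => by
      ext
      · simp
      · have h : op (fstL f y) • c • sndL f x = c • op (fstL f y) • sndL f x :=
          smul_algebra_smul_comm c _ _
        simp [smul_add, h])
    (fun c x y => by
      ext
      · simp
      · have h : fstL f x • c • sndL f y = c • fstL f x • sndL f y :=
          smul_algebra_smul_comm c _ _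
        simp [smul_add, h])

variable (f)

/-- The canonical projection `E → A`, an algebra morphism with kernel `M`. -/
def proj : SqZeroExt f →ₐ[k] A :=
  AlgHom.ofLinearMap (fstL f) rfl (fun _ _ => rfl)

/-- The concatenation of two elements of `A ∪ M`, extended bilinearly to `E`: the product of `A`
on `A × A`, the actions of `A` on `A × M` and `M × A`, and zero on `M × M`. -/
def concat : SqZeroExt f →ₗ[k] SqZeroExt f →ₗ[k] SqZeroExt f :=
  LinearMap.mk₂ k (fun x y => inA f (fstL f x * fstL f y) +
      inM f (fstL f x • sndL f y + op (fstL f y) • sndL f x))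
    (fun x x' y => by ext <;> simp [add_mul, add_smul, smul_add]; abel)
    (fun c x y => by
      have h : op (fstL f y) • c • sndL f x = c • op (fstL f y) • sndL f x :=
        smul_algebra_smul_comm c _ _
      ext <;> simp [smul_add, h])
    (fun x y y' => by ext <;> simp [mul_add, add_smul, smul_add]; abel)
    (fun c x y => by
      have h : fstL f x • c • sndL f y = c • fstL f x • sndL f y :=
        smul_algebra_smul_comm c _ _
      ext <;> simp [smul_add, h])

/-- The cocycle `f`, with values in `M ⊆ E`, extended to `E` by zero on `M`. -/
def cocycleE : SqZeroExt f →ₗ[k] SqZeroExt f →ₗ[k] SqZeroExt f :=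
  (f.toFun.compl₁₂ (fstL f) (fstL f)).compr₂ (inM f)

/-- The product of `E` is the concatenation plus the cocycle. -/
theorem mul_eq (x y : SqZeroExt f) : x * y = concat f x y + cocycleE f x y := by
  ext <;> simp [concat, cocycleE]

/-- The projector of `E` onto `A`. -/
def projA : SqZeroExt f →ₗ[k] SqZeroExt f := inA f ∘ₗ fstL f

/-- The projector of `E` onto `M`. -/
def projM : SqZeroExt f →ₗ[k] SqZeroExt f := inM f ∘ₗ sndL f

end SqZeroExt

/-! ## The double mixed complex of a square zero extension -/

/-! ### Positions under contraction -/

section Positions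

variable {n : ℕ} (j : Fin (n + 1)) (T : Finset (Fin (n + 2)))

theorem mem_image_lt {l : Fin (n + 1)} (h : l < j) :
    l ∈ T.image j.predAbove ↔ l.castSucc ∈ T := by
  have h' : (l : ℕ) < j := h
  rw [Finset.mem_image]
  constructor
  · rintro ⟨i, hi, e⟩
    have e' := congrArg Fin.val e
    rw [predAbove_val] at e'
    have : i = l.castSucc := Fin.ext (by simp only [Fin.val_castSucc]; split_ifs at e' <;> omega)
    rwa [← this]
  · intro hl
    exact ⟨_, hl, Fin.predAbove_castSucc_of_le _ _ h.le⟩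

theorem mem_image_gt {l : Fin (n + 1)} (h : j < l) :
    l ∈ T.image j.predAbove ↔ l.succ ∈ T := by
  have h' : (j : ℕ) < l := h
  rw [Finset.mem_image]
  constructor
  · rintro ⟨i, hi, e⟩
    have e' := congrArg Fin.val e
    rw [predAbove_val] at e'
    have : i = l.succ := Fin.ext (by simp only [Fin.val_succ]; split_ifs at e' <;> omega)
    rwa [← this]
  · intro hl
    exact ⟨_, hl, Fin.predAbove_succ_of_le _ _ h.le⟩

theorem mem_image_self : j ∈ T.image j.predAbove ↔ j.castSucc ∈ T ∨ j.succ ∈ T := by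
  rw [Finset.mem_image]
  constructor
  · rintro ⟨i, hi, e⟩
    have e' := congrArg Fin.val e
    rw [predAbove_val] at e'
    by_cases h : (i : ℕ) = j
    · left
      have : i = j.castSucc := Fin.ext h
      rwa [← this]
    · right
      have : i = j.succ := Fin.ext (by simp only [Fin.val_succ]; split_ifs at e' <;> omega)
      rwa [← this]
  · rintro (h | h)
    · exact ⟨_, h, Fin.predAbove_castSucc_self _⟩
    · exact ⟨_, h, Fin.predAbove_succ_self _⟩

theorem card_image_predAbove (h : ¬ (j.castSucc ∈ T ∧ j.succ ∈ T)) :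
    (T.image j.predAbove).card = T.card := by
  refine Finset.card_image_of_injOn fun a ha b hb e => ?_
  have e' := congrArg Fin.val e
  rw [predAbove_val, predAbove_val] at e'
  by_contra hab
  have hab' : (a : ℕ) ≠ b := fun q => hab (Fin.ext q)
  apply h
  have hc : ((a : ℕ) = j ∧ (b : ℕ) = j + 1) ∨ ((b : ℕ) = j ∧ (a : ℕ) = j + 1) := by
    split_ifs at e' <;> omega
  rcases hc with ⟨h1, h2⟩ | ⟨h1, h2⟩
  · have q1 : a = j.castSucc := Fin.ext h1
    have q2 : b = j.succ := Fin.ext h2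
    exact ⟨q1 ▸ ha, q2 ▸ hb⟩
  · have q1 : b = j.castSucc := Fin.ext h1
    have q2 : a = j.succ := Fin.ext h2
    exact ⟨q1 ▸ hb, q2 ▸ ha⟩

theorem zero_mem_image (h : 0 ∈ T) : 0 ∈ T.image j.predAbove :=
  Finset.mem_image.2 ⟨0, h, by simp⟩

theorem mem_image_add {n : ℕ} (T : Finset (Fin (n + 1))) (a i : Fin (n + 1)) :
    i ∈ T.image (· + -a) ↔ i + a ∈ T := by
  rw [Finset.mem_image]
  constructor
  · rintro ⟨l, hl, rfl⟩
    rwa [neg_add_cancel_right]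
  · intro hi
    exact ⟨_, hi, add_neg_cancel_right _ _⟩

end Positions

namespace SqZeroExt

variable {k A M : Type*} [CommRing k] [Ring A] [Algebra k A] [AddCommGroup M]
  [Module k M] [Module A M] [Module Aᵐᵒᵖ M] [SMulCommClass A Aᵐᵒᵖ M]
  [IsScalarTower k A M] [IsScalarTower k Aᵐᵒᵖ M] (f : NormalCocycle k A M)

/-- The sets of positions `T ⊆ {0, …, n}` which contain `0` and have `w` further elements. -/
def positions (n w : ℕ) : Finset (Finset (Fin (n + 1))) :=
  Finset.univ.filter fun T => 0 ∈ T ∧ T.card = w + 1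

theorem mem_positions {n w : ℕ} {T : Finset (Fin (n + 1))} :
    T ∈ positions n w ↔ 0 ∈ T ∧ T.card = w + 1 := by
  simp [positions]

/-- The last position in `T`. -/
def lastPos {n : ℕ} (T : Finset (Fin (n + 1))) : Fin (n + 1) := T.sup id

theorem lastPos_mem {n : ℕ} {T : Finset (Fin (n + 1))} (h : T.Nonempty) : lastPos T ∈ T := by
  obtain ⟨i, hi, e⟩ := Finset.exists_mem_eq_sup T h id
  rw [lastPos, e]
  exact hi

variable {f} in
/-- The tuple `(x_0, …, x_n)` has `x_i ∈ M` for `i ∈ T` and `x_i ∈ A` for `i ∉ T`. -/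
def HasType {n : ℕ} (T : Finset (Fin (n + 1))) (x : Fin (n + 1) → SqZeroExt f) : Prop :=
  ∀ i, (i ∈ T → fstL f (x i) = 0) ∧ (i ∉ T → sndL f (x i) = 0)

/-- The module `M ⊗ B^n_w = X_v^w`, where `v = n + w`, as a submodule of the normalized
chains `E ⊗ (E/k)^{⊗ n}` of `E`: it is spanned by the tensors `x_0 ⊗ ⋯ ⊗ x_n` such that
`x_0 ∈ M`, exactly `w` of the `x_i` with `i ≥ 1` are (chosen) in `M`, and the other ones are
in `A`. -/
def X (n w : ℕ) : Submodule k (NormChains k (SqZeroExt f) n) :=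
  Submodule.span k {z | ∃ T ∈ positions n w, ∃ x : Fin (n + 1) → SqZeroExt f, HasType T x ∧
    Submodule.Quotient.mk (PiTensorProduct.tprod k x) = z}

variable {f} in
theorem mk_mem_X {n w : ℕ} {T : Finset (Fin (n + 1))} (hT : T ∈ positions n w)
    {x : Fin (n + 1) → SqZeroExt f} (hx : HasType T x) :
    (Submodule.Quotient.mk (PiTensorProduct.tprod k x) : NormChains k (SqZeroExt f) n)
      ∈ X f n w :=
  Submodule.subset_span ⟨T, hT, x, hx, rfl⟩

/-! ### The boundary map `b` -/

/-- The map given by the formula of the Hochschild boundary map of an algebra, with the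
concatenation of elements of `A ∪ M` in place of the product. -/
def concatB (n : ℕ) : NormChains k (SqZeroExt f) (n + 1) →ₗ[k] NormChains k (SqZeroExt f) n :=
  Submodule.mapQ _ _ (hochschildB (concat f) n)
    (hochschildB_degenerate _ _ (fun v => by ext <;> simp [concat])
      (fun v => by ext <;> simp [concat]) n)

variable {f} in
theorem contract_concat_mem {n w : ℕ} (j : Fin (n + 1)) {T : Finset (Fin (n + 2))}
    {x : Fin (n + 2) → SqZeroExt f} (hx : HasType T x) (hc : T.card = w + 1)
    (h0 : 0 ∈ T.image j.predAbove) :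
    (Submodule.Quotient.mk (PiTensorProduct.tprod k (contractFun (concat f) j x)) :
      NormChains k (SqZeroExt f) n) ∈ X f n w := by
  by_cases h : j.castSucc ∈ T ∧ j.succ ∈ T
  · have e : contractFun (concat f) j x j = 0 := by
      have h1 := (hx j.castSucc).1 h.1
      have h2 := (hx j.succ).1 h.2
      ext <;> simp [contractFun, concat, h1, h2]
    rw [MultilinearMap.map_coord_zero _ j e, Submodule.Quotient.mk_zero]
    exact Submodule.zero_mem _
  · refine mk_mem_X (mem_positions.2 ⟨h0, (card_image_predAbove j T h).trans hc⟩) fun l => ?_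
    rcases lt_trichotomy l j with hl | hl | hl
    · rw [mem_image_lt j T hl]
      simpa [contractFun, hl] using hx l.castSucc
    · subst hl
      rw [mem_image_self]
      have h1 := hx l.castSucc
      have h2 := hx l.succ
      by_cases m1 : l.castSucc ∈ T <;> by_cases m2 : l.succ ∈ T <;>
        simp_all [contractFun, concat]
    · rw [mem_image_gt j T hl]
      simpa [contractFun, hl.not_gt, hl.ne'] using hx l.succ

theorem concatB_mem (n w : ℕ) : ∀ z ∈ X f (n + 1) w, concatB f n z ∈ X f n w := by
  intro z hz
  refine (Submodule.span_le (p := (X f n w).comap (concatB f n))).2 ?_ hz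
  rintro _ ⟨T, hT, x, hx, rfl⟩
  obtain ⟨h0, hc⟩ := mem_positions.1 hT
  change (degenerate k (1 : SqZeroExt f) n).mkQ
    (hochschildB (concat f) n (PiTensorProduct.tprod k x)) ∈ X f n w
  simp only [hochschildB, LinearMap.add_apply, LinearMap.sum_apply, LinearMap.smul_apply,
    LinearMap.comp_apply, rotate_tprod, contract_tprod, map_add, map_sum, map_smul]
  refine Submodule.add_mem _ (Submodule.sum_mem _ fun j _ => Submodule.smul_mem _ _ ?_)
    (Submodule.smul_mem _ _ ?_)
  · exact contract_concat_mem j hx hc (zero_mem_image j T h0)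
  · have hinj := add_left_injective (-Fin.last (n + 1))
    refine contract_concat_mem (T := T.image (· + -Fin.last (n + 1))) 0 (fun i => ?_) ?_ ?_
    · rw [mem_image_add]
      exact hx _
    · rw [Finset.card_image_of_injective _ hinj, hc]
    · refine Finset.mem_image.2 ⟨1, Finset.mem_image.2 ⟨0, h0, ?_⟩, ?_⟩
      · rw [zero_add, neg_eq_iff_add_eq_zero]
        exact Fin.last_add_one (n + 1)
      · exact Fin.predAbove_succ_self (0 : Fin (n + 1))

/-- The map `b : X_v^w → X_{v-1}^w`, where `v = n + 1 + w`. -/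
def b (n w : ℕ) : X f (n + 1) w →ₗ[k] X f n w := (concatB f n).restrict (concatB_mem f n w)

/-! ### The operator `t` and the norm `N` -/

/-- The projector onto the tensors `x_0 ⊗ ⋯ ⊗ x_n` with `x_i ∈ M` for `i ∈ T` and
`x_i ∈ A` for `i ∉ T`, along the tensors of the other types. -/
def projType {n : ℕ} (T : Finset (Fin (n + 1))) :
    (⨂[k] _ : Fin (n + 1), SqZeroExt f) →ₗ[k] ⨂[k] _ : Fin (n + 1), SqZeroExt f :=
  PiTensorProduct.map fun i => if i ∈ T then projM f else projA f

set_option linter.unusedSectionVars false in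
theorem projType_tprod {n : ℕ} (T : Finset (Fin (n + 1))) (x : Fin (n + 1) → SqZeroExt f) :
    projType f T (PiTensorProduct.tprod k x) =
      PiTensorProduct.tprod k fun i => if i ∈ T then projM f (x i) else projA f (x i) := by
  rw [projType, PiTensorProduct.map_tprod]
  congr 1
  funext i
  split_ifs <;> rfl

set_option linter.unusedSectionVars false in
theorem hasType_proj {n : ℕ} (T : Finset (Fin (n + 1))) (x : Fin (n + 1) → SqZeroExt f) :
    HasType T fun i => if i ∈ T then projM f (x i) else projA f (x i) := by
  intro i
  by_cases h : i ∈ T <;> simp [h, projM, projA]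

theorem projType_degenerate {n : ℕ} (T : Finset (Fin (n + 1))) :
    degenerate k (1 : SqZeroExt f) n ≤ (degenerate k 1 n).comap (projType f T) := by
  refine degenerate_le fun x i hi hx => ?_
  rw [Submodule.mem_comap, projType_tprod]
  by_cases h : i ∈ T
  · rw [MultilinearMap.map_coord_zero _ i (by ext <;> simp [h, hx, projM])]
    exact Submodule.zero_mem _
  · exact tprod_mem_degenerate _ _ i hi (by ext <;> simp [h, hx, projA])

/-- The projector `projType` on normalized chains. -/
def projTypeN {n : ℕ} (T : Finset (Fin (n + 1))) :
    NormChains k (SqZeroExt f) n →ₗ[k] NormChains k (SqZeroExt f) n :=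
  Submodule.mapQ _ _ (projType f T) (projType_degenerate f T)

/-- The operator which sends a tensor `x_0 ⊗ ⋯ ⊗ x_n` with `x_0 ∈ M` and exactly `w` of the `x_i`
with `i ≥ 1` in `M` (the other ones in `A`) to
`(-1)^{i n} x_i ⊗ ⋯ ⊗ x_n ⊗ x_0 ⊗ ⋯ ⊗ x_{i-1}`, where `i` is the last index with `x_i ∈ M`,
and kills the tensors of the other types. -/
def tTensor (n w : ℕ) :
    (⨂[k] _ : Fin (n + 1), SqZeroExt f) →ₗ[k] ⨂[k] _ : Fin (n + 1), SqZeroExt f :=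
  ∑ T ∈ positions n w, (-1 : k) ^ ((lastPos T : ℕ) * n) •
    (rotate k (SqZeroExt f) (lastPos T) ∘ₗ projType f T)

theorem tTensor_degenerate (n w : ℕ) :
    degenerate k (1 : SqZeroExt f) n ≤ (degenerate k 1 n).comap (tTensor f n w) := by
  refine degenerate_le fun x i hi hx => ?_
  simp only [Submodule.mem_comap, tTensor, LinearMap.sum_apply, LinearMap.smul_apply,
    LinearMap.comp_apply, projType_tprod, rotate_tprod]
  refine Submodule.sum_mem _ fun T hT => Submodule.smul_mem _ _ ?_
  have hl := lastPos_mem ⟨0, (mem_positions.1 hT).1⟩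
  by_cases h : i ∈ T
  · rw [MultilinearMap.map_coord_zero _ (i - lastPos T) (by ext <;> simp [h, hx, projM])]
    exact Submodule.zero_mem _
  · refine tprod_mem_degenerate _ _ (i - lastPos T) (fun e => h ?_)
      (by ext <;> simp [h, hx, projA])
    rwa [sub_eq_zero.1 e]

/-- The operator `tTensor` on normalized chains. -/
def tN (n w : ℕ) : NormChains k (SqZeroExt f) n →ₗ[k] NormChains k (SqZeroExt f) n :=
  Submodule.mapQ _ _ (tTensor f n w) (tTensor_degenerate f n w)

theorem tN_mem (n w : ℕ) (z : NormChains k (SqZeroExt f) n) : tN f n w z ∈ X f n w := by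
  obtain ⟨u, rfl⟩ := Submodule.mkQ_surjective _ z
  have hu : u ∈ Submodule.span k
      (Set.range (PiTensorProduct.tprod k (s := fun _ : Fin (n + 1) => SqZeroExt f))) := by
    rw [PiTensorProduct.span_tprod_eq_top]
    exact Submodule.mem_top
  refine (Submodule.span_le (p := (X f n w).comap
    (tN f n w ∘ₗ (degenerate k (1 : SqZeroExt f) n).mkQ))).2 ?_ hu
  rintro _ ⟨x, rfl⟩
  change (degenerate k (1 : SqZeroExt f) n).mkQ (tTensor f n w (PiTensorProduct.tprod k x)) ∈
    X f n w
  simp only [tTensor, LinearMap.sum_apply, LinearMap.smul_apply,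
    LinearMap.comp_apply, projType_tprod, rotate_tprod, map_sum, map_smul]
  refine Submodule.sum_mem _ fun T hT => Submodule.smul_mem _ _ ?_
  obtain ⟨h0, hc⟩ := mem_positions.1 hT
  have hl := lastPos_mem ⟨0, h0⟩
  refine mk_mem_X (T := T.image (· + -lastPos T)) (mem_positions.2 ⟨?_, ?_⟩) fun i => ?_
  · rw [mem_image_add, zero_add]
    exact hl
  · rw [Finset.card_image_of_injective _ (add_left_injective _), hc]
  · rw [mem_image_add]
    exact hasType_proj f T x (i + lastPos T)

/-- The map `t : X_v^w → X_v^w`, where `v = n + w`. -/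
def t (n w : ℕ) : X f n w →ₗ[k] X f n w := (tN f n w).restrict fun z _ => tN_mem f n w z

/-- The map `N = id + t + ⋯ + t^w : X_v^w → X_v^w`, where `v = n + w`. -/
def N (n w : ℕ) : X f n w →ₗ[k] X f n w := ∑ l ∈ Finset.range (w + 1), t f n w ^ l

/-! ### The maps `d` and `d'` -/

/-- The map `F_j`, `x_0 ⊗ ⋯ ⊗ x_{n+1} ↦ (-1)^j x_0 ⊗ ⋯ ⊗ f(x_j, x_{j+1}) ⊗ ⋯ ⊗ x_{n+1}`, for
`0 ≤ j ≤ n`, on normalized chains. -/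
def F (n : ℕ) (j : Fin (n + 1)) :
    NormChains k (SqZeroExt f) (n + 1) →ₗ[k] NormChains k (SqZeroExt f) n :=
  (-1 : k) ^ (j : ℕ) • Submodule.mapQ _ _ (contract (cocycleE f) j)
    (contract_degenerate (cocycleE f) 1 (fun v => by simp [cocycleE, f.one_left])
      (fun v => by simp [cocycleE, f.one_right]) j)

theorem F_mem (n w : ℕ) (j : Fin (n + 1)) : ∀ z ∈ X f (n + 1) w, F f n j z ∈ X f n (w + 1) := by
  intro z hz
  refine (Submodule.span_le (p := (X f n (w + 1)).comap (F f n j))).2 ?_ hz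
  rintro _ ⟨T, hT, x, hx, rfl⟩
  obtain ⟨h0, hc⟩ := mem_positions.1 hT
  change (-1 : k) ^ (j : ℕ) • (degenerate k (1 : SqZeroExt f) n).mkQ
    (contract (cocycleE f) j (PiTensorProduct.tprod k x)) ∈ X f n (w + 1)
  rw [contract_tprod]
  refine Submodule.smul_mem _ _ ?_
  by_cases h : j.castSucc ∈ T ∨ j.succ ∈ T
  · have e : contractFun (cocycleE f) j x j = 0 := by
      rcases h with h | h
      · simp [contractFun, cocycleE, (hx j.castSucc).1 h]
      · simp [contractFun, cocycleE, (hx j.succ).1 h]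
    rw [MultilinearMap.map_coord_zero _ j e, map_zero]
    exact Submodule.zero_mem _
  · have hj : j ∉ T.image j.predAbove := fun q => h ((mem_image_self j T).1 q)
    refine mk_mem_X (T := insert j (T.image j.predAbove))
      (mem_positions.2 ⟨Finset.mem_insert_of_mem (zero_mem_image j T h0), ?_⟩) fun l => ?_
    · rw [Finset.card_insert_of_notMem hj,
        card_image_predAbove j T (fun q => h (Or.inl q.1)), hc]
    · rcases lt_trichotomy l j with hl | hl | hl
      · rw [Finset.mem_insert, mem_image_lt j T hl]
        simpa [contractFun, hl, hl.ne] using hx l.castSucc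
      · subst hl
        simp [contractFun, cocycleE]
      · rw [Finset.mem_insert, mem_image_gt j T hl]
        simpa [contractFun, hl.not_gt, hl.ne'] using hx l.succ

/-- The map `d = ∑_{1 ≤ j ≤ n} F_j : X_v^w → X_v^{w+1}`, where `v = n + 1 + w`. -/
def d (n w : ℕ) : X f (n + 1) w →ₗ[k] X f n (w + 1) :=
  ∑ j ∈ Finset.univ.filter (fun j : Fin (n + 1) => j ≠ 0), (F f n j).restrict (F_mem f n w j)

/-- The operator which sends a tensor `x = x_0 ⊗ ⋯ ⊗ x_{n+1}` with `x_0 ∈ M` and exactly `w` of the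
`x_i` with `i ≥ 1` in `M` (the other ones in `A`) to `∑_{i(x) < j ≤ n} t (F_j x)`, where `i(x)` is
the last index `i` with `x_i ∈ M`. -/
def tF (n w : ℕ) : NormChains k (SqZeroExt f) (n + 1) →ₗ[k] NormChains k (SqZeroExt f) n :=
  ∑ T ∈ positions (n + 1) w,
    ∑ j ∈ Finset.univ.filter (fun j : Fin (n + 1) => lastPos T < j.castSucc),
      tN f n (w + 1) ∘ₗ F f n j ∘ₗ projTypeN f T

theorem tF_mem (n w : ℕ) (z : NormChains k (SqZeroExt f) (n + 1)) :
    tF f n w z ∈ X f n (w + 1) := by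
  simp only [tF, LinearMap.sum_apply, LinearMap.comp_apply]
  exact Submodule.sum_mem _ fun T _ => Submodule.sum_mem _ fun j _ => tN_mem f n (w + 1) _

/-- The map `d' : X_v^w → X_v^{w+1}`, where `v = n + 1 + w`, given by
`d'(x) = - d(x) - ∑_{i(x) < j ≤ n} t (F_j x)`. -/
def d' (n w : ℕ) : X f (n + 1) w →ₗ[k] X f n (w + 1) :=
  -d f n w - (tF f n w).restrict fun z _ => tF_mem f n w z

/-! ### The double mixed complex -/

/-- The module `X_{v-1}^w`, where `v = n + w`: it is zero if `n = 0`. -/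
def XPred : ∀ n : ℕ, ℕ → Submodule k (NormChains k (SqZeroExt f) (n - 1))
  | 0, _ => ⊥
  | n + 1, w => X f n w

/-- The map `-b : X_v^w → X_{v-1}^w`, where `v = n + w` (zero if `n = 0`). -/
def negB : ∀ n w : ℕ, X f n w →ₗ[k] XPred f n w
  | 0, _ => 0
  | n + 1, w => -b f n w

/-- The map `d' : X_v^w → X_v^{w+1}`, where `v = n + w` (zero if `n = 0`). -/
def dPrime : ∀ n w : ℕ, X f n w →ₗ[k] XPred f n (w + 1)
  | 0, _ => 0
  | n + 1, w => d' f n w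

/-- The diagram `(X̂, b̂, d̂, B̂)`, where `X̂_v^w = X_v^w ⊕ X_{v-1}^w`,
`b̂(x, y) = (b(x) + (id - t)(y), -b(y))`, `d̂(x, y) = (d(x), d'(y))` and `B̂(x, y) = (0, N(x))`.
Note that `XPred f (n + 1) w` is `X f n w` by definition. -/
def hatX : DoubleMixedDiagram k where
  X w n := X f n w × XPred f n w
  δ w n := LinearMap.prod
    (b f n w ∘ₗ LinearMap.fst k (X f (n + 1) w) (X f n w) +
      (LinearMap.id - t f n w) ∘ₗ LinearMap.snd k (X f (n + 1) w) (X f n w))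
    (negB f n w ∘ₗ LinearMap.snd k (X f (n + 1) w) (X f n w))
  del w n := LinearMap.prod
    (d f n w ∘ₗ LinearMap.fst k (X f (n + 1) w) (X f n w))
    (dPrime f n w ∘ₗ LinearMap.snd k (X f (n + 1) w) (X f n w))
  B w n := LinearMap.prod (0 : (X f n w × XPred f n w) →ₗ[k] X f (n + 1) w)
    (N f n w ∘ₗ LinearMap.fst k (X f n w) (XPred f n w))

end SqZeroExt

end

/-! Let `θ` (`theta`) be the part of Connes' operator of `E` that cuts a cyclic word only behind its
last entry in `M`: if that entry is `x_c`, then `x_0 ⊗ ⋯ ⊗ x_n` goes to the sum over `c < i ≤ n + 1`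
of `± 1 ⊗ x_i ⊗ ⋯ ⊗ x_n ⊗ x_0 ⊗ ⋯ ⊗ x_{i-1}`. The comparison map is `(x, y) ↦ x + θ(y)`.

Three computations make it a morphism. On chains starting in `M` the boundary of `E` is `b + d`,
because the product of `E` is the concatenation plus the cocycle (`bN_X`). On `X`, the boundary of
`θ(y)` is `(id - t)(y) - θ(b y) + θ(d' y)` (`bN_theta_X`): the outer faces of consecutive cuts
telescope to `id - t`, and the inner faces are cuts of contracted words. A contraction by `f` behind
the last entry in `M` creates a new last entry, so the cuts in front of it are lost; these are `θ`
of a rotated word, which explains the extra sum in `d'`. Finally `B = θN` on `X` and `Bθ = 0`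
(`BN_X`, `BN_theta`), since rotating through all the entries in `M` collects every cut.

The comparison map is injective: a functional `ε` on `A` with `ε(1) = 1` gives a retraction of `θ`
on `X` that kills chains starting in `M` (`exists_retraction`), and different weights are
independent. So the identities of a mixed complex are inherited from the Hochschild complex of `E`,
and sorting them by weight gives those of a double mixed complex.

On the relative chains, `bθ + θb - id` takes values in the image of the comparison map: each error
term in `LastM.homotopy` starts in `M` or is `θ` of a chain starting in `M`. As `θ` preserves the
image, the cokernel is `b`-acyclic. Mixed complexes here start in degree `0`, so primitives for `b +
B` can be found degree by degree, and the total complexes of the cokernel are acyclic for every set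
of columns (`homologyMap_bijective`). This treats all four homologies at once. -/

noncomputable section

set_option linter.unusedSectionVars false

/-! ## Comparison of mixed complexes -/

namespace MixedDiagram

variable {k : Type*} [CommRing k]

/-- The identities of a mixed complex: `b` and `B` have square zero and anticommute. -/
structure IsMixed (C : MixedDiagram k) : Prop where
  b_b : ∀ n x, C.b n (C.b (n + 1) x) = 0
  B_B : ∀ n x, C.B (n + 1) (C.B n x) = 0
  b_B_zero : ∀ x, C.b 0 (C.B 0 x) = 0
  b_B : ∀ n x, C.b (n + 1) (C.B (n + 1) x) + C.B n (C.b n x) = 0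

variable {C D : MixedDiagram k}

theorem truncate_apply_of_mem {J : Set ℤ} {n : ℤ} {m : ℕ} (h : m ∈ entries J n)
    (x : ∀ m, C.X m) : C.truncate J n x m = x m := by
  simp [truncate, h]

theorem truncate_apply_of_notMem {J : Set ℤ} {n : ℤ} {m : ℕ} (h : m ∉ entries J n)
    (x : ∀ m, C.X m) : C.truncate J n x m = 0 := by
  simp [truncate, h]

theorem truncate_mem (J : Set ℤ) (n : ℤ) (x : ∀ m, C.X m) : C.truncate J n x ∈ C.tot J n :=
  fun _ hm => truncate_apply_of_notMem hm x

theorem bPlusB_zero (x : ∀ m, C.X m) : C.bPlusB x 0 = C.b 0 (x 1) := rfl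

theorem bPlusB_succ (x : ∀ m, C.X m) (m : ℕ) :
    C.bPlusB x (m + 1) = C.b (m + 1) (x (m + 2)) + C.B m (x m) := rfl

theorem succ_mem_entries {J : Set ℤ} {n : ℤ} {m : ℕ} :
    m + 1 ∈ entries J (n + 1) ↔ m ∈ entries J n := by
  simp only [entries, Set.mem_ofPred_eq]
  refine exists_congr fun p => and_congr_right fun _ => ?_
  push_cast
  omega

/-- Since `b` stays in its column, the only delicate term is the outer `B`. When its argument is
truncated away, the component of `x` that `b` sends there lies in the same column, so it vanishes,
and with it the matching term `b B x`. -/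
theorem truncate_bPlusB_sq (hC : C.IsMixed) (J : Set ℤ) (n : ℤ) {x : ∀ m, C.X m}
    (hx : x ∈ C.tot J (n + 1 + 1)) :
    C.truncate J n (C.bPlusB (C.truncate J (n + 1) (C.bPlusB x))) = 0 := by
  funext m
  by_cases hm : m ∈ entries J n
  · rw [truncate_apply_of_mem hm]
    have h1 := succ_mem_entries.2 hm
    cases m with
    | zero => simp [bPlusB_zero, truncate_apply_of_mem h1, bPlusB_succ, hC.b_b, hC.b_B_zero]
    | succ m =>
      rw [bPlusB_succ, truncate_apply_of_mem h1, bPlusB_succ, map_add, hC.b_b, zero_add]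
      have hB := hC.b_B m (x (m + 1))
      by_cases hm' : m ∈ entries J (n + 1)
      · rw [truncate_apply_of_mem hm']
        cases m with
        | zero => simpa [bPlusB_zero] using hB
        | succ m =>
          rw [bPlusB_succ, map_add, hC.B_B, add_zero]
          exact hB
      · rw [truncate_apply_of_notMem hm', map_zero, add_zero,
          hx (m + 1) (fun h => hm' (succ_mem_entries.1 h)), map_zero, map_zero]
        rfl
  · rw [truncate_apply_of_notMem hm]
    rfl

namespace Hom

variable (φ : C.Hom D)

open scoped Classical in
/-- A family `z` with `y ≡ (b + B) z` modulo the image of `φ`, chosen recursively. -/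
def correction (y : ∀ m, D.X m) (s : Set ℕ) : ∀ m, D.X m
  | 0 => 0
  | 1 => if h : 0 ∈ s ∧ ∃ e, y 0 - D.b 0 e ∈ LinearMap.range (φ.f 0) then h.2.choose else 0
  | m + 2 => if h : m + 1 ∈ s ∧ ∃ e, y (m + 1) - D.B m (correction y s m) - D.b (m + 1) e ∈
      LinearMap.range (φ.f (m + 1)) then h.2.choose else 0

theorem correction_of_notMem (y : ∀ m, D.X m) {s : Set ℕ} {m : ℕ} (hm : m ∉ s) :
    φ.correction y s (m + 1) = 0 := by
  cases m <;> simp [correction, hm]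

theorem correction_one (y : ∀ m, D.X m) {s : Set ℕ} (h0 : 0 ∈ s)
    (h : ∃ e, y 0 - D.b 0 e ∈ LinearMap.range (φ.f 0)) :
    y 0 - D.b 0 (φ.correction y s 1) ∈ LinearMap.range (φ.f 0) := by
  have h' : 0 ∈ s ∧ ∃ e, y 0 - D.b 0 e ∈ LinearMap.range (φ.f 0) := ⟨h0, h⟩
  rw [correction, dif_pos h']
  exact h'.2.choose_spec

theorem correction_add_two (y : ∀ m, D.X m) {s : Set ℕ} {m : ℕ} (h0 : m + 1 ∈ s)
    (h : ∃ e, y (m + 1) - D.B m (φ.correction y s m) - D.b (m + 1) e ∈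
      LinearMap.range (φ.f (m + 1))) :
    y (m + 1) - D.B m (φ.correction y s m) - D.b (m + 1) (φ.correction y s (m + 2)) ∈
      LinearMap.range (φ.f (m + 1)) := by
  have h' : m + 1 ∈ s ∧ ∃ e, y (m + 1) - D.B m (φ.correction y s m) - D.b (m + 1) e ∈
      LinearMap.range (φ.f (m + 1)) := ⟨h0, h⟩
  rw [correction, dif_pos h']
  exact h'.2.choose_spec

/-- The cokernel of `φ` is acyclic with respect to `b`. -/
structure CokerAcyclic : Prop where
  zero : ∀ d, ∃ e, d - D.b 0 e ∈ LinearMap.range (φ.f 0)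
  succ : ∀ n d, D.b n d ∈ LinearMap.range (φ.f n) →
    ∃ e, d - D.b (n + 1) e ∈ LinearMap.range (φ.f (n + 1))

theorem B_mem_range {n : ℕ} {x : D.X n} (h : x ∈ LinearMap.range (φ.f n)) :
    D.B n x ∈ LinearMap.range (φ.f (n + 1)) := by
  obtain ⟨c, rfl⟩ := h
  exact ⟨C.B n c, LinearMap.congr_fun (φ.comm_B n) c⟩

/-- Strong induction on the degree. By acyclicity, the next value of `z` exists once `y_{m+1} - B
z_m` is a `b`-cycle modulo the image of `φ`. Using `bB = -Bb` and `BB = 0`, its boundary is `(b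
y_{m+1} + B y_{m-1}) - B (y_{m-1} - ((b + B) z)_{m-1})`, where the first term is in the image by
hypothesis and the second by induction. -/
theorem correction_spec (hD : D.IsMixed) (hφ : φ.CokerAcyclic) {J : Set ℤ} {n : ℤ}
    {y : ∀ m, D.X m} (hy : y ∈ D.tot J (n + 1))
    (hb : ∀ m, D.truncate J n (D.bPlusB y) m ∈ LinearMap.range (φ.f m)) (m : ℕ)
    (hm : m ∈ entries J (n + 1)) :
    y m - D.bPlusB (φ.correction y (entries J (n + 1))) m ∈ LinearMap.range (φ.f m) := by
  induction m using Nat.strong_induction_on with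
  | _ m ih =>
  set z := φ.correction y (entries J (n + 1)) with hz
  cases m with
  | zero => exact φ.correction_one y hm (hφ.zero _)
  | succ m =>
    rw [bPlusB_succ, add_comm (D.b _ _), ← sub_sub]
    refine φ.correction_add_two y hm (hφ.succ m _ ?_)
    rw [← hz]
    have hm' := succ_mem_entries.1 hm
    have h1 := hb m
    rw [truncate_apply_of_mem hm'] at h1
    cases m with
    | zero =>
      rw [map_sub, hD.b_B_zero, sub_zero]
      exact h1
    | succ m =>
      rw [bPlusB_succ] at h1
      have hB : D.b (m + 1) (D.B (m + 1) (z (m + 1))) = - D.B m (D.b m (z (m + 1))) :=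
        eq_neg_of_add_eq_zero_left (hD.b_B m _)
      rw [map_sub, hB, sub_neg_eq_add]
      by_cases h2 : m ∈ entries J (n + 1)
      · have h3 := φ.B_mem_range (ih m (by omega) h2)
        have h4 : D.B m (D.bPlusB z m) = D.B m (D.b m (z (m + 1))) := by
          cases m with
          | zero => rfl
          | succ m => rw [bPlusB_succ, map_add, hD.B_B, add_zero]
        rw [map_sub, h4] at h3
        have := Submodule.sub_mem _ h1 h3
        convert this using 1
        abel
      -- The entry `m` of degree `n + 1` lies outside the chosen columns, so `y m` and the
      -- correction `z (m + 1)` above it both vanish.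
      · have h3 : z (m + 1) = 0 := φ.correction_of_notMem y h2
        have h4 := hy m h2
        rw [h4, map_zero, add_zero] at h1
        rwa [h3, map_zero, map_zero, add_zero]

theorem correction_mem (y : ∀ m, D.X m) (J : Set ℤ) (n : ℤ) :
    φ.correction y (entries J n) ∈ D.tot J (n + 1) := by
  intro m hm
  cases m with
  | zero => rfl
  | succ m => exact φ.correction_of_notMem y fun h => hm (succ_mem_entries.2 h)

/-- If the cokernel of `φ` is `b`-acyclic, then its total complexes are acyclic. -/
theorem exists_decomposition (hD : D.IsMixed) (hφ : φ.CokerAcyclic)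
    {J : Set ℤ} {n : ℤ}
    {y : ∀ m, D.X m} (hy : y ∈ D.tot J (n + 1))
    (hb : D.truncate J n (D.bPlusB y) ∈ LinearMap.range φ.prodMap) :
    ∃ u ∈ C.tot J (n + 1), ∃ z ∈ D.tot J (n + 1 + 1),
      y = φ.prodMap u + D.truncate J (n + 1) (D.bPlusB z) := by
  classical
  have hb' : ∀ m, D.truncate J n (D.bPlusB y) m ∈ LinearMap.range (φ.f m) := by
    obtain ⟨c, hc⟩ := hb
    intro m
    rw [← hc]
    exact ⟨c m, rfl⟩
  have h := φ.correction_spec hD hφ hy hb'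
  set z := φ.correction y (entries J (n + 1))
  choose! u hu using h
  refine ⟨C.truncate J (n + 1) u, truncate_mem _ _ _, z, φ.correction_mem _ _ _, ?_⟩
  rw [prodMap_truncate]
  funext m
  by_cases hm : m ∈ entries J (n + 1)
  · rw [Pi.add_apply, truncate_apply_of_mem hm, truncate_apply_of_mem hm]
    have := hu m hm
    change y m = φ.f m (u m) + _
    rw [this]
    abel
  · rw [Pi.add_apply, truncate_apply_of_notMem hm, truncate_apply_of_notMem hm, hy m hm, add_zero]

theorem prodMap_injective (hinj : ∀ n, Function.Injective (φ.f n)) :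
    Function.Injective φ.prodMap := fun _ _ h => funext fun m => hinj m (congrFun h m)

/-- An injective morphism to a mixed complex whose cokernel is `b`-acyclic induces isomorphisms on
the homologies of all the total complexes. -/
theorem homologyMap_bijective (hD : D.IsMixed) (hinj : ∀ n, Function.Injective (φ.f n))
    (hφ : φ.CokerAcyclic) (J : Set ℤ) (n : ℤ) : Function.Bijective (φ.homologyMap J n) := by
  have hinj' := φ.prodMap_injective hinj
  obtain ⟨n, rfl⟩ : ∃ n', n = n' + 1 := ⟨n - 1, by ring⟩
  constructor
  · rw [injective_iff_map_eq_zero]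
    intro q hq
    obtain ⟨x, rfl⟩ := Submodule.mkQ_surjective _ q
    replace hq : (φ.cyclesMap J (n + 1) x) ∈
        (D.boundaries J (n + 1)).comap (D.cycles J (n + 1)).subtype :=
      (Submodule.Quotient.mk_eq_zero _).1 hq
    obtain ⟨y, hy, hxy⟩ := hq
    replace hxy : D.truncate J (n + 1) (D.bPlusB y) = φ.prodMap x.1 := hxy
    -- The chain `y` bounding `φ x` may be moved into the image of `φ` by subtracting a boundary; by
    -- injectivity its preimage `u` then bounds `x`.
    obtain ⟨u, hu, z, hz, e⟩ := φ.exists_decomposition hD hφ hy ⟨x.1, hxy.symm⟩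
    refine (Submodule.Quotient.mk_eq_zero _).2 ⟨u, hu, hinj' ?_⟩
    change φ.prodMap (C.truncate J (n + 1) (C.bPlusB u)) = φ.prodMap x.1
    rw [← hxy, e, map_add, map_add, truncate_bPlusB_sq hD J _ hz, add_zero, prodMap_truncate,
      prodMap_bPlusB]
  · intro q
    obtain ⟨⟨y, hy, hy'⟩, rfl⟩ := Submodule.mkQ_surjective _ q
    replace hy' : D.truncate J n (D.bPlusB y) = 0 := by
      have h : D.truncate J (n + 1 - 1) (D.bPlusB y) = 0 := hy'
      rwa [add_sub_cancel_right] at h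
    obtain ⟨u, hu, z, hz, e⟩ := φ.exists_decomposition hD hφ hy (hy' ▸ Submodule.zero_mem _)
    have hu' : C.truncate J n (C.bPlusB u) = 0 := by
      refine hinj' ?_
      rw [map_zero, prodMap_truncate, prodMap_bPlusB, eq_sub_of_add_eq e.symm, map_sub, map_sub, hy',
        truncate_bPlusB_sq hD J _ hz, sub_zero]
    refine ⟨(Submodule.mkQ _) ⟨u, hu, ?_⟩, ?_⟩
    · change C.truncate J (n + 1 - 1) (C.bPlusB u) = 0
      rwa [add_sub_cancel_right]
    · refine (Submodule.Quotient.eq _).2 ?_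
      refine ⟨-z, Submodule.neg_mem _ hz, ?_⟩
      change D.truncate J (n + 1) (D.bPlusB (-z)) = φ.prodMap u - y
      rw [e, map_neg, map_neg]
      abel

/-- A morphism of mixed complexes whose source embeds satisfies the identities of its target. -/
theorem isMixed_of_injective (hD : D.IsMixed) (hinj : ∀ n, Function.Injective (φ.f n)) :
    C.IsMixed := by
  have hb : ∀ n x, φ.f n (C.b n x) = D.b n (φ.f (n + 1) x) := fun n x =>
    LinearMap.congr_fun (φ.comm_b n) x
  have hB : ∀ n x, φ.f (n + 1) (C.B n x) = D.B n (φ.f n x) := fun n x =>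
    LinearMap.congr_fun (φ.comm_B n) x
  constructor
  · exact fun n x => hinj _ (by rw [hb, hb, hD.b_b, map_zero])
  · exact fun n x => hinj _ (by rw [hB, hB, hD.B_B, map_zero])
  · exact fun x => hinj _ (by rw [hb, hB, hD.b_B_zero, map_zero])
  · exact fun n x => hinj _ (by rw [map_add, hb, hB, hB, hb, hD.b_B, map_zero])

theorem isMixed_ker (hC : C.IsMixed) : φ.ker.IsMixed :=
  ⟨fun n x => Subtype.ext (hC.b_b n x.1), fun n x => Subtype.ext (hC.B_B n x.1),
    fun x => Subtype.ext (hC.b_B_zero x.1), fun n x => Subtype.ext (hC.b_B n x.1)⟩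

end Hom

end MixedDiagram

/-! ## Words -/

section Words

variable (k : Type*) [CommRing k] {R : Type*} [Ring R] [Algebra k R]

/-- The class of `x_0 ⊗ ⋯ ⊗ x_n` in the normalized chains. -/
def wd (n : ℕ) (x : ℕ → R) : NormChains k R n :=
  Submodule.Quotient.mk (PiTensorProduct.tprod k fun i : Fin (n + 1) => x i)

variable {k}

theorem wd_congr {n : ℕ} {x y : ℕ → R} (h : ∀ i ≤ n, x i = y i) : wd k n x = wd k n y := by
  unfold wd
  congr 2
  funext i
  exact h i (Nat.lt_succ_iff.1 i.isLt)

theorem wd_eq_zero_of_apply {n i : ℕ} {x : ℕ → R} (hi : i ≤ n) (h : x i = 0) :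
    wd k n x = 0 := by
  unfold wd
  rw [MultilinearMap.map_coord_zero _ (⟨i, Nat.lt_succ_of_le hi⟩ : Fin (n + 1)) h]
  rfl

theorem wd_eq_zero_of_one {n i : ℕ} {x : ℕ → R} (hi : i ≤ n) (h0 : i ≠ 0) (h : x i = 1) :
    wd k n x = 0 :=
  (Submodule.Quotient.mk_eq_zero _).2 (tprod_mem_degenerate 1 _ ⟨i, Nat.lt_succ_of_le hi⟩
    (fun e => h0 (congrArg Fin.val e)) h)

theorem update_fin (n : ℕ) (x : ℕ → R) (i : Fin (n + 1)) (a : R) :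
    (fun l : Fin (n + 1) => Function.update x i a l) =
      Function.update (fun l : Fin (n + 1) => x l) i a := by
  funext l
  simp [Function.update_apply, Fin.ext_iff]

theorem wd_update_add {n i : ℕ} (hi : i ≤ n) (x : ℕ → R) (a a' : R) :
    wd k n (Function.update x i (a + a')) =
      wd k n (Function.update x i a) + wd k n (Function.update x i a') := by
  obtain ⟨i, rfl⟩ : ∃ i' : Fin (n + 1), i = i' := ⟨⟨i, Nat.lt_succ_of_le hi⟩, rfl⟩
  unfold wd
  rw [update_fin, update_fin, update_fin, MultilinearMap.map_update_add]
  rfl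

/-- A version of additivity in one slot. -/
theorem wd_add {n i : ℕ} (hi : i ≤ n) {x y z : ℕ → R} (h : x i = y i + z i)
    (hy : ∀ j ≤ n, j ≠ i → y j = x j) (hz : ∀ j ≤ n, j ≠ i → z j = x j) :
    wd k n x = wd k n y + wd k n z := by
  have e := wd_update_add (k := k) hi x (y i) (z i)
  rw [← h, Function.update_eq_self] at e
  rw [e]
  congr 1 <;> refine wd_congr fun j hj => ?_ <;> by_cases q : j = i <;>
    simp [q]
  · exact (hy j hj q).symm
  · exact (hz j hj q).symm

/-- Indexing words by `ℕ` turns rotations and contractions into plain arithmetic of indices; the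
values beyond `n` play no role. -/
theorem exists_nat_extension {n : ℕ} (x : Fin (n + 1) → R) :
    ∃ y : ℕ → R, x = fun i : Fin (n + 1) => y i :=
  ⟨fun l => if h : l < n + 1 then x ⟨l, h⟩ else 0, funext fun i => by
    change x i = dite _ _ _
    rw [dif_pos i.isLt]⟩

theorem span_wd (n : ℕ) : Submodule.span k (Set.range (wd k n : (ℕ → R) → _)) = ⊤ := by
  rw [eq_top_iff]
  rintro z -
  obtain ⟨u, rfl⟩ := Submodule.mkQ_surjective _ z
  have hu : u ∈ Submodule.span k
      (Set.range (PiTensorProduct.tprod k (s := fun _ : Fin (n + 1) => R))) := by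
    rw [PiTensorProduct.span_tprod_eq_top]
    exact Submodule.mem_top
  refine (Submodule.span_le (p := (Submodule.span k (Set.range (wd k n : (ℕ → R) → _))).comap
    (degenerate k (1 : R) n).mkQ)).2 ?_ hu
  rintro _ ⟨x, rfl⟩
  obtain ⟨y, rfl⟩ := exists_nat_extension x
  exact Submodule.subset_span ⟨y, rfl⟩

theorem ext_wd {n : ℕ} {Q : Type*} [AddCommGroup Q] [Module k Q] {g h : NormChains k R n →ₗ[k] Q}
    (e : ∀ x, g (wd k n x) = h (wd k n x)) : g = h := by
  refine LinearMap.ext_on (span_wd n) ?_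
  rintro _ ⟨x, rfl⟩
  exact e x

/-! ### Contractions and rotations of sequences -/

/-- `(x_0, …, β(x_j, x_{j+1}), …)`. -/
def con (β : R →ₗ[k] R →ₗ[k] R) (j : ℕ) (x : ℕ → R) : ℕ → R := fun l =>
  if l < j then x l else if l = j then β (x j) (x (j + 1)) else x (l + 1)

/-- `(β(x_{n+1}, x_0), x_1, …, x_n)`. -/
def cyc (β : R →ₗ[k] R →ₗ[k] R) (n : ℕ) (x : ℕ → R) : ℕ → R := fun l =>
  if l = 0 then β (x (n + 1)) (x 0) else x l

/-- `(x_i, …, x_n, x_0, …, x_{i-1})`. -/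
def rot (n i : ℕ) (x : ℕ → R) : ℕ → R := fun l =>
  if l + i ≤ n then x (l + i) else x (l + i - (n + 1))

/-- `(1, x_0, x_1, …)`. -/
def pre (x : ℕ → R) : ℕ → R := fun l => if l = 0 then 1 else x (l - 1)

theorem contractFun_eq (β : R →ₗ[k] R →ₗ[k] R) {n : ℕ} (j : Fin (n + 1)) (x : ℕ → R) :
    contractFun β j (fun i : Fin (n + 2) => x i) = fun i : Fin (n + 1) => con β j x i := by
  funext l
  simp only [contractFun, con, Fin.lt_def, Fin.ext_iff, Fin.val_castSucc, Fin.val_succ]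
  split_ifs with h1 h2
  · rfl
  · rw [h2]
  · rfl

theorem rotate_nat (n : ℕ) (i : Fin (n + 1)) (x : ℕ → R) :
    (fun l : Fin (n + 1) => x ((l + i : Fin (n + 1)) : ℕ)) =
      fun l : Fin (n + 1) => rot n i x l := by
  funext l
  simp only [rot, Fin.val_add_eq_ite]
  have h1 := l.isLt
  have h2 := i.isLt
  split_ifs with h3 h4 h4
  · omega
  · rfl
  · rfl
  · omega

theorem contract_mk (β : R →ₗ[k] R →ₗ[k] R) {n : ℕ} (j : Fin (n + 1)) (x : ℕ → R) :
    (Submodule.Quotient.mk (contract β j (PiTensorProduct.tprod k fun i : Fin (n + 2) => x i)) :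
      NormChains k R n) = wd k n (con β j x) := by
  rw [contract_tprod, contractFun_eq]
  rfl

theorem hochschildB_mk (β : R →ₗ[k] R →ₗ[k] R) (n : ℕ) (x : ℕ → R) :
    (Submodule.Quotient.mk (hochschildB β n (PiTensorProduct.tprod k fun i : Fin (n + 2) => x i)) :
      NormChains k R n) = ∑ j ∈ Finset.range (n + 1), (-1 : k) ^ j • wd k n (con β j x) +
        (-1 : k) ^ (n + 1) • wd k n (cyc β n x) := by
  -- The cyclic face is the contraction at `0` of the word rotated by `n + 1`.
  have h : (degenerate k (1 : R) n).mkQ (contract β 0 (PiTensorProduct.tprod k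
      fun l : Fin (n + 2) => rot (n + 1) (n + 1) x l)) = wd k n (cyc β n x) := by
    refine (contract_mk β 0 _).trans (wd_congr fun l hl => ?_)
    simp only [con, cyc, rot, Fin.val_zero]
    grind
  rw [← Submodule.mkQ_apply]
  simp only [hochschildB, LinearMap.add_apply, LinearMap.sum_apply, LinearMap.smul_apply,
    LinearMap.comp_apply, rotate_tprod, map_add, map_sum, map_smul]
  have e : (fun l : Fin (n + 2) => x ((l + Fin.last (n + 1) : Fin (n + 2)) : ℕ)) =
      fun l : Fin (n + 2) => rot (n + 1) (n + 1) x l := rotate_nat (n + 1) (Fin.last _) x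
  rw [e, h, ← Fin.sum_univ_eq_sum_range (fun j => (-1 : k) ^ j • wd k n (con β j x))]
  simp only [Submodule.mkQ_apply, contract_mk]

/-! ### Boundary, Connes' operator and cuts on words -/

variable (k R) in
/-- The Hochschild boundary on normalized chains. -/
def bN (n : ℕ) : NormChains k R (n + 1) →ₗ[k] NormChains k R n := (hochschildMixed k R).b n

variable (k R) in
/-- The Connes operator on normalized chains. -/
def BN (n : ℕ) : NormChains k R n →ₗ[k] NormChains k R (n + 1) := (hochschildMixed k R).B n

theorem bN_wd (n : ℕ) (x : ℕ → R) :
    bN k R n (wd k (n + 1) x) =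
      ∑ j ∈ Finset.range (n + 1), (-1 : k) ^ j • wd k n (con (LinearMap.mul k R) j x) +
        (-1 : k) ^ (n + 1) • wd k n (cyc (LinearMap.mul k R) n x) :=
  hochschildB_mk _ n x

theorem rot_zero (n : ℕ) (x : ℕ → R) {i : ℕ} (hi : i ≤ n) : rot n 0 x i = x i := by
  simp [rot, hi]

theorem rot_self (n : ℕ) (x : ℕ → R) : rot n (n + 1) x = x := by
  funext i
  rw [rot, if_neg (by omega), Nat.add_sub_cancel]

/-- The linear map `x_0 ⊗ ⋯ ⊗ x_n ↦ 1 ⊗ x_i ⊗ ⋯ ⊗ x_n ⊗ x_0 ⊗ ⋯ ⊗ x_{i-1}`. -/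
def cutL (k : Type*) [CommRing k] (R : Type*) [Ring R] [Algebra k R] (n i : ℕ) :
    NormChains k R n →ₗ[k] NormChains k R (n + 1) :=
  Submodule.mapQ _ _ (prepend (1 : R) n ∘ₗ rotate k R (Fin.ofNat (n + 1) i)) (by
    refine degenerate_le fun x j hj hx => ?_
    simp only [Submodule.mem_comap, LinearMap.comp_apply, rotate_tprod, prepend_tprod]
    refine tprod_mem_degenerate 1 _ (j - Fin.ofNat (n + 1) i).succ (Fin.succ_ne_zero _) ?_
    simp [hx])

theorem cons_nat (n : ℕ) (x : ℕ → R) :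
    (Fin.cons 1 fun l : Fin (n + 1) => x l : Fin (n + 2) → R) =
      fun l : Fin (n + 2) => pre x l := by
  funext l
  refine Fin.cases ?_ (fun l => ?_) l <;> simp [pre]

/-- The value `i = n + 1` is allowed: `Fin.ofNat` reduces it to the cut at `0`, and `rot n (n + 1)`
is the identity. -/
theorem cutL_wd {n i : ℕ} (hi : i ≤ n + 1) (x : ℕ → R) :
    cutL k R n i (wd k n x) = wd k (n + 1) (pre (rot n i x)) := by
  have h : ∀ i (hi : i < n + 1), ∀ i' : Fin (n + 1), (i' : ℕ) = i →
      (degenerate k (1 : R) (n + 1)).mkQ ((prepend (1 : R) n ∘ₗ rotate k R i')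
        (PiTensorProduct.tprod k fun i : Fin (n + 1) => x i)) =
        wd k (n + 1) (pre (rot n i x)) := by
    rintro i hi i' rfl
    rw [LinearMap.comp_apply, rotate_tprod, prepend_tprod, rotate_nat, cons_nat]
    rfl
  rcases hi.lt_or_eq with hi | rfl
  · exact h i hi _ (by simp [Nat.mod_eq_of_lt hi])
  · refine (h 0 (Nat.succ_pos _) _ (by simp)).trans (wd_congr fun l hl => ?_)
    simp only [pre, rot_self]
    split_ifs
    · rfl
    · exact rot_zero n x (by omega)

/-- A cut at `i ≠ 0` moves the leading unit to position `n + 2 - i ≥ 1`, where it makes the chain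
degenerate. Every vanishing of a composite of two cut operators comes from this. -/
theorem cutL_wd_one {n i : ℕ} (h0 : i ≠ 0) (hi : i ≤ n + 1) {x : ℕ → R} (hx : x 0 = 1) :
    cutL k R n i (wd k n x) = 0 := by
  rw [cutL_wd hi]
  refine wd_eq_zero_of_one (i := n + 2 - i) (by omega) (by omega) ?_
  simp only [pre, rot]
  split_ifs <;> first | omega | (rw [← hx]; congr 1; omega)

/-- The part of Connes' operator given by the cuts at the positions `> c`. -/
def cutSum (k : Type*) [CommRing k] (R : Type*) [Ring R] [Algebra k R] (n c : ℕ) :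
    NormChains k R n →ₗ[k] NormChains k R (n + 1) :=
  ∑ i ∈ Finset.Ico (c + 1) (n + 2), (-1 : k) ^ (i * n) • cutL k R n i

theorem cutSum_apply (n c : ℕ) (z : NormChains k R n) : cutSum k R n c z =
    ∑ i ∈ Finset.Ico (c + 1) (n + 2), (-1 : k) ^ (i * n) • cutL k R n i z := by
  simp [cutSum]

theorem neg_one_pow_eq_of_even {a b : ℕ} (h : Even (a + b)) : (-1 : k) ^ a = (-1) ^ b := by
  rcases Nat.even_or_odd a with ha | ha
  · rw [ha.neg_one_pow, ((Nat.even_add.1 h).1 ha).neg_one_pow]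
  · rw [ha.neg_one_pow, Odd.neg_one_pow]
    rw [← Nat.not_even_iff_odd] at ha ⊢
    exact fun q => ha ((Nat.even_add.1 h).2 q)

/-- The cut at `0` is counted as the cut at `n + 1`, whose sign `(-1) ^ ((n + 1) * n)` is `1`. With
this convention Connes' operator consists of the cuts strictly behind position `0`. -/
theorem BN_eq_cutSum (n : ℕ) : BN k R n = cutSum k R n 0 := by
  refine ext_wd fun x => ?_
  have h : BN k R n (wd k n x) =
      ∑ i ∈ Finset.range (n + 1), (-1 : k) ^ (i * n) • wd k (n + 1) (pre (rot n i x)) := by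
    change (degenerate k (1 : R) (n + 1)).mkQ (connesB (1 : R) n _) = _
    simp only [connesB, LinearMap.sum_apply, LinearMap.smul_apply,
      LinearMap.comp_apply, rotate_tprod, map_sum, map_smul, prepend_tprod, rotate_nat]
    simp only [cons_nat]
    exact Fin.sum_univ_eq_sum_range (fun i => (-1 : k) ^ (i * n) •
      wd k (n + 1) (pre (rot n i x))) _
  rw [h, cutSum_apply, Finset.sum_range_succ', Finset.sum_Ico_succ_top (by omega),
    Finset.sum_Ico_eq_sum_range]
  congr 1
  · refine Finset.sum_congr rfl fun i hi => ?_
    rw [Finset.mem_range] at hi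
    rw [cutL_wd (by omega), zero_add, add_comm 1 i]
  · rw [cutL_wd le_rfl, rot_self, zero_mul, pow_zero, mul_comm (n + 1),
      (Nat.even_mul_succ_self n).neg_one_pow, one_smul, one_smul]
    refine wd_congr fun l hl => ?_
    simp only [pre]
    split_ifs
    · rfl
    · exact rot_zero n x (by omega)

end Words

section Words

variable {k : Type*} [CommRing k] {R : Type*} [Ring R] [Algebra k R]

/-! ### The Hochschild complex is a mixed complex -/

variable (k) in
/-- The `j`-th face of a sequence of length `n + 2`, including the cyclic one. -/
def face (n j : ℕ) (x : ℕ → R) : ℕ → R :=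
  fun l => if j ≤ n then con (LinearMap.mul k R) j x l else cyc (LinearMap.mul k R) n x l

theorem bN_wd_face (n : ℕ) (x : ℕ → R) :
    bN k R n (wd k (n + 1) x) =
      ∑ j ∈ Finset.range (n + 2), (-1 : k) ^ j • wd k n (face k n j x) := by
  rw [bN_wd, Finset.sum_range_succ _ (n + 1)]
  congr 1
  · refine Finset.sum_congr rfl fun j hj => ?_
    congr 1
    exact wd_congr fun l _ => (if_pos (Nat.lt_succ_iff.1 (Finset.mem_range.1 hj))).symm
  · congr 1
    exact wd_congr fun l _ => (if_neg (Nat.not_succ_le_self n)).symm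

/-- The simplicial identities `d_i d_j = d_{j-1} d_i` for `i < j`, including the cyclic face as the
last one. -/
theorem face_face (n : ℕ) {i j : ℕ} (hij : i < j) (hj : j ≤ n + 2) (x : ℕ → R) {l : ℕ}
    (hl : l ≤ n) :
    face k n i (face k (n + 1) j x) l = face k n (j - 1) (face k (n + 1) i x) l := by
  simp only [face, con, cyc, LinearMap.mul_apply']
  by_cases h1 : j ≤ n + 1
  · have h2 : i ≤ n := by omega
    have h3 : j - 1 ≤ n := by omega
    have h4 : i ≤ n + 1 := by omega
    simp only [h1, h2, h3, h4, if_true]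
    grind
  · have h5 : j = n + 2 := by omega
    subst h5
    have h3 : ¬ n + 2 - 1 ≤ n := by omega
    have h4 : i ≤ n + 1 := by omega
    simp only [h1, h3, h4, if_true, if_false]
    grind

theorem bN_bN (n : ℕ) : bN k R n ∘ₗ bN k R (n + 1) = 0 := by
  refine ext_wd fun x => ?_
  rw [LinearMap.comp_apply, bN_wd_face, map_sum, LinearMap.zero_apply]
  simp only [map_smul, bN_wd_face, Finset.smul_sum]
  rw [Finset.sum_sigma']
  -- The terms of `b²` with `i < j` and those with `j ≤ i` are exchanged by `(j, i) ↦ (i, j - 1)`,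
  -- with opposite signs.
  refine Finset.sum_involution
    (fun p _ => if p.2 < p.1 then ⟨p.2, p.1 - 1⟩ else ⟨p.2 + 1, p.1⟩) ?_ ?_ ?_ ?_
  · rintro ⟨j, i⟩ hp
    simp only [Finset.mem_sigma, Finset.mem_range] at hp
    by_cases h : i < j
    · simp only [h, if_true]
      rw [smul_smul, smul_smul, wd_congr fun l hl => face_face n h (by omega) x hl, ← add_smul]
      obtain ⟨j, rfl⟩ : ∃ j', j = j' + 1 := ⟨j - 1, by omega⟩
      rw [Nat.add_sub_cancel]
      convert zero_smul k _ using 2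
      ring
    · simp only [h, if_false]
      rw [smul_smul, smul_smul, wd_congr (x := face k n j (face k (n + 1) (i + 1) x))
        fun l hl => face_face n (show j < i + 1 by omega) (by omega) x hl, Nat.add_sub_cancel,
        ← add_smul]
      convert zero_smul k _ using 2
      ring
  · rintro ⟨j, i⟩ hp _ e
    simp only at e
    split_ifs at e with h
    · have := congrArg Sigma.fst e
      simp only at this
      omega
    · have := congrArg Sigma.fst e
      simp only at this
      omega
  · rintro ⟨j, i⟩ hp
    simp only [Finset.mem_sigma, Finset.mem_range] at hp
    by_cases h : i < j <;> simp [h] <;> omega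
  · rintro ⟨j, i⟩ hp
    simp only [Finset.mem_sigma, Finset.mem_range] at hp
    by_cases h : i < j
    · have h' : ¬ j - 1 < i := by omega
      simp [h, h', Nat.sub_add_cancel (show 1 ≤ j by omega)]
    · have h' : j < i + 1 := by omega
      simp [h, h']

/-! ### The boundary of a cut -/

theorem pre_congr {n : ℕ} {x y : ℕ → R} (h : ∀ i ≤ n, x i = y i) :
    wd k (n + 1) (pre x) = wd k (n + 1) (pre y) := by
  refine wd_congr fun i hi => ?_
  simp only [pre]
  split_ifs
  · rfl
  · exact h _ (by omega)

/-- In a word starting with `1`, the face at `0` deletes the unit; the cyclic face multiplies the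
unit by the last entry `x_i`, which amounts to cutting one place earlier. The inner faces are
shifted by one place, whence their sign. -/
theorem bN_pre_rot (n i : ℕ) (hi : i ≤ n) (x : ℕ → R) :
    bN k R n (wd k (n + 1) (pre (rot n (i + 1) x))) =
      wd k n (rot n (i + 1) x) - (-1 : k) ^ n • wd k n (rot n i x) -
      ∑ j ∈ Finset.range n,
        (-1 : k) ^ j • wd k n (pre (con (LinearMap.mul k R) j (rot n (i + 1) x))) := by
  rw [bN_wd, Finset.sum_range_succ', pow_zero, one_smul,
    wd_congr (x := con _ 0 _) (y := rot n (i + 1) x), wd_congr (x := cyc _ n _) (y := rot n i x),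
    Finset.sum_congr rfl fun j hj => ?_, Finset.sum_neg_distrib]
  rotate_left
  · exact fun j => (-1 : k) ^ j • wd k n (pre (con (LinearMap.mul k R) j (rot n (i + 1) x)))
  · rw [pow_succ, mul_neg_one, neg_smul]
    congr 2
    refine wd_congr fun l hl => ?_
    simp only [pre, con, LinearMap.mul_apply']
    grind
  · intro l hl
    simp only [pre, cyc, rot, LinearMap.mul_apply']
    grind
  · intro l hl
    simp only [pre, con, LinearMap.mul_apply']
    grind
  · rw [pow_succ, mul_neg_one, neg_smul]
    abel

/-- `(-1)^l` times the cut at `i` of the `l`-th contraction. -/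
def cutCon (n i l : ℕ) (x : ℕ → R) : NormChains k R (n + 1) :=
  (-1 : k) ^ (l + i * n) • cutL k R n i (wd k n (con (LinearMap.mul k R) l x))

/-- The cut at `i` of the cyclic contraction. -/
def cutCyc (n i : ℕ) (x : ℕ → R) : NormChains k R (n + 1) :=
  (-1 : k) ^ (n + 1 + i * n) • cutL k R n i (wd k n (cyc (LinearMap.mul k R) n x))

/-- Contracting adjacent entries of a cut word is cutting a contracted word. The pair `(x_l,
x_{l+1})` with `l < i` shortens the part in front of the cut, which is then at `i`; a pair with `l >
i` leaves the cut at `i + 1`; the pair `(x_{n+1}, x_0)` gives the cyclic contraction. The pair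
`(x_i, x_{i+1})` is separated by the cut and does not occur; for `i = n + 1` the separated pair is
`(x_{n+1}, x_0)`. -/
theorem sum_con_rot (n i : ℕ) (hi : i ≤ n + 1) (x : ℕ → R) :
    (-1 : k) ^ ((i + 1) * (n + 1)) • ∑ j ∈ Finset.range (n + 1),
        (-1 : k) ^ j • wd k (n + 1) (pre (con (LinearMap.mul k R) j (rot (n + 1) (i + 1) x))) =
      ∑ l ∈ Finset.range i, cutCon n i l x + ∑ l ∈ Finset.Ico (i + 1) (n + 1), cutCon n (i + 1) l x
        + if i ≤ n then cutCyc n (i + 1) x else 0 := by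
  have hA : ∀ j l, j + i = l + (n + 1) → l < i →
      (-1 : k) ^ ((i + 1) * (n + 1)) • (-1 : k) ^ j •
        wd k (n + 1) (pre (con (LinearMap.mul k R) j (rot (n + 1) (i + 1) x))) =
      cutCon n i l x := by
    intro j l h hl
    rw [cutCon, cutL_wd (by omega), smul_smul, ← pow_add]
    congr 1
    · refine neg_one_pow_eq_of_even ⟨i * n + l + n + 1, ?_⟩
      have : j = l + (n + 1) - i := by omega
      zify [show i ≤ l + (n + 1) by omega] at this ⊢
      rw [this]
      ring
    · refine pre_congr fun m hm => ?_
      simp only [con, rot, LinearMap.mul_apply']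
      grind
  have hB : ∀ j l, l = j + (i + 1) → l < n + 1 →
      (-1 : k) ^ ((i + 1) * (n + 1)) • (-1 : k) ^ j •
        wd k (n + 1) (pre (con (LinearMap.mul k R) j (rot (n + 1) (i + 1) x))) =
      cutCon n (i + 1) l x := by
    rintro j l rfl hl
    rw [cutCon, cutL_wd (by omega), smul_smul, ← pow_add]
    congr 1
    · exact neg_one_pow_eq_of_even ⟨(i + 1) * n + j + i + 1, by ring⟩
    · refine pre_congr fun m hm => ?_
      simp only [con, rot, LinearMap.mul_apply']
      grind
  have hC : ∀ j, j + i = n →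
      (-1 : k) ^ ((i + 1) * (n + 1)) • (-1 : k) ^ j •
        wd k (n + 1) (pre (con (LinearMap.mul k R) j (rot (n + 1) (i + 1) x))) =
      cutCyc n (i + 1) x := by
    rintro j rfl
    rw [cutCyc, cutL_wd (by omega), smul_smul, ← pow_add]
    congr 1
    · exact neg_one_pow_eq_of_even ⟨(i + 1) * (j + i) + j + i + 1, by ring⟩
    · refine pre_congr fun m hm => ?_
      simp only [con, rot, cyc, LinearMap.mul_apply']
      grind
  rw [Finset.smul_sum, Finset.range_eq_Ico]
  rcases hi.lt_or_eq with hi | rfl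
  · rw [← Finset.sum_Ico_consecutive _ (Nat.zero_le (n - i)) (show n - i ≤ n + 1 by omega),
      Finset.sum_eq_sum_Ico_succ_bot (show n - i < n + 1 by omega), if_pos (by omega),
      hC _ (by omega)]
    have h1 : ∑ j ∈ Finset.Ico 0 (n - i), (-1 : k) ^ ((i + 1) * (n + 1)) • (-1 : k) ^ j •
        wd k (n + 1) (pre (con (LinearMap.mul k R) j (rot (n + 1) (i + 1) x))) =
        ∑ l ∈ Finset.Ico (i + 1) (n + 1), cutCon n (i + 1) l x := by
      rw [Finset.sum_Ico_eq_sum_range, Finset.sum_Ico_eq_sum_range]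
      refine Finset.sum_congr (congrArg _ (by omega)) fun j hj => ?_
      rw [Finset.mem_range] at hj
      exact hB _ _ (by omega) (by omega)
    have h2 : ∑ j ∈ Finset.Ico (n - i + 1) (n + 1), (-1 : k) ^ ((i + 1) * (n + 1)) • (-1 : k) ^ j •
        wd k (n + 1) (pre (con (LinearMap.mul k R) j (rot (n + 1) (i + 1) x))) =
        ∑ l ∈ Finset.Ico 0 i, cutCon n i l x := by
      rw [Finset.sum_Ico_eq_sum_range, Finset.sum_Ico_eq_sum_range]
      refine Finset.sum_congr (congrArg _ (by omega)) fun j hj => ?_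
      rw [Finset.mem_range] at hj
      exact hA _ _ (by omega) (by omega)
    rw [h1, h2, ← Finset.range_eq_Ico]
    abel
  · rw [if_neg (by omega), Finset.Ico_eq_empty (a := n + 1 + 1) (by omega), Finset.sum_empty,
      add_zero, add_zero, ← Finset.range_eq_Ico]
    exact Finset.sum_congr rfl fun j hj => hA _ _ (by omega) (Finset.mem_range.1 hj)

/-- The outer faces of consecutive cuts telescope. The upper end is the full rotation `rot n (n +
1)`, which is the identity with sign `+1`. -/
theorem cutSum_sub (n c : ℕ) (hc : c ≤ n) (x : ℕ → R) :
    ∑ i ∈ Finset.Ico c (n + 1), (-1 : k) ^ ((i + 1) * n) • (wd k n (rot n (i + 1) x) -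
      (-1 : k) ^ n • wd k n (rot n i x)) =
    wd k n x - (-1 : k) ^ (c * n) • wd k n (rot n c x) := by
  have h : ∀ i, (-1 : k) ^ ((i + 1) * n) • (wd k n (rot n (i + 1) x) -
      (-1 : k) ^ n • wd k n (rot n i x)) =
      (-1 : k) ^ ((i + 1) * n) • wd k n (rot n (i + 1) x) -
        (-1 : k) ^ (i * n) • wd k n (rot n i x) := by
    intro i
    rw [smul_sub, smul_smul, ← pow_add]
    congr 2
    exact neg_one_pow_eq_of_even ⟨i * n + n, by ring⟩
  simp only [h]
  have h2 := Finset.sum_Ico_sub (fun i => (-1 : k) ^ (i * n) • wd k n (rot n i x))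
    (show c ≤ n + 1 by omega)
  rw [h2, rot_self, mul_comm (n + 1), (Nat.even_mul_succ_self n).neg_one_pow, one_smul]

theorem bN_cutSum_zero (x : ℕ → R) : bN k R 0 (cutSum k R 0 0 (wd k 0 x)) = 0 := by
  rw [cutSum_apply, Finset.sum_Ico_succ_top (by omega), Finset.Ico_self, Finset.sum_empty,
    zero_add (_ • _), cutL_wd le_rfl, map_smul, bN_pre_rot 0 0 le_rfl]
  simp only [Finset.range_zero, Finset.sum_empty, mul_zero, pow_zero, one_smul, sub_zero]
  rw [rot_self, wd_congr fun i hi => rot_zero 0 x hi, sub_self]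

theorem cutSum_con (n c l : ℕ) (x : ℕ → R) :
    (-1 : k) ^ l • cutSum k R n c (wd k n (con (LinearMap.mul k R) l x)) =
      ∑ i ∈ Finset.Ico (c + 1) (n + 2), cutCon n i l x := by
  simp only [cutSum_apply, Finset.smul_sum, cutCon, smul_smul, pow_add]

theorem cutSum_cyc (n c : ℕ) (x : ℕ → R) :
    (-1 : k) ^ (n + 1) • cutSum k R n c (wd k n (cyc (LinearMap.mul k R) n x)) =
      ∑ i ∈ Finset.Ico (c + 1) (n + 2), cutCyc n i x := by
  simp only [cutSum_apply, Finset.smul_sum, cutCyc, smul_smul, pow_add]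

/-- The boundary of the sum of the cuts after position `c`. -/
theorem bN_cutSum (n c : ℕ) (hc : c ≤ n + 1) (x : ℕ → R) :
    bN k R (n + 1) (cutSum k R (n + 1) c (wd k (n + 1) x)) =
      wd k (n + 1) x - (-1 : k) ^ (c * (n + 1)) • wd k (n + 1) (rot (n + 1) c x) -
      (∑ l ∈ Finset.range c,
        (-1 : k) ^ l • cutSum k R n (c - 1) (wd k n (con (LinearMap.mul k R) l x)) +
      ∑ l ∈ Finset.Ico c (n + 1),
        (-1 : k) ^ l • cutSum k R n c (wd k n (con (LinearMap.mul k R) l x)) +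
      (-1 : k) ^ (n + 1) • cutSum k R n c (wd k n (cyc (LinearMap.mul k R) n x))) := by
  rw [← cutSum_sub (n + 1) c hc x, cutSum_apply, map_sum]
  have h0 : ∀ i ∈ Finset.Ico c (n + 2), bN k R (n + 1) ((-1 : k) ^ ((i + 1) * (n + 1)) •
      cutL k R (n + 1) (i + 1) (wd k (n + 1) x)) =
      (-1 : k) ^ ((i + 1) * (n + 1)) • (wd k (n + 1) (rot (n + 1) (i + 1) x) -
      (-1 : k) ^ (n + 1) • wd k (n + 1) (rot (n + 1) i x)) -
      (∑ l ∈ Finset.range i, cutCon n i l x + ∑ l ∈ Finset.Ico (i + 1) (n + 1), cutCon n (i + 1) l x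
        + if i ≤ n then cutCyc n (i + 1) x else 0) := by
    intro i hi
    rw [Finset.mem_Ico] at hi
    rw [map_smul, cutL_wd (by omega), bN_pre_rot (n + 1) i (by omega), smul_sub,
      sum_con_rot n i (by omega)]
  rw [← Finset.sum_Ico_add' (fun i => bN k R (n + 1) ((-1 : k) ^ (i * (n + 1)) •
      cutL k R (n + 1) i (wd k (n + 1) x))) c (n + 2) 1, Finset.sum_congr rfl h0,
      Finset.sum_sub_distrib]
  congr 1
  rw [Finset.sum_add_distrib, Finset.sum_add_distrib]
  simp only [cutSum_con, cutSum_cyc]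
  congr 1
  · rw [Finset.sum_Ico_succ_top (show c ≤ n + 1 by omega)
      (fun i => ∑ l ∈ Finset.Ico (i + 1) (n + 1), cutCon (k := k) n (i + 1) l x),
      Finset.Ico_eq_empty (a := n + 1 + 1) (by omega), Finset.sum_empty, add_zero,
      Finset.sum_Ico_add' (fun i => ∑ l ∈ Finset.Ico i (n + 1), cutCon (k := k) n i l x) c (n + 1) 1,
      Finset.sum_eq_sum_Ico_succ_bot (show c < n + 2 by omega), add_assoc,
      ← Finset.sum_add_distrib, Finset.sum_comm (s := Finset.Ico c (n + 1))]
    -- After reindexing, each cut position `i > c` meets all contractions exactly once, so the range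
    -- of `l` can be split at `c` instead of `i`. The position `i = c` only meets `l < c`; it
    -- enlarges those sums to `cutSum` from `c - 1`.
    have h1 : ∀ i ∈ Finset.Ico (c + 1) (n + 2), ∑ l ∈ Finset.range i, cutCon (k := k) n i l x +
        ∑ l ∈ Finset.Ico i (n + 1), cutCon (k := k) n i l x =
        ∑ l ∈ Finset.range c, cutCon (k := k) n i l x + ∑ l ∈ Finset.Ico c (n + 1), cutCon (k := k) n i l x := by
      intro i hi
      rw [Finset.mem_Ico] at hi
      rw [Finset.sum_range_add_sum_Ico _ (by omega), Finset.sum_range_add_sum_Ico _ (by omega)]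
    rw [Finset.sum_congr rfl h1, Finset.sum_add_distrib, ← add_assoc]
    congr 1
    rcases Nat.eq_zero_or_pos c with rfl | h
    · simp
    · rw [Nat.sub_add_cancel h, Finset.sum_comm (s := Finset.range c),
        Finset.sum_eq_sum_Ico_succ_bot (show c < n + 2 by omega)]
  · rw [Finset.sum_Ico_succ_top (show c ≤ n + 1 by omega), if_neg (by omega), add_zero,
      ← Finset.sum_Ico_add' (fun i => cutCyc (k := k) n i x) c (n + 1) 1]
    exact Finset.sum_congr rfl fun i hi => if_pos (by rw [Finset.mem_Ico] at hi; omega)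

theorem cutSum_cutL (n c : ℕ) {i : ℕ} (hi : i ≤ n + 1) :
    cutSum k R (n + 1) c ∘ₗ cutL k R n i = 0 := by
  refine ext_wd fun x => ?_
  rw [LinearMap.comp_apply, cutL_wd hi, cutSum_apply]
  refine Finset.sum_eq_zero fun j hj => ?_
  rw [Finset.mem_Ico] at hj
  rw [cutL_wd_one (by omega) (by omega) (by simp [pre]), smul_zero]

theorem BN_cutSum (n c : ℕ) : BN k R (n + 1) ∘ₗ cutSum k R n c = 0 := by
  refine LinearMap.ext fun z => ?_
  simp only [BN_eq_cutSum, LinearMap.comp_apply]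
  rw [cutSum_apply n c, map_sum]
  refine Finset.sum_eq_zero fun i hi => ?_
  rw [Finset.mem_Ico] at hi
  rw [map_smul, ← LinearMap.comp_apply, cutSum_cutL _ _ (by omega), LinearMap.zero_apply,
    smul_zero]

variable (k R) in
/-- The normalized Hochschild complex is a mixed complex. -/
theorem isMixed_hochschildMixed : (hochschildMixed k R).IsMixed := by
  constructor
  · exact fun n => LinearMap.congr_fun (bN_bN (k := k) (R := R) n)
  · intro n x
    have h := LinearMap.congr_fun (BN_cutSum (k := k) (R := R) n 0) x
    rwa [← BN_eq_cutSum] at h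
  · have h : bN k R 0 ∘ₗ BN k R 0 = 0 := ext_wd fun x => by
      rw [LinearMap.comp_apply, BN_eq_cutSum, bN_cutSum_zero, LinearMap.zero_apply]
    exact LinearMap.congr_fun h
  · intro n
    -- For `c = 0` the two outer terms of `bN_cutSum` cancel, and the rest is `-B b`.
    have h : bN k R (n + 1) ∘ₗ BN k R (n + 1) + BN k R n ∘ₗ bN k R n = 0 := ext_wd fun x => by
      rw [LinearMap.add_apply, LinearMap.comp_apply, LinearMap.comp_apply, BN_eq_cutSum,
        BN_eq_cutSum, bN_cutSum n 0 (Nat.zero_le _), bN_wd, map_add, map_sum]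
      simp only [map_smul, Finset.range_zero, Finset.sum_empty, zero_mul, pow_zero, one_smul,
        zero_add, ← Finset.range_eq_Ico]
      rw [wd_congr fun i hi => rot_zero (n + 1) x hi, sub_self, zero_sub, neg_add_cancel,
        LinearMap.zero_apply]
    exact LinearMap.congr_fun h

end Words

namespace SqZeroExt

open MulOpposite (op)

variable {k A M : Type*} [CommRing k] [Ring A] [Algebra k A] [AddCommGroup M]
  [Module k M] [Module A M] [Module Aᵐᵒᵖ M] [SMulCommClass A Aᵐᵒᵖ M]
  [IsScalarTower k A M] [IsScalarTower k Aᵐᵒᵖ M] {f : NormalCocycle k A M}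

/-! ## The comparison map -/

/-- The last entry of `(x_0, …, x_n)` in `M` is `x_c`, and the following ones are in `A`. -/
structure LastM (n c : ℕ) (x : ℕ → SqZeroExt f) : Prop where
  le : c ≤ n
  mem : fstL f (x c) = 0
  tail : ∀ j, c < j → j ≤ n → sndL f (x j) = 0

theorem projA_of_snd {v : SqZeroExt f} (h : sndL f v = 0) : projA f v = v := by
  ext <;> simp [projA, h]

theorem projA_of_fst {v : SqZeroExt f} (h : fstL f v = 0) : projA f v = 0 := by
  ext <;> simp [projA, h]

theorem projM_of_fst {v : SqZeroExt f} (h : fstL f v = 0) : projM f v = v := by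
  ext <;> simp [projM, h]

theorem projM_of_snd {v : SqZeroExt f} (h : sndL f v = 0) : projM f v = 0 := by
  ext <;> simp [projM, h]

theorem projA_one : projA f 1 = 1 := projA_of_snd rfl

variable (f) in
/-- The projector onto the tensors with entries in `A` from the position `i` on. -/
def tailA (n i : ℕ) : NormChains k (SqZeroExt f) n →ₗ[k] NormChains k (SqZeroExt f) n :=
  Submodule.mapQ _ _
    (PiTensorProduct.map fun j : Fin (n + 1) => if i ≤ j then projA f else LinearMap.id) (by
      refine degenerate_le fun x j hj hx => ?_
      rw [Submodule.mem_comap, PiTensorProduct.map_tprod]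
      refine tprod_mem_degenerate 1 _ j hj ?_
      split_ifs
      · rw [hx, projA_one]
      · exact hx)

theorem tailA_wd (n i : ℕ) (x : ℕ → SqZeroExt f) :
    tailA f n i (wd k n x) = wd k n fun j => if i ≤ j then projA f (x j) else x j := by
  change (degenerate k (1 : SqZeroExt f) n).mkQ (PiTensorProduct.map _ _) = _
  rw [PiTensorProduct.map_tprod]
  unfold wd
  rw [Submodule.mkQ_apply]
  congr 2
  funext j
  dsimp only
  split_ifs <;> rfl

variable (f) in
/-- The part of Connes' operator given by the cuts after the last entry in `M`. -/
def theta (n : ℕ) : NormChains k (SqZeroExt f) n →ₗ[k] NormChains k (SqZeroExt f) (n + 1) :=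
  ∑ i ∈ Finset.Ico 1 (n + 2), (-1 : k) ^ (i * n) • (cutL k (SqZeroExt f) n i ∘ₗ tailA f n i)

theorem theta_apply (n : ℕ) (z : NormChains k (SqZeroExt f) n) : theta f n z =
    ∑ i ∈ Finset.Ico 1 (n + 2), (-1 : k) ^ (i * n) •
      cutL k (SqZeroExt f) n i (tailA f n i z) := by
  simp [theta]

/-- For `i ≤ c` the projector `tailA` applies `projA` to `x_c ∈ M` and kills the word; for `i > c`
it only meets entries already in `A`. This is how `theta`, defined on all chains, detects the last
entry in `M`. -/
theorem LastM.theta_wd {n c : ℕ} {x : ℕ → SqZeroExt f} (h : LastM n c x) :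
    theta f n (wd k n x) = cutSum k (SqZeroExt f) n c (wd k n x) := by
  have hc := h.le
  rw [theta_apply, cutSum_apply,
    ← Finset.sum_Ico_consecutive _ (show 1 ≤ c + 1 by omega) (show c + 1 ≤ n + 2 by omega),
    Finset.sum_eq_zero, zero_add]
  · refine Finset.sum_congr rfl fun i hi => ?_
    rw [Finset.mem_Ico] at hi
    rw [tailA_wd]
    congr 2
    refine wd_congr fun j hj => ?_
    split_ifs
    · exact projA_of_snd (h.tail j (by omega) hj)
    · rfl
  · intro i hi
    rw [Finset.mem_Ico] at hi
    rw [tailA_wd, wd_eq_zero_of_apply hc, map_zero, smul_zero]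
    rw [if_pos (by omega), projA_of_fst h.mem]

theorem theta_cutL (n : ℕ) {i : ℕ} (hi : i ≤ n + 1) :
    theta f (n + 1) ∘ₗ cutL k (SqZeroExt f) n i = 0 := by
  refine ext_wd fun x => ?_
  rw [LinearMap.comp_apply, cutL_wd hi, theta_apply]
  refine Finset.sum_eq_zero fun j hj => ?_
  rw [Finset.mem_Ico] at hj
  rw [tailA_wd, cutL_wd_one (by omega) (by omega), smul_zero]
  -- The cut index is at least `1`, so `tailA` does not touch the leading unit.
  rw [if_neg (by omega)]
  rfl

theorem theta_theta (n : ℕ) (z : NormChains k (SqZeroExt f) n) :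
    theta f (n + 1) (theta f n z) = 0 := by
  rw [theta_apply n, map_sum]
  refine Finset.sum_eq_zero fun i hi => ?_
  rw [Finset.mem_Ico] at hi
  rw [map_smul, ← LinearMap.comp_apply, theta_cutL _ (by omega), LinearMap.zero_apply, smul_zero]

theorem BN_theta (n : ℕ) (z : NormChains k (SqZeroExt f) n) :
    BN k (SqZeroExt f) (n + 1) (theta f n z) = 0 := by
  rw [theta_apply n, map_sum, BN_eq_cutSum]
  refine Finset.sum_eq_zero fun i hi => ?_
  rw [Finset.mem_Ico] at hi
  rw [map_smul, ← LinearMap.comp_apply, cutSum_cutL _ _ (by omega), LinearMap.zero_apply,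
    smul_zero]

/-! ### Entries of contractions -/

theorem fstL_mul_of_left {u v : SqZeroExt f} (h : fstL f u = 0) : fstL f (u * v) = 0 := by
  rw [fstL_mul, h, zero_mul]

theorem fstL_mul_of_right {u v : SqZeroExt f} (h : fstL f v = 0) : fstL f (u * v) = 0 := by
  rw [fstL_mul, h, mul_zero]

theorem mul_of_fst {u v : SqZeroExt f} (hu : fstL f u = 0) (hv : fstL f v = 0) : u * v = 0 := by
  ext <;> simp [hu, hv]

theorem sndL_concat {u v : SqZeroExt f} (hu : sndL f u = 0) (hv : sndL f v = 0) :
    sndL f (concat f u v) = 0 := by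
  simp [concat, hu, hv]

theorem fstL_cocycleE (u v : SqZeroExt f) : fstL f (cocycleE f u v) = 0 := by
  simp [cocycleE]

theorem cocycleE_left {u v : SqZeroExt f} (hu : fstL f u = 0) : cocycleE f u v = 0 := by
  simp [cocycleE, hu]

theorem cocycleE_right {u v : SqZeroExt f} (hv : fstL f v = 0) : cocycleE f u v = 0 := by
  simp [cocycleE, hv]

theorem wd_con_mul {n j : ℕ} (hj : j ≤ n) (x : ℕ → SqZeroExt f) :
    wd k n (con (LinearMap.mul k _) j x) =
      wd k n (con (concat f) j x) + wd k n (con (cocycleE f) j x) := by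
  refine wd_add hj ?_ ?_ ?_
  · simp [con, mul_eq]
  · intro l _ hl
    simp [con, hl]
  · intro l _ hl
    simp [con, hl]

theorem wd_cyc_mul (n : ℕ) (x : ℕ → SqZeroExt f) :
    wd k n (cyc (LinearMap.mul k _) n x) =
      wd k n (cyc (concat f) n x) + wd k n (cyc (cocycleE f) n x) := by
  refine wd_add (Nat.zero_le n) ?_ ?_ ?_
  · simp [cyc, mul_eq]
  · intro l _ hl
    simp [cyc, hl]
  · intro l _ hl
    simp [cyc, hl]

namespace LastM

variable {n c : ℕ} {x : ℕ → SqZeroExt f} (h : LastM (n + 1) c x)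
include h

theorem con_mul_lt {l : ℕ} (hl : l < c) : LastM n (c - 1) (con (LinearMap.mul k _) l x) := by
  have hc := h.le
  refine ⟨by omega, ?_, fun j h1 h2 => ?_⟩
  · rcases Nat.lt_or_ge l (c - 1) with h1 | h1
    · rw [con, if_neg (by omega), if_neg (by omega), Nat.sub_add_cancel (by omega)]
      exact h.mem
    · rw [con, if_neg (by omega), if_pos (by omega)]
      refine fstL_mul_of_right ?_
      rw [show l + 1 = c by omega]
      exact h.mem
  · rw [con, if_neg (by omega), if_neg (by omega)]
    exact h.tail _ (by omega) (by omega)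

theorem con_mul_self (hc : c ≤ n) : LastM n c (con (LinearMap.mul k _) c x) := by
  refine ⟨hc, ?_, fun j h1 h2 => ?_⟩
  · rw [con, if_neg (by omega), if_pos rfl]
    exact fstL_mul_of_left h.mem
  · rw [con, if_neg (by omega), if_neg (by omega)]
    exact h.tail _ (by omega) (by omega)

/-- The product in `E` of two entries of `A` has components in both `A` and `M`, so behind `x_c` its
two parts are followed separately: concatenation keeps `c` as the last position in `M`, while the
cocycle moves it to `l`. -/
theorem con_concat {l : ℕ} (hl : c < l) (hn : l ≤ n) : LastM n c (con (concat f) l x) := by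
  refine ⟨by omega, ?_, fun j h1 h2 => ?_⟩
  · rw [con, if_pos (by omega)]
    exact h.mem
  · unfold con
    split_ifs
    · exact h.tail _ (by omega) (by omega)
    · exact sndL_concat (h.tail _ (by omega) (by omega)) (h.tail _ (by omega) (by omega))
    · exact h.tail _ (by omega) (by omega)

theorem con_cocycleE {l : ℕ} (hl : c < l) (hn : l ≤ n) : LastM n l (con (cocycleE f) l x) := by
  refine ⟨hn, ?_, fun j h1 h2 => ?_⟩
  · rw [con, if_neg (by omega), if_pos rfl]
    exact fstL_cocycleE _ _
  · rw [con, if_neg (by omega), if_neg (by omega)]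
    exact h.tail _ (by omega) (by omega)

/-- Rotating by `l` brings the new entry `f(x_l, x_{l+1})` to the front, and `x_c` becomes the last
entry in `M` again. -/
theorem rot_con_cocycleE {l : ℕ} (hl : c < l) (hn : l ≤ n) :
    LastM n (c + (n + 1) - l) (rot n l (con (cocycleE f) l x)) := by
  refine ⟨by omega, ?_, fun j h1 h2 => ?_⟩
  · rw [rot, if_neg (by omega), con, if_pos (by omega),
      show c + (n + 1) - l + l - (n + 1) = c by omega]
    exact h.mem
  · rw [rot, if_neg (by omega), con, if_pos (by omega)]
    exact h.tail _ (by omega) (by omega)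

theorem cyc_mul (hc : c ≤ n) : LastM n c (cyc (LinearMap.mul k _) n x) := by
  refine ⟨hc, ?_, fun j h1 h2 => ?_⟩
  · unfold cyc
    split_ifs with h0
    · refine fstL_mul_of_right ?_
      rw [← h0]
      exact h.mem
    · exact h.mem
  · rw [cyc, if_neg (by omega)]
    exact h.tail _ h1 (by omega)

end LastM

/-! ### Cuts of rotated words and the homotopy formula -/

theorem cutL_rot {n i l : ℕ} (hi : i ≤ n + 1) (hl : l ≤ n) (h : n + 1 ≤ i + l)
    (y : ℕ → SqZeroExt f) :
    cutL k (SqZeroExt f) n i (wd k n (rot n l y)) =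
      cutL k (SqZeroExt f) n (i + l - (n + 1)) (wd k n y) := by
  rw [cutL_wd hi, cutL_wd (by omega)]
  refine pre_congr fun j hj => ?_
  simp only [rot]
  grind

/-- Rotating by `l` takes the cuts at the positions `> c` and `≤ l` to the last ones. -/
theorem cutSum_rot {n c l : ℕ} (hc : c ≤ l) (hl : l ≤ n) (y : ℕ → SqZeroExt f) :
    (-1 : k) ^ (l * n) • cutSum k (SqZeroExt f) n (c + (n + 1) - l) (wd k n (rot n l y)) =
      ∑ i ∈ Finset.Ico (c + 1) (l + 1), (-1 : k) ^ (i * n) • cutL k (SqZeroExt f) n i (wd k n y) := by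
  rw [cutSum_apply, Finset.smul_sum, Finset.sum_Ico_eq_sum_range, Finset.sum_Ico_eq_sum_range]
  refine Finset.sum_congr (congrArg _ (by omega)) fun i hi => ?_
  rw [Finset.mem_range] at hi
  rw [cutL_rot (by omega) hl (by omega), smul_smul, ← pow_add]
  have e : c + (n + 1) - l + 1 + i + l - (n + 1) = c + 1 + i := by omega
  rw [e]
  congr 1
  refine neg_one_pow_eq_of_even ?_
  have e' : c + (n + 1) - l + 1 + i = c + 1 + i + (n + 1) - l := by omega
  rw [e']
  have h2 : l * n + (c + 1 + i + (n + 1) - l) * n + (c + 1 + i) * n =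
      2 * ((c + 1 + i) * n) + n * (n + 1) := by
    zify [show l ≤ c + 1 + i + (n + 1) by omega]
    ring
  rw [h2]
  exact (even_two_mul _).add (Nat.even_mul_succ_self n)

theorem rot_zero_apply {n i : ℕ} (hi : i ≤ n) (y : ℕ → SqZeroExt f) : rot n i y 0 = y i := by
  simp [rot, hi]

/-- The concatenation part is cut behind `c`, but the cocycle part only behind `l`. Compared with
cutting everything behind `c`, the cuts of the cocycle part at `c < i ≤ l` are missing, and by
`cutSum_rot` they form `theta` of the word rotated by `l`. For `l = c` the cocycle part is zero
because `x_c ∈ M`. -/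
theorem LastM.theta_con_mul {n c : ℕ} {x : ℕ → SqZeroExt f} (h : LastM (n + 1) c x) {l : ℕ}
    (hl : c ≤ l) (hn : l ≤ n) :
    theta f n (wd k n (con (LinearMap.mul k _) l x)) =
      cutSum k (SqZeroExt f) n c (wd k n (con (LinearMap.mul k _) l x)) -
        (-1 : k) ^ (l * n) • theta f n (wd k n (rot n l (con (cocycleE f) l x))) := by
  rcases hl.eq_or_lt with rfl | hl
  · rw [(h.con_mul_self hn).theta_wd, wd_eq_zero_of_apply (x := rot n c _) (Nat.zero_le n),
      map_zero, smul_zero, sub_zero]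
    rw [rot_zero_apply hn, con, if_neg (by omega), if_pos rfl, cocycleE_left h.mem]
  · rw [wd_con_mul hn, map_add, map_add, (h.con_concat hl hn).theta_wd,
      (h.con_cocycleE hl hn).theta_wd, (h.rot_con_cocycleE hl hn).theta_wd,
      cutSum_rot hl.le hn, cutSum_apply n l, cutSum_apply n c (wd k n (con (cocycleE f) l x)),
      ← Finset.sum_Ico_consecutive _ (show c + 1 ≤ l + 1 by omega) (show l + 1 ≤ n + 2 by omega)]
    abel

/-- If `c = n + 1`, the cyclic product absorbs `x_c` into the first entry and `cutSum n c` is an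
empty sum, so all of `theta` remains as an error term. -/
theorem LastM.theta_cyc_mul {n c : ℕ} {x : ℕ → SqZeroExt f} (h : LastM (n + 1) c x) :
    theta f n (wd k n (cyc (LinearMap.mul k _) n x)) =
      cutSum k (SqZeroExt f) n c (wd k n (cyc (LinearMap.mul k _) n x)) +
        if c = n + 1 then theta f n (wd k n (cyc (LinearMap.mul k _) n x)) else 0 := by
  have hc := h.le
  split_ifs with e
  · rw [cutSum_apply, Finset.Ico_eq_empty (by omega), Finset.sum_empty, zero_add]
  · rw [(h.cyc_mul (by omega)).theta_wd, add_zero]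

/-- `theta` is a homotopy from the identity to a map with image in that of the comparison map. -/
theorem LastM.homotopy {n c : ℕ} {x : ℕ → SqZeroExt f} (h : LastM (n + 1) c x) :
    bN k (SqZeroExt f) (n + 1) (theta f (n + 1) (wd k (n + 1) x)) =
      wd k (n + 1) x - (-1 : k) ^ (c * (n + 1)) • wd k (n + 1) (rot (n + 1) c x) -
      theta f n (bN k (SqZeroExt f) n (wd k (n + 1) x)) -
      ∑ l ∈ Finset.Ico c (n + 1), (-1 : k) ^ l • (-1 : k) ^ (l * n) •
        theta f n (wd k n (rot n l (con (cocycleE f) l x))) +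
      (-1 : k) ^ (n + 1) •
        if c = n + 1 then theta f n (wd k n (cyc (LinearMap.mul k _) n x)) else 0 := by
  have hc := h.le
  have h1 : ∑ l ∈ Finset.range c, (-1 : k) ^ l • theta f n
      (wd k n (con (LinearMap.mul k _) l x)) = ∑ l ∈ Finset.range c, (-1 : k) ^ l •
        cutSum k (SqZeroExt f) n (c - 1) (wd k n (con (LinearMap.mul k _) l x)) :=
    Finset.sum_congr rfl fun l hl => by rw [(h.con_mul_lt (Finset.mem_range.1 hl)).theta_wd]
  have h2 : ∑ l ∈ Finset.Ico c (n + 1), (-1 : k) ^ l • theta f n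
      (wd k n (con (LinearMap.mul k _) l x)) = ∑ l ∈ Finset.Ico c (n + 1), (-1 : k) ^ l •
        cutSum k (SqZeroExt f) n c (wd k n (con (LinearMap.mul k _) l x)) -
      ∑ l ∈ Finset.Ico c (n + 1), (-1 : k) ^ l • (-1 : k) ^ (l * n) •
        theta f n (wd k n (rot n l (con (cocycleE f) l x))) := by
    rw [← Finset.sum_sub_distrib]
    refine Finset.sum_congr rfl fun l hl => ?_
    rw [Finset.mem_Ico] at hl
    rw [h.theta_con_mul hl.1 (by omega), smul_sub]
  have h3 := congrArg (fun z => (-1 : k) ^ (n + 1) • z) h.theta_cyc_mul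
  simp only [smul_add] at h3
  rw [h.theta_wd, bN_cutSum n c hc, bN_wd, map_add, map_sum]
  simp only [map_smul]
  rw [h3, ← Finset.sum_range_add_sum_Ico _ hc, h1, h2]
  abel

end SqZeroExt

namespace SqZeroExt

variable {k A M : Type*} [CommRing k] [Ring A] [Algebra k A] [AddCommGroup M]
  [Module k M] [Module A M] [Module Aᵐᵒᵖ M] [SMulCommClass A Aᵐᵒᵖ M]
  [IsScalarTower k A M] [IsScalarTower k Aᵐᵒᵖ M] {f : NormalCocycle k A M}

/-! ### Typed words -/

theorem X_ext {n w : ℕ} {Q : Type*} [AddCommGroup Q] [Module k Q]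
    {g h : NormChains k (SqZeroExt f) n →ₗ[k] Q}
    (e : ∀ T ∈ positions n w, ∀ x : ℕ → SqZeroExt f, HasType T (fun i : Fin (n + 1) => x i) →
      g (wd k n x) = h (wd k n x)) {z : NormChains k (SqZeroExt f) n} (hz : z ∈ X f n w) :
    g z = h z := by
  refine LinearMap.eqOn_span ?_ hz
  rintro _ ⟨T, hT, x, hx, rfl⟩
  obtain ⟨y, rfl⟩ := exists_nat_extension x
  exact e T hT y hx

theorem le_lastPos {n : ℕ} {T : Finset (Fin (n + 1))} {i : Fin (n + 1)} (h : i ∈ T) :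
    i ≤ lastPos T := Finset.le_sup (f := id) h

section

variable {n : ℕ} {T : Finset (Fin (n + 1))} {x : ℕ → SqZeroExt f}
  (hx : HasType T (fun i : Fin (n + 1) => x i))
include hx

theorem HasType.lastM (hT : T.Nonempty) : LastM n (lastPos T) x := by
  refine ⟨Nat.lt_succ_iff.1 (lastPos T).isLt, (hx _).1 (lastPos_mem hT), fun j h1 h2 => ?_⟩
  exact (hx ⟨j, Nat.lt_succ_of_le h2⟩).2 fun h => absurd (le_lastPos h) (not_le_of_gt h1)

theorem HasType.projType_self :
    projType f T (PiTensorProduct.tprod k fun i : Fin (n + 1) => x i) =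
      PiTensorProduct.tprod k fun i : Fin (n + 1) => x i := by
  rw [projType_tprod]
  congr 1
  funext i
  split_ifs with h
  · exact projM_of_fst ((hx i).1 h)
  · exact projA_of_snd ((hx i).2 h)

theorem HasType.projType_of_ne {T' : Finset (Fin (n + 1))} (h : T' ≠ T) :
    projType f T' (PiTensorProduct.tprod k fun i : Fin (n + 1) => x i) = 0 := by
  obtain ⟨i, hi⟩ : ∃ i, ¬ (i ∈ T' ↔ i ∈ T) := by
    by_contra! q
    exact h (Finset.ext q)
  rw [projType_tprod]
  refine MultilinearMap.map_coord_zero _ i ?_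
  split_ifs with h1
  · exact projM_of_snd ((hx i).2 fun q => hi ⟨fun _ => q, fun _ => h1⟩)
  · refine projA_of_fst ((hx i).1 ?_)
    by_contra q
    exact hi ⟨fun r => absurd r h1, fun r => absurd r q⟩

theorem HasType.projTypeN_self : projTypeN f T (wd k n x) = wd k n x :=
  congrArg (degenerate k (1 : SqZeroExt f) n).mkQ hx.projType_self

theorem HasType.projTypeN_of_ne {T' : Finset (Fin (n + 1))} (h : T' ≠ T) :
    projTypeN f T' (wd k n x) = 0 :=
  congrArg (degenerate k (1 : SqZeroExt f) n).mkQ (hx.projType_of_ne h)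

theorem HasType.tN_wd_lastPos {w : ℕ} (hT : T ∈ positions n w) :
    tN f n w (wd k n x) =
      (-1 : k) ^ ((lastPos T : ℕ) * n) • wd k n (rot n (lastPos T : ℕ) x) := by
  change (degenerate k (1 : SqZeroExt f) n).mkQ (tTensor f n w _) = _
  simp only [tTensor, LinearMap.sum_apply, LinearMap.smul_apply, LinearMap.comp_apply]
  rw [Finset.sum_eq_single T, hx.projType_self, rotate_tprod, rotate_nat, map_smul]
  · rfl
  · intro T' _ h
    rw [hx.projType_of_ne h, map_zero, smul_zero]
  · exact fun h => absurd hT h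

theorem HasType.tN_wd {w c : ℕ} (hT : T ∈ positions n w) (hc : LastM n c x) :
    tN f n w (wd k n x) = (-1 : k) ^ (c * n) • wd k n (rot n c x) := by
  have hc' := hc.le
  have hl := hx.lastM ⟨0, (mem_positions.1 hT).1⟩
  have hl' := hl.le
  have key : c = lastPos T ∨ ∃ i ≤ n, x i = 0 := by
    rcases lt_trichotomy c (lastPos T) with h | h | h
    · exact Or.inr ⟨_, hl', ext hl.mem (hc.tail _ h hl')⟩
    · exact Or.inl h
    · exact Or.inr ⟨_, hc', ext hc.mem (hl.tail _ h hc')⟩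
  rcases key with rfl | ⟨i, hi, h0⟩
  · exact hx.tN_wd_lastPos hT
  · rw [wd_eq_zero_of_apply hi h0, map_zero]
    rcases Nat.lt_or_ge i c with h | h
    · rw [wd_eq_zero_of_apply (i := i + (n + 1) - c) (by omega), smul_zero]
      rw [rot, if_neg (by omega), ← h0]
      congr 1
      omega
    · rw [wd_eq_zero_of_apply (i := i - c) (by omega), smul_zero]
      rw [rot, if_pos (by omega), ← h0]
      congr 1
      omega

end

/-! ### The boundary on typed words -/

theorem concatB_wd (n : ℕ) (x : ℕ → SqZeroExt f) :
    concatB f n (wd k (n + 1) x) =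
      ∑ j ∈ Finset.range (n + 1), (-1 : k) ^ j • wd k n (con (concat f) j x) +
        (-1 : k) ^ (n + 1) • wd k n (cyc (concat f) n x) :=
  hochschildB_mk _ n x

theorem F_wd (n : ℕ) (j : Fin (n + 1)) (x : ℕ → SqZeroExt f) :
    F f n j (wd k (n + 1) x) = (-1 : k) ^ (j : ℕ) • wd k n (con (cocycleE f) j x) :=
  congrArg (fun z : NormChains k (SqZeroExt f) n => (-1 : k) ^ (j : ℕ) • z)
    (contract_mk (cocycleE f) j x)

variable (f) in
/-- The operator `d` on all the normalized chains. -/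
def dN (n : ℕ) : NormChains k (SqZeroExt f) (n + 1) →ₗ[k] NormChains k (SqZeroExt f) n :=
  ∑ j ∈ Finset.univ.filter (fun j : Fin (n + 1) => j ≠ 0), F f n j

/-- The cocycle parts of the faces involving `x_0`, namely the face at `0` and the cyclic one,
vanish because `x_0 ∈ M`. The remaining cocycle parts make up `d`. -/
theorem bN_of_mem_M (n : ℕ) {x : ℕ → SqZeroExt f} (h0 : fstL f (x 0) = 0) :
    bN k (SqZeroExt f) n (wd k (n + 1) x) =
      concatB f n (wd k (n + 1) x) + dN f n (wd k (n + 1) x) := by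
  have hc : wd k n (cyc (cocycleE f) n x) = 0 :=
    wd_eq_zero_of_apply (Nat.zero_le n) (cocycleE_right h0)
  have hd : dN f n (wd k (n + 1) x) =
      ∑ j ∈ Finset.range (n + 1), (-1 : k) ^ j • wd k n (con (cocycleE f) j x) := by
    rw [← Fin.sum_univ_eq_sum_range (fun j => (-1 : k) ^ j • wd k n (con (cocycleE f) j x)), dN,
      LinearMap.sum_apply]
    rw [Finset.sum_filter]
    refine Finset.sum_congr rfl fun j _ => ?_
    rw [F_wd]
    split_ifs with h
    · rfl
    · rw [not_not.1 h, wd_eq_zero_of_apply (Nat.zero_le n) (cocycleE_left h0), smul_zero]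
  rw [bN_wd, concatB_wd, hd, wd_cyc_mul, hc, add_zero, add_right_comm, ← Finset.sum_add_distrib]
  congr 1
  refine Finset.sum_congr rfl fun j hj => ?_
  rw [wd_con_mul (Nat.lt_succ_iff.1 (Finset.mem_range.1 hj)), smul_add]

theorem bN_X {n w : ℕ} {z : NormChains k (SqZeroExt f) (n + 1)} (hz : z ∈ X f (n + 1) w) :
    bN k (SqZeroExt f) n z = concatB f n z + dN f n z :=
  X_ext (h := concatB f n + dN f n)
    (fun _ hT _ hx => bN_of_mem_M n ((hx 0).1 (mem_positions.1 hT).1)) hz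

theorem hasType_con_cocycleE {n w : ℕ} {T : Finset (Fin (n + 2))} {x : ℕ → SqZeroExt f}
    (hT : T ∈ positions (n + 1) w) (hx : HasType T (fun i : Fin (n + 2) => x i)) (j : Fin (n + 1))
    (h1 : j.castSucc ∉ T) (h2 : j.succ ∉ T) :
    ∃ T' ∈ positions n (w + 1), HasType T' (fun i : Fin (n + 1) => con (cocycleE f) j x i) := by
  obtain ⟨h0, hc⟩ := mem_positions.1 hT
  have hj : j ∉ T.image j.predAbove := fun q => ((mem_image_self j T).1 q).elim h1 h2
  refine ⟨insert j (T.image j.predAbove),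
    mem_positions.2 ⟨Finset.mem_insert_of_mem (zero_mem_image j T h0), ?_⟩, ?_⟩
  · rw [Finset.card_insert_of_notMem hj, card_image_predAbove j T (fun q => h1 q.1), hc]
  · rw [← contractFun_eq]
    intro l
    rcases lt_trichotomy l j with hl | hl | hl
    · rw [Finset.mem_insert, mem_image_lt j T hl]
      simpa [contractFun, hl, hl.ne] using hx l.castSucc
    · subst hl
      simp [contractFun, cocycleE]
    · rw [Finset.mem_insert, mem_image_gt j T hl]
      simpa [contractFun, hl.not_gt, hl.ne'] using hx l.succ

theorem tF_wd {n w : ℕ} {T : Finset (Fin (n + 2))} {x : ℕ → SqZeroExt f}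
    (hT : T ∈ positions (n + 1) w) (hx : HasType T (fun i : Fin (n + 2) => x i)) :
    tF f n w (wd k (n + 1) x) = ∑ l ∈ Finset.Ico ((lastPos T : ℕ) + 1) (n + 1),
      (-1 : k) ^ l • (-1 : k) ^ (l * n) • wd k n (rot n l (con (cocycleE f) l x)) := by
  have e : Finset.Ico ((lastPos T : ℕ) + 1) (n + 1) =
      (Finset.range (n + 1)).filter (fun l => (lastPos T : ℕ) < l) := by
    ext l
    simp only [Finset.mem_Ico, Finset.mem_filter, Finset.mem_range]
    omega
  rw [e, Finset.sum_filter, ← Fin.sum_univ_eq_sum_range (fun l => if (lastPos T : ℕ) < l then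
    (-1 : k) ^ l • (-1 : k) ^ (l * n) • wd k n (rot n l (con (cocycleE f) l x)) else 0)]
  simp only [tF, LinearMap.sum_apply, LinearMap.comp_apply]
  rw [Finset.sum_eq_single T, Finset.sum_filter]
  · refine Finset.sum_congr rfl fun j _ => ?_
    by_cases h : lastPos T < j.castSucc
    · have h' : (lastPos T : ℕ) < j := h
      have h1 : j.castSucc ∉ T := fun q => absurd (le_lastPos q) (not_le_of_gt h)
      have h2 : j.succ ∉ T := fun q =>
        absurd (le_lastPos q) (not_le_of_gt (h.trans Fin.castSucc_lt_succ))
      obtain ⟨T', hT', hx'⟩ := hasType_con_cocycleE hT hx j h1 h2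
      rw [if_pos h, if_pos h', hx.projTypeN_self, F_wd, map_smul, hx'.tN_wd hT'
        ((hx.lastM ⟨0, (mem_positions.1 hT).1⟩).con_cocycleE h' (Nat.lt_succ_iff.1 j.isLt))]
    · have h' : ¬ (lastPos T : ℕ) < j := h
      rw [if_neg h, if_neg h']
  · intro T' _ h
    refine Finset.sum_eq_zero fun j _ => ?_
    rw [hx.projTypeN_of_ne h, map_zero, map_zero]
  · exact fun h => absurd hT h

theorem bN_theta_X_zero {w : ℕ} {z : NormChains k (SqZeroExt f) 0} (hz : z ∈ X f 0 w) :
    bN k (SqZeroExt f) 0 (theta f 0 z) = z - tN f 0 w z := by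
  refine X_ext (g := bN k (SqZeroExt f) 0 ∘ₗ theta f 0) (h := LinearMap.id - tN f 0 w)
    (fun T hT x hx => ?_) hz
  have hl := hx.lastM ⟨0, (mem_positions.1 hT).1⟩
  have h0 : (lastPos T : ℕ) = 0 := Nat.le_zero.1 hl.le
  rw [h0] at hl
  rw [LinearMap.comp_apply, hl.theta_wd, bN_cutSum_zero, LinearMap.sub_apply, hx.tN_wd hT hl,
    zero_mul, pow_zero, one_smul, wd_congr fun i hi => rot_zero 0 x hi, LinearMap.id_apply,
    sub_self]

/-- The boundary of `theta` on `X`. -/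
theorem bN_theta_X {n w : ℕ} {z : NormChains k (SqZeroExt f) (n + 1)} (hz : z ∈ X f (n + 1) w) :
    bN k (SqZeroExt f) (n + 1) (theta f (n + 1) z) = z - tN f (n + 1) w z -
      theta f n (concatB f n z) + theta f n (-dN f n z - tF f n w z) := by
  refine X_ext (g := bN k (SqZeroExt f) (n + 1) ∘ₗ theta f (n + 1))
    (h := LinearMap.id - tN f (n + 1) w - theta f n ∘ₗ concatB f n +
      theta f n ∘ₗ (-dN f n - tF f n w)) (fun T hT x hx => ?_) hz
  obtain ⟨hT0, -⟩ := mem_positions.1 hT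
  have h0 : fstL f (x 0) = 0 := (hx 0).1 hT0
  have hl := hx.lastM ⟨0, hT0⟩
  simp only [LinearMap.comp_apply, LinearMap.sub_apply, LinearMap.add_apply, LinearMap.neg_apply,
    LinearMap.id_apply]
  -- The homotopy formula sums from `l = c`, while `tF` starts at `c + 1`; the additional term
  -- contains the cocycle evaluated at `x_c ∈ M`, which is zero.
  have h1 : ∑ l ∈ Finset.Ico (lastPos T : ℕ) (n + 1), (-1 : k) ^ l • (-1 : k) ^ (l * n) •
      theta f n (wd k n (rot n l (con (cocycleE f) l x))) = theta f n (tF f n w (wd k (n + 1) x)) := by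
    rw [tF_wd hT hx, map_sum]
    simp only [map_smul]
    have hc := hl.le
    rcases hc.lt_or_eq with hc | hc
    · rw [Finset.sum_eq_sum_Ico_succ_bot hc, wd_eq_zero_of_apply (x := rot n _ _) (Nat.zero_le n),
        map_zero, smul_zero, smul_zero, zero_add]
      rw [rot_zero_apply (Nat.lt_succ_iff.1 hc), con, if_neg (by omega), if_pos rfl,
        cocycleE_left hl.mem]
    · rw [Finset.Ico_eq_empty (by omega), Finset.Ico_eq_empty (by omega)]
  -- When the last entry is in `M`, the cyclic face multiplies two elements of `M`.
  have h2 : (if (lastPos T : ℕ) = n + 1 then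
      theta f n (wd k n (cyc (LinearMap.mul k (SqZeroExt f)) n x)) else 0) = 0 := by
    split_ifs with e
    · rw [wd_eq_zero_of_apply (Nat.zero_le n), map_zero]
      refine mul_of_fst ?_ h0
      rw [← e]
      exact hl.mem
    · rfl
  rw [hl.homotopy, h1, h2, bN_of_mem_M n h0, hx.tN_wd hT hl, smul_zero, add_zero, map_sub, map_add,
    map_neg]
  abel

/-! ### The norm -/

theorem HasType.rot {n w : ℕ} {T : Finset (Fin (n + 1))} {x : ℕ → SqZeroExt f}
    (hT : T ∈ positions n w) (hx : HasType T (fun i : Fin (n + 1) => x i)) :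
    T.image (· + -lastPos T) ∈ positions n w ∧ HasType (T.image (· + -lastPos T))
      (fun i : Fin (n + 1) => rot n (lastPos T : ℕ) x i) := by
  obtain ⟨h0, hc⟩ := mem_positions.1 hT
  refine ⟨mem_positions.2 ⟨?_, ?_⟩, fun i => ?_⟩
  · rw [mem_image_add, zero_add]
    exact lastPos_mem ⟨0, h0⟩
  · rw [Finset.card_image_of_injective _ (add_left_injective _), hc]
  · rw [mem_image_add, ← rotate_nat]
    exact hx (i + lastPos T)

/-- Each application of `t` brings the current last entry in `M` to the front, so `theta` of the
successive rotations collects the cuts between successive entries in `M`, going backwards. After `m`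
rotations, with `m` entries of `T` behind `a`, exactly the cuts behind `a` have been collected. -/
theorem sum_theta_tN (m : ℕ) : ∀ {n w : ℕ} {T : Finset (Fin (n + 1))} {x : ℕ → SqZeroExt f}
    (_ : T ∈ positions n w) (_ : HasType T (fun i : Fin (n + 1) => x i)) (a : Fin (n + 1))
    (_ : a ∈ T) (_ : (T.filter (a < ·)).card = m),
    ∑ l ∈ Finset.range (m + 1), theta f n ((tN f n w ^ l) (wd k n x)) =
      cutSum k (SqZeroExt f) n a (wd k n x) := by
  induction m with
  | zero =>
    intro n w T x hT hx a ha hm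
    have hl := lastPos_mem ⟨a, ha⟩
    have h : lastPos T = a := by
      refine le_antisymm (not_lt.1 fun h => ?_) (le_lastPos ha)
      rw [Finset.card_eq_zero] at hm
      exact Finset.notMem_empty _ (hm ▸ Finset.mem_filter.2 ⟨hl, h⟩)
    rw [Finset.sum_range_one, pow_zero, Module.End.one_apply, (hx.lastM ⟨a, ha⟩).theta_wd, h]
  | succ m ih =>
    intro n w T x hT hx a ha hm
    have hl := lastPos_mem ⟨a, ha⟩
    have h : a < lastPos T := by
      obtain ⟨i, hi⟩ := Finset.card_pos.1 (hm ▸ Nat.succ_pos m : 0 < (T.filter (a < ·)).card)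
      rw [Finset.mem_filter] at hi
      exact hi.2.trans_le (le_lastPos hi.1)
    obtain ⟨hT', hx'⟩ := hx.rot hT
    have h' : (a : ℕ) < (lastPos T : ℕ) := h
    have hln := (lastPos T).isLt
    have ha' : (a : ℕ) + (n + 1) - (lastPos T : ℕ) < n + 1 := by omega
    -- In the rotated word, `a` sits at `a + (n + 1) - lastPos T`, and the entries in `M` behind it
    -- are the former ones strictly between `a` and `lastPos T`: one fewer than before.
    have key := ih hT' hx' ⟨(a : ℕ) + (n + 1) - (lastPos T : ℕ), ha'⟩ (by
      rw [mem_image_add]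
      convert ha using 1
      ext
      rw [Fin.val_add_eq_ite, if_pos (by dsimp only; omega)]
      dsimp only
      omega) (by
      have e : (T.image (· + -lastPos T)).filter
          ((⟨(a : ℕ) + (n + 1) - (lastPos T : ℕ), ha'⟩ : Fin (n + 1)) < ·) =
          ((T.filter (a < ·)).erase (lastPos T)).image (· + -lastPos T) := by
        ext i
        rw [Finset.mem_filter, mem_image_add, mem_image_add, Finset.mem_erase, Finset.mem_filter]
        constructor
        · rintro ⟨h1, h2⟩
          have h3 : (((i + lastPos T : Fin (n + 1)) : ℕ)) ≤ lastPos T := le_lastPos h1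
          have h4 : (a : ℕ) + (n + 1) - (lastPos T : ℕ) < i := h2
          rw [Fin.val_add_eq_ite] at h3
          refine ⟨fun q => ?_, h1, ?_⟩
          · have := congrArg Fin.val q
            rw [Fin.val_add_eq_ite] at this
            split_ifs at this <;> omega
          · rw [Fin.lt_def, Fin.val_add_eq_ite]
            split_ifs at h3 ⊢ <;> omega
        · rintro ⟨h0, h1, h2⟩
          refine ⟨h1, ?_⟩
          have h3 : (((i + lastPos T : Fin (n + 1)) : ℕ)) ≤ lastPos T := le_lastPos h1
          have h4 : ((i + lastPos T : Fin (n + 1)) : ℕ) ≠ lastPos T := fun q => h0 (Fin.ext q)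
          have hi := i.isLt
          rw [Fin.lt_def] at h2 ⊢
          rw [Fin.val_add_eq_ite] at h2 h3 h4
          dsimp only
          split_ifs at h2 h3 h4 <;> omega
      rw [e, Finset.card_image_of_injective _ (add_left_injective _),
        Finset.card_erase_of_mem (Finset.mem_filter.2 ⟨hl, h⟩), hm]
      rfl)
    have hlM := hx.lastM ⟨a, ha⟩
    rw [Finset.sum_range_succ']
    simp only [pow_succ, Module.End.mul_apply, hx.tN_wd hT hlM, map_smul]
    rw [← Finset.smul_sum, key, cutSum_rot h'.le (Nat.lt_succ_iff.1 hln), pow_zero,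
      Module.End.one_apply, hlM.theta_wd, cutSum_apply n (lastPos T : ℕ), cutSum_apply n (a : ℕ),
      Finset.sum_Ico_consecutive _ (by omega) (by omega)]

/-- This is `sum_theta_tN` at `a = 0`: the `w` other entries in `M` are behind it, and the cuts
behind `0` form the whole of Connes' operator. -/
theorem BN_X {n w : ℕ} {z : NormChains k (SqZeroExt f) n} (hz : z ∈ X f n w) :
    BN k (SqZeroExt f) n z = theta f n (∑ l ∈ Finset.range (w + 1), (tN f n w ^ l) z) := by
  rw [map_sum]
  have := X_ext (g := BN k (SqZeroExt f) n)
    (h := ∑ l ∈ Finset.range (w + 1), theta f n ∘ₗ (tN f n w ^ l)) (fun T hT x hx => ?_) hz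
  · simpa using this
  · obtain ⟨h0, hc⟩ := mem_positions.1 hT
    rw [LinearMap.sum_apply, BN_eq_cutSum]
    refine (sum_theta_tN w hT hx 0 h0 ?_).symm
    have e : T.filter (0 < ·) = T.erase 0 := by
      ext i
      rw [Finset.mem_filter, Finset.mem_erase, Fin.pos_iff_ne_zero, and_comm]
    rw [e, Finset.card_erase_of_mem h0, hc]
    rfl

end SqZeroExt

/-! ### Identities of a double mixed complex from its associated mixed complex -/

namespace DoubleMixedDiagram

variable {k : Type*} [CommRing k] (C : DoubleMixedDiagram k)

/-- The boundary map of the associated mixed complex. -/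
def assocb (n : ℕ) : (∀ w, C.X w (n + 1)) →ₗ[k] (∀ w, C.X w n) := C.assoc.b n

/-- The Connes operator of the associated mixed complex. -/
def assocB (n : ℕ) : (∀ w, C.X w n) →ₗ[k] (∀ w, C.X w (n + 1)) := C.assoc.B n

theorem assoc_b_single (w n : ℕ) (x : C.X w (n + 1)) :
    C.assocb n (Pi.single (M := fun w => C.X w (n + 1)) w x : ∀ w, C.X w (n + 1)) =
      (Pi.single (M := fun w => C.X w n) w (C.δ w n x) +
        Pi.single (M := fun w => C.X w n) (w + 1) (C.del w n x) : ∀ w, C.X w n) := by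
  funext v
  cases v with
  | zero =>
    change C.δ 0 n (Pi.single (M := fun w => C.X w (n + 1)) w x 0) = _
    rw [Pi.add_apply, Pi.single_eq_of_ne (i := w + 1) (by omega), add_zero]
    rcases Nat.eq_zero_or_pos w with rfl | h
    · simp
    · rw [Pi.single_eq_of_ne (by omega), Pi.single_eq_of_ne (by omega), map_zero]
  | succ v =>
    change C.δ (v + 1) n (Pi.single (M := fun w => C.X w (n + 1)) w x (v + 1)) +
      C.del v n (Pi.single (M := fun w => C.X w (n + 1)) w x v) = _
    rw [Pi.add_apply]
    congr 1
    · by_cases h : v + 1 = w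
      · subst h
        simp
      · rw [Pi.single_eq_of_ne h, Pi.single_eq_of_ne h, map_zero]
    · by_cases h : v = w
      · subst h
        simp
      · rw [Pi.single_eq_of_ne h, Pi.single_eq_of_ne (by omega), map_zero]

theorem assoc_B_single (w n : ℕ) (x : C.X w n) :
    C.assocB n (Pi.single (M := fun w => C.X w n) w x : ∀ w, C.X w n) =
      (Pi.single (M := fun w => C.X w (n + 1)) w (C.B w n x) : ∀ w, C.X w (n + 1)) := by
  funext v
  change C.B v n (Pi.single (M := fun w => C.X w n) w x v) = _
  by_cases h : v = w
  · subst h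
    simp
  · rw [Pi.single_eq_of_ne h, Pi.single_eq_of_ne h, map_zero]

/-- A double mixed diagram whose associated diagram is a mixed complex is a double mixed
complex. -/
theorem isDoubleMixedComplex_of_assoc (h : C.assoc.IsMixed) : C.IsDoubleMixedComplex := by
  -- On a chain concentrated in weight `w`, the square of `δ + ∂` has components `δ²`, `δ∂ + ∂δ` and
  -- `∂²` in the distinct weights `w`, `w + 1` and `w + 2`.
  have hbb : ∀ w n x, (Pi.single (M := fun w => C.X w n) w (C.δ w n (C.δ w (n + 1) x)) +
      Pi.single (M := fun w => C.X w n) (w + 1) (C.del w n (C.δ w (n + 1) x)) +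
      (Pi.single (M := fun w => C.X w n) (w + 1) (C.δ (w + 1) n (C.del w (n + 1) x)) +
      Pi.single (M := fun w => C.X w n) (w + 1 + 1) (C.del (w + 1) n (C.del w (n + 1) x))) :
      ∀ w, C.X w n) = 0 := by
    intro w n x
    rw [← assoc_b_single, ← assoc_b_single, ← map_add, ← assoc_b_single]
    exact h.b_b n _
  have hbB0 : ∀ w x, (Pi.single (M := fun w => C.X w 0) w (C.δ w 0 (C.B w 0 x)) +
      Pi.single (M := fun w => C.X w 0) (w + 1) (C.del w 0 (C.B w 0 x)) : ∀ w, C.X w 0) = 0 := by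
    intro w x
    rw [← assoc_b_single, ← assoc_B_single]
    exact h.b_B_zero _
  have hbB : ∀ w n x, (Pi.single (M := fun w => C.X w (n + 1)) w
        (C.δ w (n + 1) (C.B w (n + 1) x)) +
      Pi.single (M := fun w => C.X w (n + 1)) (w + 1) (C.del w (n + 1) (C.B w (n + 1) x)) +
      (Pi.single (M := fun w => C.X w (n + 1)) w (C.B w n (C.δ w n x)) +
      Pi.single (M := fun w => C.X w (n + 1)) (w + 1) (C.B (w + 1) n (C.del w n x))) :
      ∀ w, C.X w (n + 1)) = 0 := by
    intro w n x
    rw [← assoc_b_single, ← assoc_B_single, ← assoc_B_single, ← assoc_B_single, ← map_add,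
      ← assoc_b_single]
    exact h.b_B n _
  constructor
  · intro w n
    ext1 x
    have := congrFun (hbb w n x) w
    rw [Pi.add_apply, Pi.add_apply, Pi.add_apply, Pi.single_eq_same,
      Pi.single_eq_of_ne (by omega), Pi.single_eq_of_ne (by omega),
      Pi.single_eq_of_ne (by omega), add_zero, add_zero, add_zero] at this
    exact this
  · intro w n
    ext1 x
    have := congrFun (hbb w n x) (w + 1 + 1)
    rw [Pi.add_apply, Pi.add_apply, Pi.add_apply, Pi.single_eq_of_ne (by omega),
      Pi.single_eq_of_ne (by omega), Pi.single_eq_of_ne (by omega), Pi.single_eq_same,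
      zero_add, zero_add, zero_add] at this
    exact this
  · intro w n
    ext1 x
    have h1 : C.assocB (n + 1) (C.assocB n (Pi.single (M := fun w => C.X w n) w x)) = 0 :=
      h.B_B n _
    rw [assoc_B_single, assoc_B_single] at h1
    simpa using congrFun h1 w
  · intro w n
    ext1 x
    have := congrFun (hbb w n x) (w + 1)
    simpa [add_comm] using this
  · intro w
    ext1 x
    have := congrFun (hbB0 w x) w
    simpa using this
  · intro w n
    ext1 x
    have := congrFun (hbB w n x) w
    simpa using this
  · intro w
    ext1 x
    have := congrFun (hbB0 w x) (w + 1)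
    simpa using this
  · intro w n
    ext1 x
    have := congrFun (hbB w n x) (w + 1)
    simpa using this

end DoubleMixedDiagram

namespace SqZeroExt

variable {k A M : Type*} [CommRing k] [Ring A] [Algebra k A] [AddCommGroup M]
  [Module k M] [Module A M] [Module Aᵐᵒᵖ M] [SMulCommClass A Aᵐᵒᵖ M]
  [IsScalarTower k A M] [IsScalarTower k Aᵐᵒᵖ M] {f : NormalCocycle k A M}

/-! ### The comparison map -/

/-- There is no set of `w + 1` positions among `n + 1`. Thus the product over all weights is finite
in each degree, and the comparison map can be a finite sum. -/
theorem X_eq_zero {n w : ℕ} (h : n < w) {z : NormChains k (SqZeroExt f) n} (hz : z ∈ X f n w) :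
    z = 0 := by
  refine X_ext (g := LinearMap.id) (h := 0) (fun T hT x hx => ?_) hz
  have := (mem_positions.1 hT).2
  have := Finset.card_le_univ T
  rw [Fintype.card_fin] at this
  omega

theorem XPred_eq_zero {n w : ℕ} (h : n < w + 1) {z : NormChains k (SqZeroExt f) (n - 1)}
    (hz : z ∈ XPred f n w) : z = 0 := by
  cases n with
  | zero => exact hz
  | succ n => exact X_eq_zero (by omega) hz

variable (f) in
/-- The map `theta`, with source in degree `n - 1` (zero if `n = 0`). -/
def thetaPred : ∀ n : ℕ, NormChains k (SqZeroExt f) (n - 1) →ₗ[k] NormChains k (SqZeroExt f) n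
  | 0 => 0
  | n + 1 => theta f n

variable (f) in
/-- The comparison map `(x, y) ↦ x + theta y` on the weight `w` part. -/
def psi (n w : ℕ) : (X f n w × XPred f n w) →ₗ[k] NormChains k (SqZeroExt f) n :=
  (X f n w).subtype ∘ₗ LinearMap.fst k _ _ +
    thetaPred f n ∘ₗ (XPred f n w).subtype ∘ₗ LinearMap.snd k _ _

theorem psi_apply (n w : ℕ) (p : X f n w × XPred f n w) :
    psi f n w p = p.1 + thetaPred f n p.2 := rfl

theorem psi_eq_zero {n w : ℕ} (h : n < w) (p : X f n w × XPred f n w) : psi f n w p = 0 := by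
  rw [psi_apply, X_eq_zero h p.1.2, XPred_eq_zero (by omega) p.2.2, map_zero, add_zero]

variable (f) in
/-- The comparison map. -/
def phi (n : ℕ) : (∀ w, X f n w × XPred f n w) →ₗ[k] NormChains k (SqZeroExt f) n :=
  ∑ w ∈ Finset.range (n + 1), psi f n w ∘ₗ LinearMap.proj w

theorem phi_apply (n : ℕ) (p : ∀ w, X f n w × XPred f n w) :
    phi f n p = ∑ w ∈ Finset.range (n + 1), psi f n w (p w) := by
  simp [phi]

theorem phi_apply' (n : ℕ) (p : ∀ w, X f n w × XPred f n w) :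
    phi f n p = ∑ w ∈ Finset.range (n + 1), ((p w).1 : NormChains k (SqZeroExt f) n) +
      thetaPred f n (∑ w ∈ Finset.range (n + 1), ((p w).2 : NormChains k (SqZeroExt f) (n - 1))) := by
  rw [phi_apply, map_sum, ← Finset.sum_add_distrib]
  rfl

theorem coe_d {n w : ℕ} (z : X f (n + 1) w) :
    (d f n w z : NormChains k (SqZeroExt f) n) = dN f n z := by
  rw [d, dN, LinearMap.sum_apply, LinearMap.sum_apply, Submodule.coe_sum]
  rfl

theorem coe_N {n w : ℕ} (z : X f n w) : (N f n w z : NormChains k (SqZeroExt f) n) =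
    ∑ l ∈ Finset.range (w + 1), (tN f n w ^ l) z := by
  rw [N, LinearMap.sum_apply, Submodule.coe_sum]
  have h : ∀ l, ((t f n w ^ l) z : NormChains k (SqZeroExt f) n) = (tN f n w ^ l) z := ?_
  · exact Finset.sum_congr rfl fun l _ => h l
  intro l
  induction l with
  | zero => rfl
  | succ l ih =>
    rw [pow_succ', pow_succ', Module.End.mul_apply, Module.End.mul_apply, ← ih]
    rfl

variable (f) in
/-- The map `b̂`. -/
def hatb (n w : ℕ) : (X f (n + 1) w × XPred f (n + 1) w) →ₗ[k] (X f n w × XPred f n w) :=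
  (hatX f).δ w n

variable (f) in
/-- The map `d̂`. -/
def hatd (n w : ℕ) :
    (X f (n + 1) w × XPred f (n + 1) w) →ₗ[k] (X f n (w + 1) × XPred f n (w + 1)) :=
  (hatX f).del w n

variable (f) in
/-- The map `B̂`. -/
def hatB (n w : ℕ) : (X f n w × XPred f n w) →ₗ[k] (X f (n + 1) w × XPred f (n + 1) w) :=
  (hatX f).B w n

/-- In `bN_theta_X`, the term outside `θ` is `id - t`, which goes to the first summand of `X̂`; the
terms under `θ` are `-b` and `d'`, which act on the second one. -/
theorem bN_psi (n w : ℕ) (p : X f (n + 1) w × XPred f (n + 1) w) :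
    bN k (SqZeroExt f) n (psi f (n + 1) w p) =
      psi f n w (hatb f n w p) + psi f n (w + 1) (hatd f n w p) := by
  obtain ⟨⟨x, hx⟩, ⟨(y : NormChains k (SqZeroExt f) n), (hy : y ∈ X f n w)⟩⟩ := p
  change bN k (SqZeroExt f) n (x + theta f n y) = (concatB f n x + (y - tN f n w y)) +
    thetaPred f n (negB f n w ⟨y, hy⟩) + ((d f n w ⟨x, hx⟩ : NormChains k (SqZeroExt f) n) +
    thetaPred f n (dPrime f n w ⟨y, hy⟩))
  rw [map_add, bN_X hx, coe_d]
  cases n with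
  | zero =>
    -- Here `y` has degree `0`, so `-b` and `d'` of it are zero by definition.
    rw [bN_theta_X_zero hy]
    change _ = _ + 0 + (_ + 0)
    abel
  | succ n =>
    have h1 : thetaPred f (n + 1) (negB f (n + 1) w ⟨y, hy⟩) = -theta f n (concatB f n y) :=
      map_neg (theta f n) (concatB f n y)
    have h2 : thetaPred f (n + 1) (dPrime f (n + 1) w ⟨y, hy⟩) =
        theta f n (-dN f n y - tF f n w y) := by
      rw [← coe_d ⟨y, hy⟩]
      rfl
    rw [bN_theta_X hy, h1, h2]
    abel

theorem BN_psi (n w : ℕ) (p : X f n w × XPred f n w) :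
    BN k (SqZeroExt f) n (psi f n w p) = psi f (n + 1) w (hatB f n w p) := by
  obtain ⟨⟨x, hx⟩, ⟨y, hy⟩⟩ := p
  change BN k (SqZeroExt f) n (x + thetaPred f n y) = 0 + theta f n (N f n w ⟨x, hx⟩)
  have h : BN k (SqZeroExt f) n (thetaPred f n y) = 0 := by
    cases n with
    | zero => exact map_zero _
    | succ n => exact BN_theta n y
  rw [map_add, h, add_zero, zero_add, coe_N, BN_X hx]

/-- Only the ends of the sums over weights need care: `psi f n w` is zero for `w > n`, so the
superfluous weights drop out before the terms are matched. -/
theorem bN_phi (n : ℕ) (p : ∀ w, X f (n + 1) w × XPred f (n + 1) w) :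
    bN k (SqZeroExt f) n (phi f (n + 1) p) = phi f n ((hatX f).assocb n p) := by
  refine Eq.trans ?_ (phi_apply n ((hatX f).assocb n p)).symm
  rw [phi_apply, map_sum, Finset.sum_congr rfl fun w _ => bN_psi n w (p w),
    Finset.sum_add_distrib, Finset.sum_range_succ _ (n + 1), psi_eq_zero (Nat.lt_succ_self n) (hatb f n _ _),
    add_zero, Finset.sum_range_succ _ (n + 1), psi_eq_zero (n := n) (w := n + 1 + 1) (by omega),
    add_zero, Finset.sum_range_succ (fun w => psi f n (w + 1) _) n,
    psi_eq_zero (n := n) (Nat.lt_succ_self n), add_zero,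
    Finset.sum_range_succ', Finset.sum_range_succ', add_right_comm, ← Finset.sum_add_distrib]
  refine congrArg₂ _ (Finset.sum_congr rfl fun w _ => ?_) rfl
  exact (map_add (psi f n (w + 1)) _ _).symm

theorem BN_phi (n : ℕ) (p : ∀ w, X f n w × XPred f n w) :
    BN k (SqZeroExt f) n (phi f n p) = phi f (n + 1) ((hatX f).assocB n p) := by
  refine Eq.trans ?_ (phi_apply (n + 1) ((hatX f).assocB n p)).symm
  rw [phi_apply, map_sum, Finset.sum_congr rfl fun w _ => BN_psi n w (p w),
    Finset.sum_range_succ _ (n + 1)]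
  have h : psi f (n + 1) (n + 1) (hatB f n (n + 1) (p (n + 1))) = 0 := by
    rw [← BN_psi, psi_eq_zero (Nat.lt_succ_self n), map_zero]
  exact (add_zero _).symm.trans (congrArg _ h.symm)

end SqZeroExt

namespace SqZeroExt

section CommRing

variable {k A M : Type*} [CommRing k] [Ring A] [Algebra k A] [AddCommGroup M]
  [Module k M] [Module A M] [Module Aᵐᵒᵖ M] [SMulCommClass A Aᵐᵒᵖ M]
  [IsScalarTower k A M] [IsScalarTower k Aᵐᵒᵖ M] {f : NormalCocycle k A M}

/-! ### The relative chains -/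

variable (f) in
/-- The map induced by `E → A` on normalized chains. -/
def gN (n : ℕ) : NormChains k (SqZeroExt f) n →ₗ[k] NormChains k A n :=
  (hochschildMixedMap (proj f)).f n

theorem gN_wd (n : ℕ) (x : ℕ → SqZeroExt f) :
    gN f n (wd k n x) = wd k n (fun i => fstL f (x i)) :=
  congrArg (degenerate k (1 : A) n).mkQ (tensorMap_tprod (proj f) _)

theorem LastM.gN_wd {n c : ℕ} {x : ℕ → SqZeroExt f} (h : LastM n c x) : gN f n (wd k n x) = 0 := by
  rw [SqZeroExt.gN_wd, wd_eq_zero_of_apply h.le h.mem]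

/-- Every cut behind `c` keeps `x_c`, at position `c + (n + 1) - i + 1`, and its image in `A` is
zero. -/
theorem LastM.gN_theta {n c : ℕ} {x : ℕ → SqZeroExt f} (h : LastM n c x) :
    gN f (n + 1) (theta f n (wd k n x)) = 0 := by
  rw [h.theta_wd, cutSum_apply, map_sum]
  refine Finset.sum_eq_zero fun i hi => ?_
  rw [Finset.mem_Ico] at hi
  rw [map_smul, cutL_wd (by omega), SqZeroExt.gN_wd,
    wd_eq_zero_of_apply (i := c + (n + 1) - i + 1) (by omega), smul_zero]
  rw [pre, if_neg (by omega), rot, if_neg (by omega), ← h.mem]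
  congr 2
  omega

theorem X_le_ker_gN (n w : ℕ) : X f n w ≤ LinearMap.ker (gN f n) := fun _ hz =>
  X_ext (g := gN f n) (h := 0) (fun _ hT _ hx => (hx.lastM ⟨0, (mem_positions.1 hT).1⟩).gN_wd) hz

theorem gN_theta_X {n w : ℕ} {z : NormChains k (SqZeroExt f) n} (hz : z ∈ X f n w) :
    gN f (n + 1) (theta f n z) = 0 :=
  X_ext (g := gN f (n + 1) ∘ₗ theta f n) (h := 0)
    (fun _ hT _ hx => (hx.lastM ⟨0, (mem_positions.1 hT).1⟩).gN_theta) hz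

theorem gN_psi (n w : ℕ) (p : X f n w × XPred f n w) : gN f n (psi f n w p) = 0 := by
  rw [psi_apply, map_add, X_le_ker_gN n w p.1.2, zero_add]
  cases n with
  | zero => exact map_zero _
  | succ n => exact gN_theta_X p.2.2

theorem gN_phi (n : ℕ) (p : ∀ w, X f n w × XPred f n w) : gN f n (phi f n p) = 0 := by
  rw [phi_apply, map_sum]
  exact Finset.sum_eq_zero fun w _ => gN_psi n w (p w)

variable (f) in
/-- The span of the words with an entry in `M` followed by entries in `A`. -/
def lastSpan (n : ℕ) : Submodule k (NormChains k (SqZeroExt f) n) :=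
  Submodule.span k {z | ∃ c x, LastM n c x ∧ wd k n x = z}

/-- Replacing the entries from `c` on by their components in `A`. -/
theorem wd_sub_mem_lastSpan (n : ℕ) (x : ℕ → SqZeroExt f) :
    wd k n x - wd k n (fun i => projA f (x i)) ∈ lastSpan f n := by
  have key : ∀ c ≤ n + 1, wd k n (fun i => if i < c then x i else projA f (x i)) -
      wd k n (fun i => projA f (x i)) ∈ lastSpan f n := by
    intro c
    induction c with
    | zero =>
      intro _
      simp
    | succ c ih =>
      intro hc
      have h1 : wd k n (fun i => if i < c + 1 then x i else projA f (x i)) =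
          wd k n (fun i => if i < c then x i else if i = c then projM f (x c) else projA f (x i)) +
          wd k n (fun i => if i < c then x i else projA f (x i)) := by
        refine wd_add (i := c) (by omega) ?_ ?_ ?_
        · rw [if_pos (by omega), if_neg (by omega), if_pos rfl, if_neg (by omega)]
          ext <;> simp [projA, projM]
        · intro j _ hj
          split_ifs <;> first | rfl | omega
        · intro j _ hj
          split_ifs <;> first | rfl | omega
      rw [h1, add_sub_assoc]
      refine Submodule.add_mem _ (Submodule.subset_span ⟨c, _, ⟨by omega, ?_, ?_⟩, rfl⟩)
        (ih (by omega))
      · rw [if_neg (by omega), if_pos rfl]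
        rfl
      · intro j h2 _
        rw [if_neg (by omega), if_neg (by omega)]
        rfl
  have := key (n + 1) le_rfl
  rwa [wd_congr (y := x) fun i hi => if_pos (by omega)] at this

/-- The map induced by the inclusion of `A` in `E` on normalized chains. -/
theorem exists_inA (n : ℕ) : ∃ ι : NormChains k A n →ₗ[k] NormChains k (SqZeroExt f) n,
    ∀ x, ι (wd k n x) = wd k n (fun i => inA f (x i)) := by
  refine ⟨Submodule.mapQ _ _ (PiTensorProduct.map fun _ => inA f) (degenerate_le fun x i hi hx => ?_),
    fun x => ?_⟩
  · rw [Submodule.mem_comap, PiTensorProduct.map_tprod]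
    refine tprod_mem_degenerate 1 _ i hi ?_
    rw [hx]
    rfl
  · exact congrArg (degenerate k (1 : SqZeroExt f) n).mkQ (PiTensorProduct.map_tprod _ _)

/-- The inclusion of `A` is linear and preserves the unit, which suffices for a linear section `ι`
on normalized chains. A chain differs from `ι` of its image by words with an entry in `M`. -/
theorem ker_gN_le (n : ℕ) : LinearMap.ker (gN f n) ≤ lastSpan f n := by
  intro z hz
  obtain ⟨ι, hι⟩ := exists_inA (f := f) n
  have h : ∀ z, z - ι (gN f n z) ∈ lastSpan f n := by
    intro z
    have hz : z ∈ Submodule.span k (Set.range (wd k n : (ℕ → SqZeroExt f) → _)) := by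
      rw [span_wd]
      exact Submodule.mem_top
    refine (Submodule.span_le (p := (lastSpan f n).comap
      (LinearMap.id - ι ∘ₗ gN f n))).2 ?_ hz
    rintro _ ⟨x, rfl⟩
    change wd k n x - ι (gN f n (wd k n x)) ∈ lastSpan f n
    rw [gN_wd, hι]
    exact wd_sub_mem_lastSpan n x
  have := h z
  rwa [LinearMap.mem_ker.1 hz, map_zero, sub_zero] at this

/-! ### The image of the comparison map -/

variable (f) in
/-- The span of the words with first entry in `M`. -/
def firstSpan (n : ℕ) : Submodule k (NormChains k (SqZeroExt f) n) :=
  Submodule.span k {z | ∃ x : ℕ → SqZeroExt f, fstL f (x 0) = 0 ∧ wd k n x = z}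

theorem X_le_firstSpan (n w : ℕ) : X f n w ≤ firstSpan f n := by
  refine Submodule.span_le.2 ?_
  rintro _ ⟨T, hT, x, hx, rfl⟩
  obtain ⟨y, rfl⟩ := exists_nat_extension x
  exact Submodule.subset_span ⟨y, (hx 0).1 (mem_positions.1 hT).1, rfl⟩

variable (f) in
/-- The sum of the elements of the `X f n w`. -/
def sumX (n : ℕ) : (∀ w, X f n w) →ₗ[k] NormChains k (SqZeroExt f) n :=
  ∑ w ∈ Finset.range (n + 1), (X f n w).subtype ∘ₗ LinearMap.proj w

theorem sumX_apply (n : ℕ) (p : ∀ w, X f n w) :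
    sumX f n p = ∑ w ∈ Finset.range (n + 1), (p w : NormChains k (SqZeroExt f) n) := by
  simp [sumX]

theorem X_le_range_sumX {n w : ℕ} (hw : w ≤ n) : X f n w ≤ LinearMap.range (sumX f n) := by
  intro z hz
  refine ⟨Pi.single w ⟨z, hz⟩, ?_⟩
  rw [sumX_apply, Finset.sum_eq_single w, Pi.single_eq_same]
  · intro v _ hv
    rw [Pi.single_eq_of_ne hv]
    rfl
  · exact fun h => absurd (Finset.mem_range.2 (Nat.lt_succ_of_le hw)) h

/-- Expanding every entry into its components in `M` and `A` gives typed words; those with an entry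
from `A` at position `0` vanish because `x_0 ∈ M`. -/
theorem firstSpan_le_range_sumX (n : ℕ) : firstSpan f n ≤ LinearMap.range (sumX f n) := by
  refine Submodule.span_le.2 ?_
  rintro _ ⟨x, h0, rfl⟩
  have e : (fun i : Fin (n + 1) => x i) =
      (fun i : Fin (n + 1) => projM f (x i)) + fun i : Fin (n + 1) => projA f (x i) := by
    funext i
    ext <;> simp [projA, projM]
  unfold wd
  rw [e, MultilinearMap.map_add_univ, ← Submodule.mkQ_apply, map_sum]
  refine Submodule.sum_mem _ fun T _ => ?_
  by_cases hT : 0 ∈ T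
  · have hc : T.card ≤ n + 1 := (Finset.card_le_univ T).trans_eq (Fintype.card_fin _)
    have hc' : 1 ≤ T.card := Finset.card_pos.2 ⟨0, hT⟩
    refine X_le_range_sumX (w := T.card - 1) (by omega) (Submodule.subset_span
      ⟨T, mem_positions.2 ⟨hT, by omega⟩, _, fun i => ⟨fun hi => ?_, fun hi => ?_⟩, rfl⟩)
    · rw [Finset.piecewise_eq_of_mem _ _ _ hi]
      rfl
    · rw [Finset.piecewise_eq_of_notMem _ _ _ hi]
      rfl
  · rw [MultilinearMap.map_coord_zero _ 0, map_zero]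
    · exact Submodule.zero_mem _
    · rw [Finset.piecewise_eq_of_notMem _ _ _ hT]
      exact projA_of_fst h0

variable (f) in
/-- The image of the comparison map in degree `n + 1`. -/
def image (n : ℕ) : Submodule k (NormChains k (SqZeroExt f) (n + 1)) :=
  firstSpan f (n + 1) ⊔ (firstSpan f n).map (theta f n)

theorem image_le (n : ℕ) : image f n ≤ LinearMap.range (phi f (n + 1)) := by
  refine sup_le ?_ ?_
  · intro z hz
    obtain ⟨p, rfl⟩ := firstSpan_le_range_sumX _ hz
    refine ⟨fun w => (p w, 0), ?_⟩
    rw [phi_apply', sumX_apply]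
    simp
  · rintro _ ⟨z, hz, rfl⟩
    obtain ⟨p, rfl⟩ := firstSpan_le_range_sumX _ hz
    refine ⟨fun w => (0, (p w : X f n w)), ?_⟩
    rw [phi_apply', sumX_apply]
    simp only [ZeroMemClass.coe_zero, Finset.sum_const_zero, zero_add]
    change theta f n (∑ w ∈ Finset.range (n + 1 + 1), (p w : NormChains k (SqZeroExt f) n)) = _
    rw [Finset.sum_range_succ, X_eq_zero (Nat.lt_succ_self n) (p (n + 1)).2, add_zero]

/-- The error terms in the homotopy formula are a rotation starting with `x_c`, the values of
`theta` on words starting with a value of the cocycle, and possibly `theta` of a word starting with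
`x_{n+1} x_0`, where `x_{n+1} ∈ M`. All of them lie in the image. -/
theorem LastM.homotopy_mem {n c : ℕ} {x : ℕ → SqZeroExt f} (h : LastM (n + 1) c x) :
    bN k (SqZeroExt f) (n + 1) (theta f (n + 1) (wd k (n + 1) x)) +
      theta f n (bN k (SqZeroExt f) n (wd k (n + 1) x)) - wd k (n + 1) x ∈ image f n := by
  have hc := h.le
  have e : ∀ a b c d e : NormChains k (SqZeroExt f) (n + 1),
      a - b - c - d + e + c - a = -b - d + e := by
    intros
    abel
  rw [h.homotopy, e]
  refine Submodule.add_mem _ (Submodule.sub_mem _ (Submodule.neg_mem _ (Submodule.smul_mem _ _ ?_))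
    (Submodule.sum_mem _ fun l hl => Submodule.smul_mem _ _ (Submodule.smul_mem _ _ ?_)))
    (Submodule.smul_mem _ _ ?_)
  · refine le_sup_left (a := firstSpan f (n + 1)) (Submodule.subset_span ⟨_, ?_, rfl⟩)
    rw [rot_zero_apply hc]
    exact h.mem
  · rw [Finset.mem_Ico] at hl
    refine le_sup_right (a := firstSpan f (n + 1)) ⟨_, Submodule.subset_span ⟨_, ?_, rfl⟩, rfl⟩
    rw [rot_zero_apply (by omega), con, if_neg (by omega), if_pos rfl]
    exact fstL_cocycleE _ _
  · split_ifs with hcn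
    · refine le_sup_right (a := firstSpan f (n + 1)) ⟨_, Submodule.subset_span ⟨_, ?_, rfl⟩, rfl⟩
      rw [cyc, if_pos rfl]
      refine fstL_mul_of_left ?_
      rw [← hcn]
      exact h.mem
    · exact Submodule.zero_mem _

theorem homotopy_mem {n : ℕ} {z : NormChains k (SqZeroExt f) (n + 1)} (hz : z ∈ lastSpan f (n + 1)) :
    bN k (SqZeroExt f) (n + 1) (theta f (n + 1) z) +
      theta f n (bN k (SqZeroExt f) n z) - z ∈ image f n := by
  refine (Submodule.span_le (p := (image f n).comap (bN k (SqZeroExt f) (n + 1) ∘ₗ theta f (n + 1) +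
    theta f n ∘ₗ bN k (SqZeroExt f) n - LinearMap.id))).2 ?_ hz
  rintro _ ⟨c, x, hx, rfl⟩
  exact hx.homotopy_mem

theorem theta_lastSpan {n : ℕ} {z : NormChains k (SqZeroExt f) n} (hz : z ∈ lastSpan f n) :
    gN f (n + 1) (theta f n z) = 0 := by
  refine (Submodule.span_le (p := LinearMap.ker (gN f (n + 1) ∘ₗ theta f n))).2 ?_ hz
  rintro _ ⟨c, x, hx, rfl⟩
  exact hx.gN_theta

/-- Since `θθ = 0`, one has `θ(x + θ(y)) = θ(x)`. So `theta` preserves the image and acts on the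
cokernel. -/
theorem theta_phi_mem (n : ℕ) (p : ∀ w, X f n w × XPred f n w) :
    theta f n (phi f n p) ∈ image f n := by
  rw [phi_apply, map_sum]
  refine Submodule.sum_mem _ fun w _ => ?_
  rw [psi_apply, map_add]
  have h : theta f n (thetaPred f n (p w).2) = 0 := by
    cases n with
    | zero => exact map_zero _
    | succ n => exact theta_theta n _
  rw [h, add_zero]
  exact le_sup_right (a := firstSpan f (n + 1)) ⟨_, X_le_firstSpan n w (p w).1.2, rfl⟩

variable (f) in
/-- The comparison morphism of mixed complexes. -/
def comparison : (hatX f).assoc.Hom (relativeMixed (proj f)) where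
  f n := LinearMap.codRestrict (LinearMap.ker (gN f n)) (phi f n) (gN_phi n)
  comm_b n := LinearMap.ext fun p => Subtype.ext (bN_phi n p).symm
  comm_B n := LinearMap.ext fun p => Subtype.ext (BN_phi n p).symm

variable (f) in
theorem comparison_cokerAcyclic : (comparison f).CokerAcyclic := by
  constructor
  · rintro ⟨(d : NormChains k (SqZeroExt f) 0), hd⟩
    -- In degree `0` every relative chain comes from `M`, so it is already in the image.
    refine ⟨0, ?_⟩
    have h : lastSpan f 0 ≤ firstSpan f 0 := by
      refine Submodule.span_le.2 ?_
      rintro _ ⟨c, x, hx, rfl⟩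
      refine Submodule.subset_span ⟨x, ?_, rfl⟩
      rw [← Nat.le_zero.1 hx.le]
      exact hx.mem
    obtain ⟨p, hp⟩ := firstSpan_le_range_sumX 0 (h (ker_gN_le 0 hd))
    refine ⟨fun w => (p w, 0), Subtype.ext ?_⟩
    change phi f 0 _ = d - bN k (SqZeroExt f) 0 0
    rw [map_zero, sub_zero, ← hp, phi_apply', sumX_apply]
    simp
  · rintro n ⟨(d : NormChains k (SqZeroExt f) (n + 1)), hd⟩ ⟨p, hp⟩
    replace hp : phi f n p = bN k (SqZeroExt f) n d := congrArg Subtype.val hp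
    have hd' := ker_gN_le _ hd
    refine ⟨⟨theta f (n + 1) d, theta_lastSpan hd'⟩, ?_⟩
    have h1 := homotopy_mem hd'
    have h2 := theta_phi_mem n p
    rw [hp] at h2
    -- The identity used is `d - bθd = θbd - (bθd + θbd - d)`, with both terms on the right in the
    -- image.
    have h3 := Submodule.sub_mem _ h2 h1
    obtain ⟨q, hq⟩ := image_le n h3
    refine ⟨q, Subtype.ext ?_⟩
    change phi f (n + 1) q = d - bN k (SqZeroExt f) (n + 1) (theta f (n + 1) d)
    rw [hq]
    abel

/-! ### Injectivity of the comparison map -/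

variable (f) in
/-- The projector onto the tensors with `x_0 ∈ M` and `w` further entries in `M`. -/
def projX (n w : ℕ) : NormChains k (SqZeroExt f) n →ₗ[k] NormChains k (SqZeroExt f) n :=
  ∑ T ∈ positions n w, projTypeN f T

theorem projX_self {n w : ℕ} {z : NormChains k (SqZeroExt f) n} (hz : z ∈ X f n w) :
    projX f n w z = z := by
  refine X_ext (h := LinearMap.id) (fun T hT x hx => ?_) hz
  rw [projX, LinearMap.sum_apply, Finset.sum_eq_single T, hx.projTypeN_self]
  · rfl
  · exact fun T' _ h => hx.projTypeN_of_ne h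
  · exact fun h => absurd hT h

theorem projX_of_ne {n w w' : ℕ} (h : w ≠ w') {z : NormChains k (SqZeroExt f) n}
    (hz : z ∈ X f n w') : projX f n w z = 0 := by
  refine X_ext (h := 0) (fun T hT x hx => ?_) hz
  rw [projX, LinearMap.sum_apply]
  refine Finset.sum_eq_zero fun T' hT' => hx.projTypeN_of_ne ?_
  rintro rfl
  have h1 := (mem_positions.1 hT).2
  have h2 := (mem_positions.1 hT').2
  omega

/-- The projectors `projX` separate the weights. -/
theorem eq_zero_of_sum_eq_zero {n N : ℕ} (z : ℕ → NormChains k (SqZeroExt f) n)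
    (hz : ∀ w, z w ∈ X f n w) (h : ∑ w ∈ Finset.range N, z w = 0) (hN : n < N) (w : ℕ) :
    z w = 0 := by
  rcases Nat.lt_or_ge w N with hw | hw
  · have h1 := congrArg (projX f n w) h
    rwa [map_sum, map_zero, Finset.sum_eq_single w (fun v _ hv => projX_of_ne hv.symm (hz v))
      (fun h => absurd (Finset.mem_range.2 hw) h), projX_self (hz w)] at h1
  · exact X_eq_zero (by omega) (hz w)

/-- A retraction of `y ↦ 1 ⊗ y`. -/
theorem exists_retraction {ε : A →ₗ[k] k} (hε : ε 1 = 1) (n : ℕ) :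
    ∃ r : NormChains k (SqZeroExt f) (n + 1) →ₗ[k] NormChains k (SqZeroExt f) n,
      (∀ w, ∀ z ∈ X f (n + 1) w, r z = 0) ∧ ∀ w, ∀ z ∈ X f n w, r (theta f n z) = z := by
  -- Contracting the first two entries by `β` applies `ε` to the `A`-component of the first and
  -- keeps the `M`-component of the second. This kills words starting in `M`, and it respects
  -- degenerate chains since the `M`-component of `1` is zero.
  let β : SqZeroExt f →ₗ[k] SqZeroExt f →ₗ[k] SqZeroExt f :=
    (LinearMap.lsmul k (SqZeroExt f)).compl₁₂ (ε ∘ₗ fstL f) (projM f)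
  have hβ : ∀ u v, β u v = ε (fstL f u) • projM f v := fun _ _ => rfl
  have hβ0 : ∀ u, ∀ {v}, sndL f v = 0 → β u v = 0 := fun u v hv => by
    rw [hβ, projM_of_snd hv, smul_zero]
  let r : NormChains k (SqZeroExt f) (n + 1) →ₗ[k] NormChains k (SqZeroExt f) n :=
    Submodule.mapQ _ _ (contract β 0) (degenerate_le fun x i hi hx => by
      rw [Submodule.mem_comap, contract_tprod]
      by_cases h : i = 1
      · subst h
        rw [MultilinearMap.map_coord_zero _ 0]
        · exact Submodule.zero_mem _
        · simp only [contractFun, lt_irrefl, if_false, if_true]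
          refine hβ0 _ ?_
          rw [Fin.succ_zero_eq_one, hx]
          rfl
      · exact contract_mem_degenerate β 1 0 x i hi hx (by simpa using hi) (by simpa using h))
  have hr : ∀ x, r (wd k (n + 1) x) = wd k n (con β 0 x) := fun x => contract_mk β 0 x
  refine ⟨r, fun w z hz => ?_, fun w z hz => ?_⟩
  · refine X_ext (g := r) (h := 0) (fun T hT x hx => ?_) hz
    rw [hr, wd_eq_zero_of_apply (Nat.zero_le n)]
    · rfl
    · have h0 : fstL f (x 0) = 0 := (hx 0).1 (mem_positions.1 hT).1
      rw [con, if_neg (by omega), if_pos rfl, hβ, h0, map_zero, zero_smul]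
  · refine X_ext (g := r ∘ₗ theta f n) (h := LinearMap.id) (fun T hT x hx => ?_) hz
    have hl := hx.lastM ⟨0, (mem_positions.1 hT).1⟩
    have hc := hl.le
    have h0 : fstL f (x 0) = 0 := (hx 0).1 (mem_positions.1 hT).1
    -- Only the cut at `n + 1`, which is `1 ⊗ x_0 ⊗ ⋯ ⊗ x_n`, survives: the others start with `1 ⊗
    -- x_i` for some `i > c`, and `x_i ∈ A` has no component in `M`.
    rw [LinearMap.comp_apply, hl.theta_wd, cutSum_apply, Finset.sum_Ico_succ_top (by omega),
      map_add, map_sum, Finset.sum_eq_zero, zero_add, mul_comm (n + 1), map_smul,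
      (Nat.even_mul_succ_self n).neg_one_pow, one_smul, cutL_wd le_rfl, rot_self, hr]
    · refine wd_congr fun i _ => ?_
      unfold con
      split_ifs with h1 h2
      · omega
      · rw [h2, hβ]
        change ε 1 • projM f (x 0) = x 0
        rw [hε, one_smul, projM_of_fst h0]
      · rfl
    · intro i hi
      rw [Finset.mem_Ico] at hi
      rw [map_smul, cutL_wd (by omega), hr, wd_eq_zero_of_apply (Nat.zero_le n), smul_zero]
      rw [con, if_neg (by omega), if_pos rfl]
      refine hβ0 _ ?_
      rw [pre, if_neg (by omega), zero_add, Nat.sub_self, rot_zero_apply (by omega)]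
      exact hl.tail i (by omega) (by omega)

/-- The retraction first recovers the sum of the second components; separating weights makes these
vanish, and the same separation then applies to the first components. -/
theorem phi_injective {ε : A →ₗ[k] k} (hε : ε 1 = 1) (n : ℕ) : Function.Injective (phi f n) := by
  rw [injective_iff_map_eq_zero]
  intro p hp
  rw [phi_apply'] at hp
  have h2 : ∀ w, (p w).2 = 0 := by
    cases n with
    | zero => exact fun w => Subtype.ext (p w).2.2
    | succ n =>
      obtain ⟨r, hr1, hr2⟩ := exists_retraction (f := f) hε n
      have h := congrArg r hp
      rw [map_zero, map_add, map_sum, Finset.sum_eq_zero fun w _ => hr1 w _ (p w).1.2,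
        zero_add] at h
      let y : ∀ w, X f n w := fun w => (p w).2
      have h' : r (theta f n (∑ w ∈ Finset.range (n + 1 + 1),
        (y w : NormChains k (SqZeroExt f) n))) = 0 := h
      rw [map_sum, map_sum, Finset.sum_congr rfl fun w _ => hr2 w _ (y w).2] at h'
      exact fun w => Subtype.ext (eq_zero_of_sum_eq_zero _ (fun w => (y w).2) h' (by omega) w)
  simp only [h2, ZeroMemClass.coe_zero, Finset.sum_const_zero, map_zero, add_zero] at hp
  funext w
  exact Prod.ext (Subtype.ext (eq_zero_of_sum_eq_zero _ (fun w => (p w).1.2) hp (by omega) w)) (h2 w)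

end CommRing

theorem comparison_injective {k A M : Type*} [Field k] [Ring A] [Algebra k A]
    [AddCommGroup M] [Module k M] [Module A M] [Module Aᵐᵒᵖ M] [SMulCommClass A Aᵐᵒᵖ M]
    [IsScalarTower k A M] [IsScalarTower k Aᵐᵒᵖ M] (f : NormalCocycle k A M) (n : ℕ) :
    Function.Injective ((comparison f).f n) := by
  have h : Function.Injective (phi f n) := by
    rcases subsingleton_or_nontrivial A with hA | hA
    -- If `A = 0`, then the unit of `E` is zero, so `E` and all its chains are zero.
    · have h0 : ∀ v : SqZeroExt f, v = 0 := fun v =>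
        eq_zero_of_zero_eq_one (ext (Subsingleton.elim _ _) rfl) v
      have h1 : ∀ (n : ℕ) (z : NormChains k (SqZeroExt f) n), z = 0 := fun n z =>
        LinearMap.congr_fun (ext_wd (g := LinearMap.id) (h := 0) fun x =>
          wd_eq_zero_of_apply (Nat.zero_le n) (h0 (x 0))) z
      exact fun p q _ => funext fun w => Prod.ext
        (Subtype.ext ((h1 _ _).trans (h1 _ _).symm)) (Subtype.ext ((h1 _ _).trans (h1 _ _).symm))
    -- Over a field the line `k · 1` in `A ≠ 0` has a linear complement, which gives `ε` with `ε(1)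
    -- = 1`.
    · obtain ⟨ε, hε⟩ := LinearMap.exists_leftInverse_of_injective (Algebra.linearMap k A)
        (LinearMap.ker_eq_bot.2 (algebraMap k A).injective)
      refine phi_injective (ε := ε) ?_ n
      have := LinearMap.congr_fun hε 1
      simpa using this
  exact fun p q hpq => h (congrArg Subtype.val hpq)

end SqZeroExt

end

/-! ### The main theorem -/

theorem theorem3p2 {k A M : Type*} [Field k] [CharZero k] [Ring A] [Algebra k A]
    [AddCommGroup M] [Module k M] [Module A M] [Module Aᵐᵒᵖ M] [SMulCommClass A Aᵐᵒᵖ M]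
    [IsScalarTower k A M] [IsScalarTower k Aᵐᵒᵖ M] (f : NormalCocycle k A M) :
    (SqZeroExt.hatX f).IsDoubleMixedComplex ∧
    ∃ φ : (SqZeroExt.hatX f).assoc.Hom (relativeMixed (SqZeroExt.proj f)), ∀ n : ℤ,
      Function.Bijective (φ.mapHH n) ∧ Function.Bijective (φ.mapHC n) ∧
      Function.Bijective (φ.mapHP n) ∧ Function.Bijective (φ.mapHN n) := by
  have hD : (relativeMixed (SqZeroExt.proj f)).IsMixed :=
    MixedDiagram.Hom.isMixed_ker _ (isMixed_hochschildMixed k (SqZeroExt f))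
  have hinj := SqZeroExt.comparison_injective f
  have hacyclic := SqZeroExt.comparison_cokerAcyclic f
  refine ⟨DoubleMixedDiagram.isDoubleMixedComplex_of_assoc _
    ((SqZeroExt.comparison f).isMixed_of_injective hD hinj), SqZeroExt.comparison f, fun n => ?_⟩
  exact ⟨MixedDiagram.Hom.homologyMap_bijective _ hD hinj hacyclic _ n,
    MixedDiagram.Hom.homologyMap_bijective _ hD hinj hacyclic _ n,
    MixedDiagram.Hom.homologyMap_bijective _ hD hinj hacyclic _ n,
    MixedDiagram.Hom.homologyMap_bijective _ hD hinj hacyclic _ n⟩
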